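/- Let $b,c\in\mathrm{PSL}(2,\mathbb Z)$ be the classes of $\begin{pmatrix}0&1\\-1&0\end{pmatrix}$ and $\begin{pmatrix}0&1\\-1&1\end{pmatrix}$. For $n\ge 1$ let $\mathcal E_n$ be the finite set of pairs $(\sigma,\tau)$ of permutations in $S_{6n}$ such that $\sigma$ has order $2$, $\tau$ has order $3$, and neither has a fixed point, with the uniform probability measure and expectation $\mathbb E_n$. For $(\sigma,\tau)\in\mathcal E_n$ let $\Phi(\sigma,\tau):\mathrm{PSL}(2,\mathbb Z)\to S_{6n}$ be the unique homomorphism with $b\mapsto\sigma$, $c\mapsto\tau$. Let $\mathrm{std}$ be the $(6n-1)$-dimensional representation of $S_{6n}$ on the orthogonal complement of the constant vectors in $\mathbb C^{6n}$, and put $\mathrm{tr}\,\Pi_\gamma(\sigma,\tau)=\frac1{6n}\mathrm{Tr}\big(\mathrm{std}(\Phi(\sigma,\tau)(\gamma))\big)$ for $\gamma\in\mathrm{PSL}(2,\mathbb Z)$. Let $\lambda$ be the left regular representation of $\mathrm{PSL}(2,\mathbb Z)$ on $\ell^2(\mathrm{PSL}(2,\mathbb Z))$, extended linearly to $\mathbb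 C[\mathrm{PSL}(2,\mathbb Z)]$, and let $u_0(\gamma)=\langle\delta_e,\lambda(\gamma)\delta_e\rangle$. Then for every $\gamma\in\mathrm{PSL}(2,\mathbb Z)$ the limit $u_1(\gamma)=\lim_{n\to\infty}6n\big(\mathbb E_n[\mathrm{tr}\,\Pi_\gamma]-u_0(\gamma)\big)$ exists, and $$\mathbb E_n[\mathrm{tr}\,\Pi_\gamma]=u_0(\gamma)+\frac{u_1(\gamma)}{6n}+O_\gamma\!\left(\frac1{n^2}\right)\qquad(n\to\infty).$$ Extend $u_1$ linearly to $\mathbb C[\mathrm{PSL}(2,\mathbb Z)]$. For every self-adjoint $\alpha=\sum_\gamma a_\gamma\gamma=\sum_\gamma\overline{a_\gamma}\gamma^{-1}\in\mathbb C[\mathrm{PSL}(2,\mathbb Z)]$, $$\limsup_{p\to\infty}|u_1(\alpha^p)|^{1/p}\le\|\lambda(\alpha)\|,$$ where the right-hand side is the operator norm on $\ell^2(\mathrm{PSL}(2,\mathbb Z))$. -/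

import Mathlib

open Filter Topology Asymptotics
open scoped ENNReal

noncomputable section

namespace BrooksMakover

/-! ## The modular group `PSL(2, ℤ)` and its generators -/

/-- The modular group `PSL(2, ℤ)`: the quotient of `SL(2, ℤ)` by its centre `{1, -1}`. -/
abbrev PSL2Z : Type := Matrix.ProjectiveSpecialLinearGroup (Fin 2) ℤ

/-- The matrix `(0 1; -1 0)` in `SL(2, ℤ)`. -/
def bMat : Matrix.SpecialLinearGroup (Fin 2) ℤ :=
  ⟨!![0, 1; -1, 0], by simp [Matrix.det_fin_two]⟩

/-- The matrix `(0 1; -1 1)` in `SL(2, ℤ)`. -/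
def cMat : Matrix.SpecialLinearGroup (Fin 2) ℤ :=
  ⟨!![0, 1; -1, 1], by simp [Matrix.det_fin_two]⟩

/-- The class `b` of `(0 1; -1 0)` in `PSL(2, ℤ)`, of order two. -/
def b : PSL2Z := QuotientGroup.mk bMat

/-- The class `c` of `(0 1; -1 1)` in `PSL(2, ℤ)`, of order three. -/
def c : PSL2Z := QuotientGroup.mk cMat

theorem neg_one_mem_center :
    (-1 : Matrix.SpecialLinearGroup (Fin 2) ℤ) ∈
      Subgroup.center (Matrix.SpecialLinearGroup (Fin 2) ℤ) := by
  rw [Subgroup.mem_center_iff]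
  intro g
  simp

theorem b_sq : b ^ 2 = 1 := by
  have h : bMat ^ 2 = -1 := by
    apply Subtype.ext
    decide
  rw [b, ← QuotientGroup.mk_pow, h, QuotientGroup.eq_one_iff]
  exact neg_one_mem_center

theorem c_cube : c ^ 3 = 1 := by
  have h : cMat ^ 3 = -1 := by
    apply Subtype.ext
    decide
  rw [c, ← QuotientGroup.mk_pow, h, QuotientGroup.eq_one_iff]
  exact neg_one_mem_center

theorem closure_b_c : Subgroup.closure ({b, c} : Set PSL2Z) = ⊤ := by
  rw [eq_top_iff]
  have hb : b ∈ Subgroup.closure ({b, c} : Set PSL2Z) := Subgroup.subset_closure (by simp)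
  have hc : c ∈ Subgroup.closure ({b, c} : Set PSL2Z) := Subgroup.subset_closure (by simp)
  have hS : ModularGroup.S = bMat⁻¹ := by
    rw [eq_inv_iff_mul_eq_one]
    apply Subtype.ext
    decide
  have hT : ModularGroup.T = cMat⁻¹ * bMat := by
    rw [eq_inv_mul_iff_mul_eq]
    apply Subtype.ext
    decide
  have key : (⊤ : Subgroup (Matrix.SpecialLinearGroup (Fin 2) ℤ)) ≤
      (Subgroup.closure ({b, c} : Set PSL2Z)).comap (QuotientGroup.mk' _) := by
    rw [← SpecialLinearGroup.SL2Z_generators, Subgroup.closure_le]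
    rintro x (rfl | rfl)
    · rw [SetLike.mem_coe, Subgroup.mem_comap, QuotientGroup.mk'_apply, hS, QuotientGroup.mk_inv]
      exact inv_mem hb
    · rw [SetLike.mem_coe, Subgroup.mem_comap, QuotientGroup.mk'_apply, hT, QuotientGroup.mk_mul, QuotientGroup.mk_inv]
      exact mul_mem (inv_mem hc) hb
  intro x _
  obtain ⟨g, rfl⟩ := QuotientGroup.mk_surjective x
  exact key (Subgroup.mem_top g)

/-! ### `PSL(2, ℤ)` is the free product of `⟨b⟩` and `⟨c⟩` -/

/-- The homomorphism `ℤ/N → G` with `1 ↦ g`, for `g` with `g ^ N = 1`. -/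
def zmodHom {G : Type*} [Group G] (N : ℕ) (g : G) (hg : g ^ N = 1) :
    Multiplicative (ZMod N) →* G :=
  AddMonoidHom.toMultiplicativeLeft
    (ZMod.lift N ⟨zmultiplesHom (Additive G) (Additive.ofMul g), by
      simpa using congrArg Additive.ofMul hg⟩)

theorem zmodHom_ofAdd {G : Type*} [Group G] (N : ℕ) (g : G) (hg : g ^ N = 1) (k : ℕ) :
    zmodHom N g hg (Multiplicative.ofAdd (k : ZMod N)) = g ^ k := by
  have := ZMod.lift_coe N ⟨zmultiplesHom (Additive G) (Additive.ofMul g), by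
      simpa using congrArg Additive.ofMul hg⟩ (k : ℤ)
  simpa [zmodHom] using congrArg Additive.toMul this

/-- The two factors `ℤ/2` and `ℤ/3`. -/
abbrev Factor (i : Bool) : Type := Multiplicative (ZMod (cond i 3 2))

/-- Homomorphisms on the two factors, given by an involution and an element of order three. -/
def factorHom {G : Type*} [Group G] (s t : G) (hs : s ^ 2 = 1) (ht : t ^ 3 = 1) :
    (i : Bool) → Factor i →* G
  | false => zmodHom 2 s hs
  | true => zmodHom 3 t ht

/-- `SL(2, ℤ)` acting on `2 × 2` matrices by `g • N = g N gᵀ`. -/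
def slAction : Matrix.SpecialLinearGroup (Fin 2) ℤ →* Equiv.Perm (Matrix (Fin 2) (Fin 2) ℤ) :=
  MonoidHom.toHomPerm
    { toFun := fun g => (fun N => g.1 * N * g.1.transpose : Function.End _)
      map_one' := by
        funext N
        change 1 * N * Matrix.transpose 1 = N
        simp
      map_mul' := fun g h => by
        funext N
        change (g.1 * h.1) * N * (g.1 * h.1).transpose =
          g.1 * (h.1 * N * h.1.transpose) * g.1.transpose
        simp only [Matrix.mul_assoc, Matrix.transpose_mul] }

theorem slAction_apply (g : Matrix.SpecialLinearGroup (Fin 2) ℤ) (N : Matrix (Fin 2) (Fin 2) ℤ) :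
    slAction g N = g.1 * N * g.1.transpose := rfl

/-- The action `g • N = g N gᵀ` descended to `PSL(2, ℤ)`. -/
def pslAction : PSL2Z →* Equiv.Perm (Matrix (Fin 2) (Fin 2) ℤ) :=
  QuotientGroup.lift _ slAction (by
    intro g hg
    obtain ⟨r, hr, hg'⟩ := Matrix.SpecialLinearGroup.mem_center_iff.1 hg
    ext1 N
    have hr' : r * r = 1 := by simpa [pow_two] using hr
    rw [slAction_apply, ← hg', Matrix.scalar_apply, Matrix.diagonal_transpose]
    ext i j
    rw [Matrix.mul_diagonal, Matrix.diagonal_mul, mul_right_comm, hr', one_mul]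
    rfl)

/-- The sets `{v vᵀ : v₀ v₁ < 0}` and `{v vᵀ : v₀ v₁ > 0}`. -/
def pingPongSet : Bool → Set (Matrix (Fin 2) (Fin 2) ℤ)
  | false => {N | ∃ x y : ℤ, x * y < 0 ∧ N = !![x * x, x * y; y * x, y * y]}
  | true => {N | ∃ x y : ℤ, 0 < x * y ∧ N = !![x * x, x * y; y * x, y * y]}

theorem pslAction_b (x y : ℤ) : pslAction b !![x * x, x * y; y * x, y * y] =
    !![y * y, y * (-x); (-x) * y, (-x) * (-x)] := by
  change bMat.1 * _ * bMat.1.transpose = _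
  ext i j
  fin_cases i <;> fin_cases j <;>
    simp [bMat, Matrix.mul_apply, Fin.sum_univ_two]

theorem pslAction_c (x y : ℤ) : pslAction c !![x * x, x * y; y * x, y * y] =
    !![y * y, y * (y - x); (y - x) * y, (y - x) * (y - x)] := by
  change cMat.1 * _ * cMat.1.transpose = _
  ext i j
  fin_cases i <;> fin_cases j <;>
    simp [cMat, Matrix.mul_apply, Fin.sum_univ_two] <;> ring

theorem lift_factorHom_bijective :
    Function.Bijective (Monoid.CoprodI.lift (factorHom b c b_sq c_cube)) := by
  constructor
  · let _ : MulAction PSL2Z (Matrix (Fin 2) (Fin 2) ℤ) := MulAction.compHom _ pslAction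
    have hsm : ∀ (g : PSL2Z) (N : Matrix (Fin 2) (Fin 2) ℤ), g • N = pslAction g N :=
      fun _ _ => rfl
    refine Monoid.CoprodI.lift_injective_of_ping_pong _ (Or.inr ⟨true, ?_⟩) pingPongSet ?_ ?_ ?_
    · have h3 : Fintype.card (ZMod 3) = 3 := ZMod.card 3
      change 3 ≤ Cardinal.mk (ZMod 3)
      rw [Cardinal.mk_fintype, h3]
      norm_num
    · rintro (_ | _)
      · exact ⟨_, 1, -1, by norm_num, rfl⟩
      · exact ⟨_, 1, 1, by norm_num, rfl⟩
    · have key : Disjoint (pingPongSet false) (pingPongSet true) := by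
        rw [Set.disjoint_left]
        rintro _ ⟨x, y, h, rfl⟩ ⟨x', y', h', he⟩
        have := congrFun (congrFun he 0) 1
        simp at this
        omega
      rintro (_ | _) (_ | _) hij
      · exact absurd rfl hij
      · exact key
      · exact key.symm
      · exact absurd rfl hij
    · rintro (_ | _) (_ | _) hij h hne
      · exact absurd rfl hij
      · obtain rfl : h = Multiplicative.ofAdd ((1 : ℕ) : ZMod 2) := by
          have key : ∀ k : ZMod 2, k ≠ 0 → k = ((1 : ℕ) : ZMod 2) := by decide
          exact key h hne
        rintro _ ⟨_, ⟨x, y, hxy, rfl⟩, rfl⟩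
        change factorHom b c b_sq c_cube false _ • _ ∈ _
        rw [factorHom, zmodHom_ofAdd, pow_one, hsm, pslAction_b]
        exact ⟨y, -x, by nlinarith, rfl⟩
      · have h12 : h = Multiplicative.ofAdd ((1 : ℕ) : ZMod 3) ∨
            h = Multiplicative.ofAdd ((2 : ℕ) : ZMod 3) := by
          have key : ∀ k : ZMod 3, k ≠ 0 → k = ((1 : ℕ) : ZMod 3) ∨ k = ((2 : ℕ) : ZMod 3) := by
            decide
          exact key h hne
        rintro _ ⟨_, ⟨x, y, hxy, rfl⟩, rfl⟩
        change factorHom b c b_sq c_cube true _ • _ ∈ _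
        rcases h12 with rfl | rfl
        · rw [factorHom, zmodHom_ofAdd, pow_one, hsm, pslAction_c]
          exact ⟨y, y - x, by nlinarith [mul_self_nonneg y], rfl⟩
        · rw [factorHom, zmodHom_ofAdd, pow_two, hsm, map_mul, Equiv.Perm.mul_apply,
            pslAction_c, pslAction_c]
          exact ⟨y - x, y - x - y, by nlinarith [mul_self_nonneg x], rfl⟩
      · exact absurd rfl hij
  · rw [← MonoidHom.range_eq_top, eq_top_iff, ← closure_b_c, Subgroup.closure_le]
    rintro x (rfl | rfl)
    · refine ⟨Monoid.CoprodI.of (i := false) (Multiplicative.ofAdd ((1 : ℕ) : ZMod 2)), ?_⟩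
      rw [Monoid.CoprodI.lift_of, factorHom, zmodHom_ofAdd, pow_one]
    · refine ⟨Monoid.CoprodI.of (i := true) (Multiplicative.ofAdd ((1 : ℕ) : ZMod 3)), ?_⟩
      rw [Monoid.CoprodI.lift_of, factorHom, zmodHom_ofAdd, pow_one]

/-- The universal property of `PSL(2, ℤ)`: elements `s`, `t` of any group with `s² = 1` and
`t³ = 1` are the images of `b` and `c` under exactly one homomorphism. -/
theorem existsUnique_hom {G : Type*} [Group G] (s t : G) (hs : s ^ 2 = 1) (ht : t ^ 3 = 1) :
    ∃! φ : PSL2Z →* G, φ b = s ∧ φ c = t := by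
  let e := MulEquiv.ofBijective _ lift_factorHom_bijective
  have hb : e.symm b = Monoid.CoprodI.of (i := false)
      (Multiplicative.ofAdd ((1 : ℕ) : ZMod 2)) := by
    rw [MulEquiv.symm_apply_eq, MulEquiv.ofBijective_apply]
    rw [Monoid.CoprodI.lift_of, factorHom, zmodHom_ofAdd, pow_one]
  have hc : e.symm c = Monoid.CoprodI.of (i := true)
      (Multiplicative.ofAdd ((1 : ℕ) : ZMod 3)) := by
    rw [MulEquiv.symm_apply_eq, MulEquiv.ofBijective_apply]
    rw [Monoid.CoprodI.lift_of, factorHom, zmodHom_ofAdd, pow_one]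
  refine ⟨(Monoid.CoprodI.lift (factorHom s t hs ht)).comp e.symm.toMonoidHom, ⟨?_, ?_⟩, ?_⟩
  · change Monoid.CoprodI.lift (factorHom s t hs ht) (e.symm b) = s
    rw [hb, Monoid.CoprodI.lift_of, factorHom, zmodHom_ofAdd, pow_one]
  · change Monoid.CoprodI.lift (factorHom s t hs ht) (e.symm c) = t
    rw [hc, Monoid.CoprodI.lift_of, factorHom, zmodHom_ofAdd, pow_one]
  · rintro ψ ⟨h1, h2⟩
    refine MonoidHom.eq_of_eqOn_dense closure_b_c ?_
    rintro x (rfl | rfl)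
    · rw [h1]
      symm
      change Monoid.CoprodI.lift (factorHom s t hs ht) (e.symm b) = s
      rw [hb, Monoid.CoprodI.lift_of, factorHom, zmodHom_ofAdd, pow_one]
    · rw [h2]
      symm
      change Monoid.CoprodI.lift (factorHom s t hs ht) (e.symm c) = t
      rw [hc, Monoid.CoprodI.lift_of, factorHom, zmodHom_ofAdd, pow_one]

/-! ## The random homomorphisms `PSL(2, ℤ) → S_{6n}` -/

/-- The finite set `𝓔ₙ` of pairs `(σ, τ)` in `S_{6n}` such that `σ` has order two, `τ` has order
three, and neither has a fixed point. -/
def pairs (n : ℕ) : Finset (Equiv.Perm (Fin (6 * n)) × Equiv.Perm (Fin (6 * n))) :=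
  Finset.univ.filter fun p =>
    (orderOf p.1 = 2 ∧ ∀ i, p.1 i ≠ i) ∧ (orderOf p.2 = 3 ∧ ∀ i, p.2 i ≠ i)

theorem existsUnique_pairHom {n : ℕ} (p : pairs n) :
    ∃! φ : PSL2Z →* Equiv.Perm (Fin (6 * n)), φ b = p.1.1 ∧ φ c = p.1.2 := by
  have hp := (Finset.mem_filter.1 p.2).2
  refine existsUnique_hom _ _ ?_ ?_
  · rw [← hp.1.1, pow_orderOf_eq_one]
  · rw [← hp.2.1, pow_orderOf_eq_one]

/-- The homomorphism `Φ(σ, τ) : PSL(2, ℤ) → S_{6n}` with `b ↦ σ` and `c ↦ τ`. -/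
def pairHom {n : ℕ} (p : pairs n) : PSL2Z →* Equiv.Perm (Fin (6 * n)) :=
  (existsUnique_pairHom p).choose

theorem pairHom_b {n : ℕ} (p : pairs n) : pairHom p b = p.1.1 :=
  (existsUnique_pairHom p).choose_spec.1.1

theorem pairHom_c {n : ℕ} (p : pairs n) : pairHom p c = p.1.2 :=
  (existsUnique_pairHom p).choose_spec.1.2

/-- The permutation representation of `S_N` on `ℂ^N`, `(π v)(i) = v (π⁻¹ i)`. -/
def permRep (N : ℕ) : Representation ℂ (Equiv.Perm (Fin N)) (Fin N → ℂ) where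
  toFun π := LinearMap.funLeft ℂ ℂ ⇑(π⁻¹)
  map_one' := rfl
  map_mul' π π' := by
    rw [mul_inv_rev]
    rfl

/-- The orthogonal complement of the invariant (constant) vectors in `ℂ^N`. -/
def sumZero (N : ℕ) : Submodule ℂ (Fin N → ℂ) where
  carrier := {v | ∑ i, v i = 0}
  add_mem' := by
    intro v w hv hw
    simp only [Set.mem_ofPred_eq] at hv hw
    simp [Finset.sum_add_distrib, hv, hw]
  zero_mem' := by simp
  smul_mem' := by
    intro a v hv
    simp only [Set.mem_ofPred_eq] at hv
    simp [← Finset.mul_sum, hv]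

theorem permRep_mem_sumZero {N : ℕ} (π : Equiv.Perm (Fin N)) :
    ∀ v ∈ sumZero N, permRep N π v ∈ sumZero N := by
  intro v hv
  change ∑ i, v (π⁻¹ i) = 0
  rw [Equiv.sum_comp π⁻¹ v]
  exact hv

/-- The standard `(N - 1)`-dimensional representation `std` of `S_N`: the permutation
representation restricted to the orthogonal complement of the invariant vectors. -/
def stdRep (N : ℕ) : Representation ℂ (Equiv.Perm (Fin N)) (sumZero N) where
  toFun π := (permRep N π).restrict (permRep_mem_sumZero π)
  map_one' := by
    ext v : 2
    simp
  map_mul' π π' := by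
    ext v : 2
    simp

/-- The normalized trace `tr Π(σ, τ)(γ) = (6n)⁻¹ Tr (std (Φ(σ, τ)(γ)))`. -/
def normTrace {n : ℕ} (p : pairs n) (γ : PSL2Z) : ℂ :=
  (1 / (6 * n : ℂ)) * LinearMap.trace ℂ (sumZero (6 * n)) (stdRep (6 * n) (pairHom p γ))

/-- The expectation `𝔼ₙ[tr Π_γ]` with respect to the uniform probability on `𝓔ₙ`. -/
def meanTrace (n : ℕ) (γ : PSL2Z) : ℂ :=
  (∑ p : pairs n, normTrace p γ) / ((pairs n).card : ℂ)

/-! ## The regular representation -/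

/-- The Hilbert space `ℓ²(PSL(2, ℤ))`. -/
abbrev Ell2 : Type := lp (fun _ : PSL2Z => ℂ) 2

theorem memℓp_translate (γ : PSL2Z) (f : Ell2) :
    Memℓp (fun x : PSL2Z => f (γ⁻¹ * x)) 2 := by
  refine memℓp_gen ?_
  have h := (lp.memℓp f).summable (by norm_num)
  exact (Equiv.mulLeft γ⁻¹).summable_iff.2 h

/-- Left translation `(λ(γ) f)(x) = f (γ⁻¹ x)`, as a linear isometry of `ℓ²(PSL(2, ℤ))`. -/
def translate (γ : PSL2Z) : Ell2 →ₗᵢ[ℂ] Ell2 where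
  toFun f := ⟨fun x => f (γ⁻¹ * x), memℓp_translate γ f⟩
  map_add' f g := rfl
  map_smul' a f := rfl
  norm_map' f := by
    rw [lp.norm_eq_tsum_rpow (by norm_num), lp.norm_eq_tsum_rpow (by norm_num)]
    congr 1
    exact (Equiv.mulLeft γ⁻¹).tsum_eq (fun x => ‖f x‖ ^ (2 : ℝ≥0∞).toReal)

theorem translate_apply (γ : PSL2Z) (f : Ell2) (x : PSL2Z) :
    translate γ f x = f (γ⁻¹ * x) := rfl

/-- The regular representation `λ` of `PSL(2, ℤ)` by bounded operators on `ℓ²(PSL(2, ℤ))`. -/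
def regRep : PSL2Z →* (Ell2 →L[ℂ] Ell2) where
  toFun γ := (translate γ).toContinuousLinearMap
  map_one' := by
    ext f x
    change f (1⁻¹ * x) = f x
    simp
  map_mul' γ γ' := by
    ext f x
    change f ((γ * γ')⁻¹ * x) = f (γ'⁻¹ * (γ⁻¹ * x))
    rw [mul_inv_rev, mul_assoc]

/-- The linear extension of `λ` to the group algebra `ℂ[PSL(2, ℤ)]`. -/
def regAlg : MonoidAlgebra ℂ PSL2Z →ₐ[ℂ] (Ell2 →L[ℂ] Ell2) :=
  MonoidAlgebra.lift ℂ (Ell2 →L[ℂ] Ell2) PSL2Z regRep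

open scoped Classical in
/-- The canonical trace `ρ(T) = ⟨δ_e, T δ_e⟩`. -/
def canonTrace (T : Ell2 →L[ℂ] Ell2) : ℂ :=
  inner ℂ (lp.single 2 (1 : PSL2Z) (1 : ℂ) : Ell2) (T (lp.single 2 (1 : PSL2Z) (1 : ℂ)))

/-- `α = ∑ a_γ γ` is self-adjoint: `α = ∑ conj(a_γ) γ⁻¹`. -/
def IsSelfAdj (α : MonoidAlgebra ℂ PSL2Z) : Prop :=
  α = α.coeff.sum fun γ a => MonoidAlgebra.single γ⁻¹ (starRingEnd ℂ a)

/-! ## The first-order coefficient -/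

/-- The zeroth-order coefficient `u₀(γ) = ρ(λ(γ))`. -/
def u₀ (γ : PSL2Z) : ℂ := canonTrace (regRep γ)

/-- The first-order coefficient `u₁(γ)` in the expansion of `𝔼ₙ[tr Π_γ]` in powers of `1/(6n)`:
the limit of `6n (𝔼ₙ[tr Π_γ] - u₀(γ))` as `n → ∞`. -/
def u₁ (γ : PSL2Z) : ℂ :=
  limUnder atTop fun n : ℕ => (6 * n : ℂ) * (meanTrace n γ - u₀ γ)

/-- If `𝔼ₙ[tr Π_γ]` has an expansion of some order `m ≥ 2` in powers of `1/(6n)`, with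
zeroth-order coefficient `u₀(γ)`, then its first-order coefficient is `u₁(γ)`. -/
theorem eq_u₁_of_expansion (γ : PSL2Z) (a : ℕ → ℂ) (ha : a 0 = u₀ γ) (m : ℕ) (hm : 2 ≤ m)
    (K : ℝ) (hK : ∀ᶠ n : ℕ in atTop,
      ‖meanTrace n γ - ∑ i ∈ Finset.range m, a i / (6 * n : ℂ) ^ i‖ ≤ K / (6 * n : ℝ) ^ m) :
    a 1 = u₁ γ := by
  obtain ⟨k, rfl⟩ := Nat.exists_eq_add_of_le' hm
  have hx : Tendsto (fun n : ℕ => (6 * n : ℝ)⁻¹) atTop (𝓝 0) :=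
    tendsto_inv_atTop_zero.comp (tendsto_natCast_atTop_atTop.const_mul_atTop (by norm_num))
  have hxc : Tendsto (fun n : ℕ => (6 * n : ℂ)⁻¹) atTop (𝓝 0) := by
    have := (Complex.continuous_ofReal.tendsto 0).comp hx
    simpa [Function.comp_def] using this
  have h1 : Tendsto (fun n : ℕ => ∑ i ∈ Finset.range (k + 1), a (i + 1) * (6 * n : ℂ)⁻¹ ^ i)
      atTop (𝓝 (a 1)) := by
    have hs := tendsto_finsetSum (Finset.range (k + 1)) fun i _ =>
      (hxc.pow i).const_mul (a (i + 1))
    have he : ∑ i ∈ Finset.range (k + 1), a (i + 1) * (0 : ℂ) ^ i = a 1 := by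
      rw [Finset.sum_range_succ']
      simp
    rwa [he] at hs
  have h2 : Tendsto (fun n : ℕ => (6 * n : ℂ) *
      (meanTrace n γ - ∑ i ∈ Finset.range (k + 2), a i / (6 * n : ℂ) ^ i)) atTop (𝓝 0) := by
    have hb : Tendsto (fun n : ℕ => K * (6 * n : ℝ)⁻¹ ^ (k + 1)) atTop (𝓝 0) := by
      simpa using (hx.pow (k + 1)).const_mul K
    refine squeeze_zero_norm' ?_ hb
    filter_upwards [hK, eventually_gt_atTop 0] with n hn hpos
    have hp : (0 : ℝ) < 6 * n := by positivity
    rw [norm_mul]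
    have hnorm : ‖(6 * n : ℂ)‖ = 6 * n := by simp
    rw [hnorm]
    calc 6 * (n : ℝ) * _ ≤ 6 * n * (K / (6 * n : ℝ) ^ (k + 2)) := by gcongr
      _ = K * (6 * n : ℝ)⁻¹ ^ (k + 1) := by
        rw [inv_pow, pow_succ]
        field_simp
  refine (Tendsto.limUnder_eq ?_).symm
  have h3 := h1.add h2
  rw [add_zero] at h3
  refine h3.congr' ?_
  filter_upwards [eventually_gt_atTop 0] with n hpos
  have hp : (n : ℂ) ≠ 0 := by exact_mod_cast hpos.ne'
  rw [Finset.sum_range_succ' _ (k + 1), ha]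
  have hsum : ∑ i ∈ Finset.range (k + 1), a (i + 1) / (6 * n : ℂ) ^ (i + 1) =
      (6 * n : ℂ)⁻¹ * ∑ i ∈ Finset.range (k + 1), a (i + 1) * (6 * n : ℂ)⁻¹ ^ i := by
    rw [Finset.mul_sum]
    refine Finset.sum_congr rfl fun i _ => ?_
    rw [pow_succ, div_eq_mul_inv, mul_inv, inv_pow]
    ring
  rw [hsum]
  field_simp
  ring

/-- The linear extension of `u₁` to the group algebra `ℂ[PSL(2, ℤ)]`. -/
def u₁Alg (α : MonoidAlgebra ℂ PSL2Z) : ℂ := α.coeff.sum fun γ a => a * u₁ γ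

end BrooksMakover

end

/-!
The group `PSL(2, ℤ)` is the free product of `⟨b⟩ ≃ ℤ/2` and `⟨c⟩ ≃ ℤ/3`, and the trace of
`std ∘ Φ(σ, τ)` at `γ` is the number of fixed points of `Φ(σ, τ)(γ)` minus one.

*The expansion.* The identity, and the conjugates of `b`, `c` and `c²`, which act without fixed
points, are immediate. Any other `γ` is conjugate to a product `W` of `m` factors `b c` or `b c²`.
With `τ` fixed, the fixed points of `W` are the closed paths of length `m` that alternate between
steps of `σ` and rotations inside the 3-cycles ("triangles") of `τ`. A path that visits
`t` triangles and uses more than `2 t` points has too few degrees of freedom to matter: together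
such paths contribute `O(1 / n)`. A path that uses exactly two points in every triangle cannot turn
around, so it runs repeatedly around a simple cycle whose length `d` is a divisor of `m` and a
period of `W`; every such `d` contributes `1 + O(1 / n)`. Hence `u₁ γ` is the number of periods of
`W` minus one (`exists_abs_sum_card_fixed_sub_le`, `expansion_evalBC`). In particular `u₁` grows at
most linearly in the word length, and it vanishes except at elements of finite order and at proper
powers (`isElliptic_or_isHyperbolicPower`).

*The spectral radius.* For `|z| ‖λ(α)‖ < 1` let `g = (1 - z λ(α))⁻¹ δ_e` be Green's function, so
that `g(x) = ∑ zᵖ (αᵖ)(x)`. The operator `1 - z λ(α)` is accretive, and so is the compression of its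
inverse to a finite set. As the steps of `α` have bounded length, a ball of bounded radius separates
the Cayley graph, and this yields the approximate factorization
`|g(u v)| ≤ C ∑_{s, s'} |g(u s⁻¹)| |g(s' v)|` for products without cancellation, where `s` and `s'`
run over a fixed ball (`norm_green_le_sum`, `norm_green_mul_le`). Let it split
`v w ^ k v⁻¹ = (v w) (w ^ (k - 1) v⁻¹)` first, and then split off `v` and `v⁻¹`. Now `v` occurs in
two factors and `w` in two others, and `w ↦ w ^ (k - 1)` is injective on cyclically reduced
elements, so the Cauchy–Schwarz inequality bounds the sum of `|g|` over all `k`-th powers by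
`C' ‖g‖⁴`, uniformly in `k` (`sum_norm_green_hyperbolic_le`). Elements of finite order are similar
and easier (`sum_norm_green_elliptic_le`). So the power series `∑_q zᵠ u₁(α^q)`, with `u₁` cut off to the
support of `α ^ p`, is bounded on the circle `|z| = r` by a polynomial in `p` as soon as
`r ‖λ(α)‖ < 1`, and Cauchy's estimate for the coefficient of `zᵖ` gives
`|u₁(α ^ p)| ≤ poly(p) r⁻ᵖ` (`exists_norm_u₁Alg_pow_le`). Letting `r` tend to `1 / ‖λ(α)‖` proves
the claim.
-/

noncomputable section

namespace BrooksMakover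

/-! ### Reduced words in `PSL(2, ℤ)` -/

/-- A letter of a reduced word: `none` stands for `b`, `some false` for `c` and `some true`
for `c²`. Two letters lie in the same free factor when they agree under `Option.isSome`. -/
abbrev Letter : Type := Option Bool

namespace Letter

/-- The element of `PSL(2, ℤ)` that a letter stands for. -/
def eval : Letter → PSL2Z
  | none => b
  | some e => c ^ (e.toNat + 1)

/-- The letter of the inverse element. -/
def inv : Letter → Letter
  | none => none
  | some e => some (!e)

@[simp] theorem inv_inv (x : Letter) : x.inv.inv = x := by
  cases x <;> simp [inv]

@[simp] theorem isSome_inv (x : Letter) : x.inv.isSome = x.isSome := by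
  cases x <;> simp [inv]

theorem eval_mul_eval_inv (x : Letter) : x.eval * x.inv.eval = 1 := by
  rcases x with _ | (_ | _)
  · simpa [eval, inv, pow_two] using b_sq
  · simpa [eval, inv, pow_succ, mul_assoc] using c_cube
  · simpa [eval, inv, pow_succ, mul_assoc] using c_cube

theorem eval_inv (x : Letter) : x.inv.eval = x.eval⁻¹ :=
  eq_inv_of_mul_eq_one_right (eval_mul_eval_inv x)

theorem eval_some_mul_self (e : Bool) :
    eval (some e) * eval (some e) = eval (some !e) := by
  cases e
  · simp [eval, pow_two]
  · have : c ^ 2 * c ^ 2 = c ^ 3 * c := by group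
    simpa [eval, c_cube] using this

/-- The letter as an element of the disjoint union of the free factors. -/
def toSigma : Letter → Σ i, Factor i
  | none => ⟨false, Multiplicative.ofAdd ((1 : ℕ) : ZMod 2)⟩
  | some e => ⟨true, Multiplicative.ofAdd ((e.toNat + 1 : ℕ) : ZMod 3)⟩

theorem toSigma_fst (x : Letter) : x.toSigma.1 = x.isSome := by
  cases x <;> rfl

theorem toSigma_snd_ne_one (x : Letter) : x.toSigma.2 ≠ 1 := by
  rcases x with _ | (_ | _)
  · exact (by decide : ((1 : ℕ) : ZMod 2) ≠ 0)
  · exact (by decide : ((0 + 1 : ℕ) : ZMod 3) ≠ 0)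
  · exact (by decide : ((1 + 1 : ℕ) : ZMod 3) ≠ 0)

theorem exists_toSigma_eq (y : Σ i, Factor i) (hy : y.2 ≠ 1) : ∃ x : Letter, x.toSigma = y := by
  obtain ⟨_ | _, g⟩ := y
  · refine ⟨none, ?_⟩
    have key : ∀ k : ZMod 2, k ≠ 0 → k = ((1 : ℕ) : ZMod 2) := by decide
    have : g = Multiplicative.ofAdd ((1 : ℕ) : ZMod 2) := key g hy
    rw [this, toSigma]
  · have key : ∀ k : ZMod 3, k ≠ 0 → k = ((0 + 1 : ℕ) : ZMod 3) ∨ k = ((1 + 1 : ℕ) : ZMod 3) := by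
      decide
    have : g = Multiplicative.ofAdd ((0 + 1 : ℕ) : ZMod 3) ∨
      g = Multiplicative.ofAdd ((1 + 1 : ℕ) : ZMod 3) := key g hy
    rcases this with h | h
    · exact ⟨some false, by rw [h]; rfl⟩
    · exact ⟨some true, by rw [h]; rfl⟩

theorem toSigma_injective : Function.Injective toSigma := by
  have h3 : ((0 + 1 : ℕ) : ZMod 3) ≠ ((1 + 1 : ℕ) : ZMod 3) := by decide
  have key : ∀ e e' : Bool, toSigma (some e) = toSigma (some e') →
      ((e.toNat + 1 : ℕ) : ZMod 3) = ((e'.toNat + 1 : ℕ) : ZMod 3) := by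
    intro e e' h
    exact Multiplicative.ofAdd.injective (eq_of_heq (Sigma.mk.inj h).2)
  have hk : ∀ x y : Letter, toSigma x = toSigma y → x.isSome = y.isSome := by
    intro x y h
    rw [← toSigma_fst, ← toSigma_fst, h]
  rintro (_ | _ | _) (_ | _ | _) h
  · rfl
  · simpa using hk _ _ h
  · simpa using hk _ _ h
  · simpa using hk _ _ h
  · rfl
  · exact absurd (key _ _ h) h3
  · simpa using hk _ _ h
  · exact absurd (key _ _ h).symm h3
  · rfl

theorem factorHom_toSigma (x : Letter) :
    factorHom b c b_sq c_cube x.toSigma.1 x.toSigma.2 = x.eval := by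
  cases x with
  | none =>
    change zmodHom 2 b b_sq _ = b
    exact (zmodHom_ofAdd 2 b b_sq 1).trans (pow_one b)
  | some e =>
    change zmodHom 3 c c_cube _ = _
    exact zmodHom_ofAdd 3 c c_cube (e.toNat + 1)

end Letter

/-- A word is reduced when neighbouring letters lie in different free factors. -/
def Reduced (l : List Letter) : Prop := l.IsChain fun x y => x.isSome ≠ y.isSome

/-- The product in `PSL(2, ℤ)` of the letters of a word. -/
def evalWord (l : List Letter) : PSL2Z := (l.map Letter.eval).prod

@[simp] theorem evalWord_nil : evalWord [] = 1 := rfl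

@[simp] theorem evalWord_cons (x : Letter) (l : List Letter) :
    evalWord (x :: l) = x.eval * evalWord l := rfl

@[simp] theorem evalWord_append (l l' : List Letter) :
    evalWord (l ++ l') = evalWord l * evalWord l' := by
  simp [evalWord]

theorem evalWord_singleton (x : Letter) : evalWord [x] = x.eval := by simp

theorem evalWord_reverse_inv (l : List Letter) :
    evalWord (l.reverse.map Letter.inv) = (evalWord l)⁻¹ := by
  induction l with
  | nil => simp
  | cons x l ih =>
    rw [List.reverse_cons, List.map_append, evalWord_append, ih]
    simp [Letter.eval_inv]

theorem Reduced.reverse_inv {l : List Letter} (h : Reduced l) :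
    Reduced (l.reverse.map Letter.inv) := by
  unfold Reduced at *
  rw [List.isChain_map, List.isChain_reverse]
  exact h.imp fun x y hxy => by simpa using hxy.symm

/-- The reduced word of Mathlib's free product that corresponds to a reduced list of letters. -/
def Reduced.toWord {l : List Letter} (h : Reduced l) : Monoid.CoprodI.Word Factor where
  toList := l.map Letter.toSigma
  ne_one := by
    rintro _ hx
    obtain ⟨x, _, rfl⟩ := List.mem_map.1 hx
    exact x.toSigma_snd_ne_one
  chain_ne := by
    rw [List.isChain_map]
    exact List.IsChain.imp (fun x y hxy => by simpa [Letter.toSigma_fst] using hxy) h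

theorem lift_prod_toWord {l : List Letter} (h : Reduced l) :
    Monoid.CoprodI.lift (factorHom b c b_sq c_cube) h.toWord.prod = evalWord l := by
  rw [Monoid.CoprodI.Word.prod, map_list_prod, evalWord]
  simp only [Reduced.toWord, List.map_map]
  congr 1
  refine List.map_congr_left fun x _ => ?_
  simp only [Function.comp_apply, Monoid.CoprodI.lift_of]
  exact x.factorHom_toSigma

theorem Reduced.eq_of_evalWord_eq {l l' : List Letter} (h : Reduced l) (h' : Reduced l')
    (he : evalWord l = evalWord l') : l = l' := by
  classical
  rw [← lift_prod_toWord h, ← lift_prod_toWord h'] at he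
  have h1 := Monoid.CoprodI.Word.equiv.symm.injective (lift_factorHom_bijective.1 he)
  exact List.map_injective_iff.2 Letter.toSigma_injective (congrArg (fun w => w.toList) h1)

theorem exists_reduced (g : PSL2Z) : ∃ l, Reduced l ∧ evalWord l = g := by
  classical
  obtain ⟨x, rfl⟩ := lift_factorHom_bijective.2 g
  obtain ⟨w, rfl⟩ := Monoid.CoprodI.Word.equiv.symm.surjective x
  have key : ∀ L : List (Σ i, Factor i), (∀ y ∈ L, y.2 ≠ 1) →
      ∃ l : List Letter, l.map Letter.toSigma = L := by
    intro L
    induction L with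
    | nil => exact fun _ => ⟨[], rfl⟩
    | cons y L ih =>
      intro hL
      obtain ⟨x, hx⟩ := Letter.exists_toSigma_eq y (hL y (by simp))
      obtain ⟨l, hl⟩ := ih fun z hz => hL z (by simp [hz])
      exact ⟨x :: l, by simp [hx, hl]⟩
  obtain ⟨l, hl⟩ := key w.toList w.ne_one
  have hr : Reduced l := by
    have := w.chain_ne
    rw [← hl, List.isChain_map] at this
    exact List.IsChain.imp (fun x y hxy => by simpa [Letter.toSigma_fst] using hxy) this
  refine ⟨l, hr, ?_⟩
  rw [← lift_prod_toWord hr]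
  congr 1
  change _ = w.prod
  congr 1
  exact Monoid.CoprodI.Word.ext hl

/-- The reduced word of an element of `PSL(2, ℤ)`. -/
def nf (g : PSL2Z) : List Letter := (exists_reduced g).choose

theorem reduced_nf (g : PSL2Z) : Reduced (nf g) := (exists_reduced g).choose_spec.1

@[simp] theorem evalWord_nf (g : PSL2Z) : evalWord (nf g) = g := (exists_reduced g).choose_spec.2

theorem Reduced.nf_evalWord {l : List Letter} (h : Reduced l) : nf (evalWord l) = l :=
  (reduced_nf _).eq_of_evalWord_eq h (evalWord_nf _)

theorem nf_injective : Function.Injective nf :=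
  Function.LeftInverse.injective evalWord_nf

/-- The word length on `PSL(2, ℤ)` for the generating set `b, c, c²`. -/
def len (g : PSL2Z) : ℕ := (nf g).length

@[simp] theorem nf_one : nf 1 = [] := by
  simpa using Reduced.nf_evalWord (l := []) List.isChain_nil

@[simp] theorem nf_eval (x : Letter) : nf x.eval = [x] := by
  simpa using Reduced.nf_evalWord (l := [x]) (List.isChain_singleton x)

@[simp] theorem len_one : len 1 = 0 := by simp [len]

@[simp] theorem len_eval (x : Letter) : len x.eval = 1 := by simp [len]

theorem nf_inv (g : PSL2Z) : nf g⁻¹ = (nf g).reverse.map Letter.inv := by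
  rw [← (reduced_nf g).reverse_inv.nf_evalWord, evalWord_reverse_inv, evalWord_nf]

@[simp] theorem len_inv (g : PSL2Z) : len g⁻¹ = len g := by simp [len, nf_inv]

theorem head?_nf_inv (g : PSL2Z) : (nf g⁻¹).head? = (nf g).getLast?.map Letter.inv := by
  simp [nf_inv]

/-- `NoCancel p q` says that no letter cancels in the product `p * q`: the last letter of `p` is not
inverse to the first letter of `q`. The two letters may still merge into one letter. -/
def NoCancel (p q : PSL2Z) : Prop := ∀ x ∈ (nf p⁻¹).head?, x ∉ (nf q).head?

theorem NoCancel.symm {p q : PSL2Z} (h : NoCancel p q) : NoCancel q⁻¹ p⁻¹ := by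
  intro x hx hx'
  rw [_root_.inv_inv] at hx
  exact h x hx' hx

theorem noCancel_of_ne {p q : PSL2Z} (h : (nf p⁻¹).head? ≠ (nf q).head?) : NoCancel p q := by
  intro x hx hx'
  exact h (by rw [Option.mem_def.1 hx, Option.mem_def.1 hx'])

/-- The reduced word of a product without cancellation. -/
theorem NoCancel.nf_mul {p q : PSL2Z} (h : NoCancel p q) :
    nf (p * q) = nf p ++ nf q ∨ ∃ p' e q', nf p = p' ++ [some e] ∧ nf q = some e :: q' ∧
      nf (p * q) = p' ++ some (!e) :: q' := by
  rcases List.eq_nil_or_concat' (nf p) with hp | ⟨p', x, hp⟩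
  · left
    have : p = 1 := by rw [← evalWord_nf p, hp, evalWord_nil]
    simp [this]
  rcases hq : nf q with _ | ⟨y, q'⟩
  · left
    have : q = 1 := by rw [← evalWord_nf q, hq, evalWord_nil]
    simp [this]
  have rp := reduced_nf p
  have rq := reduced_nf q
  rw [hp] at rp
  rw [hq] at rq
  have hne : x.inv ≠ y := by
    intro hxy
    exact h y (by simp [head?_nf_inv, hp, hxy]) (by simp [hq])
  by_cases hk : x.isSome = y.isSome
  · right
    obtain ⟨e, rfl, rfl⟩ : ∃ e, x = some e ∧ y = some e := by
      rcases x with _ | e <;> rcases y with _ | e' <;> simp_all [Letter.inv]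
    refine ⟨p', e, q', by simpa using hp, rfl, ?_⟩
    have hr : Reduced (p' ++ some (!e) :: q') := by
      unfold Reduced at *
      rw [List.isChain_append] at rp ⊢
      rw [List.isChain_cons] at rq ⊢
      refine ⟨rp.1, ⟨fun z hz => ?_, rq.2⟩, fun z hz w hw => ?_⟩
      · simpa using rq.1 z hz
      · obtain rfl : w = some (!e) := by simpa using hw.symm
        simpa using rp.2.2 z hz (some e) (by simp)
    rw [← hr.nf_evalWord, ← evalWord_nf p, ← evalWord_nf q, hp, hq]
    simp [← Letter.eval_some_mul_self, mul_assoc]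
  · left
    have hr : Reduced (nf p ++ y :: q') := by
      rw [hp]
      unfold Reduced at *
      rw [List.isChain_append]
      refine ⟨rp, rq, fun z hz w hw => ?_⟩
      obtain rfl : z = x := by simpa using hz.symm
      obtain rfl : w = y := by simpa using hw.symm
      exact hk
    rw [← hr.nf_evalWord, ← hq, evalWord_append, evalWord_nf, evalWord_nf]

theorem NoCancel.len_left_le {p q : PSL2Z} (h : NoCancel p q) : len p ≤ len (p * q) := by
  unfold len
  rcases h.nf_mul with h | ⟨p', e, q', h1, h2, h3⟩
  · simp [h]
  · simp [h1, h3]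

theorem NoCancel.len_le {p q : PSL2Z} (h : NoCancel p q) : len (p * q) ≤ len p + len q := by
  unfold len
  rcases h.nf_mul with h | ⟨p', e, q', h1, h2, h3⟩
  · simp [h]
  · simp only [h1, h2, h3, List.length_append, List.length_cons]
    omega

theorem NoCancel.head?_mul {p q : PSL2Z} (h : NoCancel p q) (hp : 2 ≤ len p) :
    (nf (p * q)).head? = (nf p).head? := by
  unfold len at hp
  rcases h.nf_mul with h | ⟨p', e, q', h1, h2, h3⟩
  · rw [h, List.head?_append]
    cases hn : nf p <;> simp_all
  · rw [h1] at hp ⊢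
    rw [h3]
    cases p' <;> simp_all

theorem noCancel_or_eq (p : PSL2Z) (y : Letter) :
    NoCancel p y.eval ∨ nf p = nf (p * y.eval) ++ [y.inv] := by
  by_cases h : NoCancel p y.eval
  · exact Or.inl h
  right
  unfold NoCancel at h
  push Not at h
  obtain ⟨x, hx, hy⟩ := h
  obtain rfl : y = x := by simpa using hy
  rw [head?_nf_inv, Option.mem_def, Option.map_eq_some_iff] at hx
  obtain ⟨z, hz, rfl⟩ := hx
  rcases List.eq_nil_or_concat' (nf p) with hp | ⟨p', x, hp⟩
  · simp [hp] at hz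
  obtain rfl : x = z := by simpa [hp] using hz
  have hr : Reduced p' := by
    have := reduced_nf p
    rw [hp] at this
    unfold Reduced at *
    rw [List.isChain_append] at this
    exact this.1
  have : p * x.inv.eval = evalWord p' := by
    rw [← evalWord_nf p, hp]
    simp [mul_assoc, Letter.eval_mul_eval_inv]
  rw [this, hr.nf_evalWord, Letter.inv_inv, hp]

theorem len_mul_eval_le (p : PSL2Z) (y : Letter) : len (p * y.eval) ≤ len p + 1 := by
  rcases noCancel_or_eq p y with h | h
  · simpa using h.len_le
  · have := congrArg List.length h
    rw [List.length_append, List.length_singleton] at this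
    change (nf (p * y.eval)).length ≤ (nf p).length + 1
    omega

theorem len_le_len_mul_eval (p : PSL2Z) (y : Letter) : len p ≤ len (p * y.eval) + 1 := by
  rcases noCancel_or_eq p y with h | h
  · exact h.len_left_le.trans (Nat.le_succ _)
  · have := congrArg List.length h
    rw [List.length_append, List.length_singleton] at this
    exact this.le

theorem head?_mul_eval (p : PSL2Z) (y : Letter) (hp : 2 ≤ len p) :
    (nf (p * y.eval)).head? = (nf p).head? := by
  rcases noCancel_or_eq p y with h | h
  · exact h.head?_mul hp
  · unfold len at hp
    rw [h] at hp ⊢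
    cases hn : nf (p * y.eval) <;> simp_all

theorem len_mul_le (p q : PSL2Z) : len (p * q) ≤ len p + len q := by
  rw [← evalWord_nf q]
  have : len (evalWord (nf q)) = (nf q).length := by rw [evalWord_nf, len]
  rw [this]
  induction nf q using List.reverseRecOn with
  | nil => simp
  | append_singleton l x ih =>
    rw [evalWord_append, evalWord_singleton, ← mul_assoc]
    have := len_mul_eval_le (p * evalWord l) x
    simp only [List.length_append, List.length_singleton]
    omega

/-- A factor on the right that is shorter than `p` does not change the first letter of `p`. -/
theorem head?_mul_of_len_lt {p q : PSL2Z} (h : len q < len p) :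
    (nf (p * q)).head? = (nf p).head? := by
  have key : ∀ l : List Letter, l.length < len p →
      len p ≤ len (p * evalWord l) + l.length ∧
        (nf (p * evalWord l)).head? = (nf p).head? := by
    intro l
    induction l using List.reverseRecOn with
    | nil => simp
    | append_singleton l x ih =>
      intro hl
      simp only [List.length_append, List.length_singleton] at hl
      obtain ⟨h1, h2⟩ := ih (by omega)
      rw [evalWord_append, evalWord_singleton, ← mul_assoc, ← h2]
      have := len_le_len_mul_eval (p * evalWord l) x
      refine ⟨?_, head?_mul_eval _ _ (by omega)⟩
      simp only [List.length_append, List.length_singleton]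
      omega
  have := (key (nf q) h).2
  rwa [evalWord_nf] at this

theorem finite_len_le (R : ℕ) : {g : PSL2Z | len g ≤ R}.Finite :=
  Set.Finite.of_injOn (f := nf) (t := {l : List Letter | l.length ≤ R}) (fun _ h => h)
    nf_injective.injOn (List.finite_length_le _ _)

/-- The elements of word length at most `R`. -/
def ball (R : ℕ) : Finset PSL2Z := (finite_len_le R).toFinset

@[simp] theorem mem_ball {R : ℕ} {g : PSL2Z} : g ∈ ball R ↔ len g ≤ R := by simp [ball]

/-! ### Conjugacy and cyclically reduced elements -/

theorem eq_eval_mul_of_mem_head? {g : PSL2Z} {x : Letter} (hx : x ∈ (nf g).head?) :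
    ∃ g', g = x.eval * g' ∧ len g = len g' + 1 ∧ (nf g).getLast? = (nf g').getLast?.or (some x) := by
  cases hn : nf g with
  | nil => simp [hn] at hx
  | cons y l =>
    obtain rfl : y = x := by simpa [hn] using hx
    have hr : Reduced l := by
      have := reduced_nf g
      rw [hn] at this
      exact List.IsChain.tail this
    refine ⟨evalWord l, ?_, ?_, ?_⟩
    · rw [← evalWord_nf g, hn, evalWord_cons]
    · simp [len, hn, hr.nf_evalWord]
    · rw [hr.nf_evalWord, List.getLast?_cons]
      cases l.getLast? <;> simp

/-- An element is cyclically reduced when its reduced word starts and ends in different free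
factors. -/
def CyclicallyReduced (w : PSL2Z) : Prop :=
  2 ≤ len w ∧ ∀ x ∈ (nf w).head?, ∀ y ∈ (nf w).getLast?, y.isSome ≠ x.isSome

/-- Conjugating by an initial letter of both `w` and `v⁻¹` shortens `v` without lengthening `w`. -/
theorem exists_shorter_conj {v w : PSL2Z} (h : ¬ NoCancel v w) :
    ∃ v' w', v * w * v⁻¹ = v' * w' * v'⁻¹ ∧ len w' ≤ len w ∧ len v' < len v := by
  unfold NoCancel at h
  push Not at h
  obtain ⟨x, hx, hy⟩ := h
  obtain ⟨v', hv', hlv, -⟩ := eq_eval_mul_of_mem_head? hx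
  obtain ⟨w', hw', hlw, -⟩ := eq_eval_mul_of_mem_head? hy
  refine ⟨v'⁻¹, w' * x.eval, ?_, ?_, ?_⟩
  · rw [hw', ← inv_inv v, hv']
    group
  · have := len_mul_eval_le w' x
    omega
  · rw [len_inv] at hlv ⊢
    omega

/-- Every element is conjugate to one of length at most one or to a cyclically reduced one, by a
conjugation without cancellation. -/
theorem exists_conj (g : PSL2Z) : ∃ v w, g = v * w * v⁻¹ ∧ NoCancel v w ∧ NoCancel w v⁻¹ ∧
    len w ≤ len g ∧ (2 ≤ len w → CyclicallyReduced w) := by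
  -- Minimize first the length of `w`, then the length of `v`.
  obtain ⟨⟨v, w⟩, h, hmin⟩ := (InvImage.wf (fun p : PSL2Z × PSL2Z => toLex (len p.2, len p.1))
    wellFounded_lt).has_min {p | g = p.1 * p.2 * p.1⁻¹} ⟨(1, g), by simp⟩
  simp only [Set.mem_ofPred_eq, InvImage, Prod.Lex.toLex_lt_toLex, Prod.forall] at h hmin
  have hmin' : ∀ v' w', g = v' * w' * v'⁻¹ → len w ≤ len w' := fun v' w' h' => by
    have := hmin v' w' h'
    omega
  refine ⟨v, w, h, ?_, ?_, by simpa using hmin' 1 g (by simp), fun h2 => ⟨h2, fun x hx y hy he => ?_⟩⟩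
  · by_contra hc
    obtain ⟨v', w', h1, h2, h3⟩ := exists_shorter_conj hc
    have := hmin v' w' (h.trans h1)
    omega
  · by_contra hc
    have hc' : ¬ NoCancel v w⁻¹ := fun h' => hc (by simpa using h'.symm)
    obtain ⟨v', w', h1, h2, h3⟩ := exists_shorter_conj hc'
    have h4 : g = v' * w'⁻¹ * v'⁻¹ := by
      rw [← inv_inj] at h1
      rw [h]
      simpa [mul_assoc] using h1
    have := hmin v' w'⁻¹ h4
    rw [len_inv] at h2 this
    omega
  · obtain ⟨w', hw', hlw, hlast⟩ := eq_eval_mul_of_mem_head? hx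
    have h5 := hmin' (v * x.eval) (w' * x.eval) (by rw [h, hw']; group)
    have hy' : y ∈ (nf w').getLast? := by
      have hne : nf w' ≠ [] := by
        intro h0
        have : len w' = 0 := by simp [len, h0]
        omega
      rw [List.getLast?_eq_some_getLast hne] at hlast ⊢
      rw [hlast] at hy
      simpa using hy
    rcases noCancel_or_eq w' x with hn | hn
    · rcases hn.nf_mul with h6 | ⟨p', e, q', h7, h8, h9⟩
      · have hr := reduced_nf (w' * x.eval)
        unfold Reduced at hr
        rw [h6, List.isChain_append] at hr
        exact hr.2.2 y hy' x (by simp) he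
      · have : len (w' * x.eval) = len w' := by
          have h10 : q' = [] := by
            have := congrArg List.length h8
            simpa using this
          simp [len, h7, h9, h10]
        omega
    · have := congrArg List.length hn
      rw [List.length_append, List.length_singleton] at this
      change len w' = len (w' * x.eval) + 1 at this
      omega

theorem nf_mul_of_reduced {p q : PSL2Z} (h : Reduced (nf p ++ nf q)) :
    nf (p * q) = nf p ++ nf q := by
  rw [← h.nf_evalWord, evalWord_append, evalWord_nf, evalWord_nf]

theorem CyclicallyReduced.inv {w : PSL2Z} (h : CyclicallyReduced w) : CyclicallyReduced w⁻¹ := by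
  refine ⟨by simpa using h.1, fun x hx y hy => ?_⟩
  rw [nf_inv] at hx hy
  simp only [List.head?_map, List.head?_reverse, List.getLast?_map, List.getLast?_reverse,
    Option.mem_def, Option.map_eq_some_iff] at hx hy
  obtain ⟨x, hx, rfl⟩ := hx
  obtain ⟨y, hy, rfl⟩ := hy
  simpa using (h.2 y hy x hx).symm

theorem CyclicallyReduced.nf_pow_succ {w : PSL2Z} (h : CyclicallyReduced w) (k : ℕ) :
    nf (w ^ (k + 1)) = nf w ++ nf (w ^ k) ∧ (nf (w ^ (k + 1))).head? = (nf w).head? := by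
  have hne : nf w ≠ [] := by
    intro h0
    have := h.1
    simp [len, h0] at this
  induction k with
  | zero => simp
  | succ k ih =>
    have h1 : nf (w ^ (k + 1 + 1)) = nf w ++ nf (w ^ (k + 1)) := by
      rw [pow_succ' w (k + 1)]
      apply nf_mul_of_reduced
      refine List.isChain_append.2 ⟨reduced_nf _, reduced_nf _, fun x hx y hy => ?_⟩
      rw [ih.2] at hy
      exact h.2 y hy x hx
    refine ⟨h1, ?_⟩
    rw [h1, List.head?_append_of_ne_nil _ hne]

theorem CyclicallyReduced.head?_pow {w : PSL2Z} (h : CyclicallyReduced w) {k : ℕ} (hk : k ≠ 0) :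
    (nf (w ^ k)).head? = (nf w).head? := by
  obtain ⟨k, rfl⟩ := Nat.exists_eq_succ_of_ne_zero hk
  exact (h.nf_pow_succ k).2

theorem CyclicallyReduced.len_pow {w : PSL2Z} (h : CyclicallyReduced w) (k : ℕ) :
    len (w ^ k) = k * len w := by
  induction k with
  | zero => simp
  | succ k ih =>
    have := congrArg List.length (h.nf_pow_succ k).1
    rw [List.length_append] at this
    change len _ = len w + len (w ^ k) at this
    rw [this, ih]
    ring

/-- Taking a fixed positive power is injective on cyclically reduced elements. -/
theorem CyclicallyReduced.eq_of_pow_eq {w w' : PSL2Z} (h : CyclicallyReduced w)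
    (h' : CyclicallyReduced w') {k : ℕ} (hk : k ≠ 0) (he : w ^ k = w' ^ k) : w = w' := by
  have hlen : len w = len w' := by
    have := congrArg len he
    rw [h.len_pow, h'.len_pow] at this
    exact Nat.eq_of_mul_eq_mul_left (Nat.pos_of_ne_zero hk) this
  obtain ⟨k, rfl⟩ := Nat.exists_eq_succ_of_ne_zero hk
  have h1 := congrArg nf he
  rw [Nat.succ_eq_add_one, (h.nf_pow_succ k).1, (h'.nf_pow_succ k).1] at h1
  exact nf_injective (List.append_inj h1 hlen).1

theorem CyclicallyReduced.head?_ne_head?_inv {w : PSL2Z} (h : CyclicallyReduced w) :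
    ∀ x ∈ (nf w).head?, x ∉ (nf w⁻¹).head? := by
  intro x hx hx'
  rw [head?_nf_inv, Option.mem_def, Option.map_eq_some_iff] at hx'
  obtain ⟨y, hy, rfl⟩ := hx'
  exact h.2 _ hx y hy (by simp)

/-- The product of the elements `b * c ^ (e + 1)`, for `e` in a list of Booleans read as `0` and
`1`. -/
def evalBC (es : List Bool) : PSL2Z := (es.map fun e => b * c ^ (e.toNat + 1)).prod

theorem evalWord_flatMap (es : List Bool) :
    evalWord (es.flatMap fun e => [none, some e]) = evalBC es := by
  induction es with
  | nil => rfl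
  | cons e es ih =>
    rw [List.flatMap_cons, evalWord_append, ih]
    simp [evalBC, Letter.eval]

theorem Reduced.exists_eq_flatMap : ∀ {l : List Letter}, Reduced l → (∀ x ∈ l.head?, x = none) →
    (∀ x ∈ l.getLast?, x ≠ none) → ∃ es : List Bool, l = es.flatMap fun e => [none, some e]
  | [], _, _, _ => ⟨[], rfl⟩
  | [x], _, h1, h2 => absurd (h1 x (by simp)) (h2 x (by simp))
  | x :: y :: l, h, h1, h2 => by
    obtain rfl : x = none := h1 x (by simp)
    have hxy := List.isChain_cons_cons.1 h
    obtain ⟨e, rfl⟩ : ∃ e, y = some e := by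
      rcases y with _ | e
      · exact absurd rfl hxy.1
      · exact ⟨e, rfl⟩
    obtain ⟨es, hes⟩ := Reduced.exists_eq_flatMap (l := l) hxy.2.tail
      (fun z hz => by
        have := (List.isChain_cons.1 hxy.2).1 z hz
        cases z <;> simp_all)
      (fun z hz => h2 z (by
        rcases l with _ | ⟨a, l⟩
        · simp at hz
        · simpa using hz))
    exact ⟨e :: es, by rw [List.flatMap_cons, ← hes]; rfl⟩

/-- A cyclically reduced element is conjugate to a product of elements `b * c` and `b * c ^ 2`. -/
theorem CyclicallyReduced.exists_eq_evalBC {w : PSL2Z} (h : CyclicallyReduced w) :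
    ∃ v es, es ≠ [] ∧ 2 * es.length = len w ∧ w = v * evalBC es * v⁻¹ := by
  have main : ∀ l : List Letter, Reduced l → (∀ x ∈ l.head?, x = none) →
      (∀ x ∈ l.getLast?, x ≠ none) → l.length = len w →
      ∃ es, es ≠ [] ∧ 2 * es.length = len w ∧ evalWord l = evalBC es := by
    intro l hr h1 h2 hl
    obtain ⟨es, rfl⟩ := hr.exists_eq_flatMap h1 h2
    have hlen : 2 * es.length = len w := by
      rw [← hl, List.length_flatMap]
      simp [mul_comm]
    refine ⟨es, ?_, hlen, evalWord_flatMap es⟩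
    rintro rfl
    have := h.1
    simp at hlen
    omega
  rcases hn : nf w with _ | ⟨x, l⟩
  · have := h.1
    simp [len, hn] at this
  have hne : l ≠ [] := by
    rintro rfl
    have := h.1
    simp [len, hn] at this
  have hlast : (nf w).getLast? = l.getLast? := by
    rw [hn, List.getLast?_cons_of_ne_nil hne]
  have hr := reduced_nf w
  rw [hn] at hr
  have h2 := h.2 x (by simp [hn])
  rw [hlast] at h2
  rcases x with _ | e
  · obtain ⟨es, h3, h4, h5⟩ := main (nf w) (reduced_nf w) (by simp [hn])
      (fun y hy => by
        rw [hlast] at hy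
        have := h2 y hy
        rintro rfl
        simp at this) rfl
    exact ⟨1, es, h3, h4, by simpa using h5⟩
  · obtain ⟨es, h3, h4, h5⟩ := main (l ++ [some e])
      (List.isChain_append.2 ⟨List.IsChain.tail hr, List.isChain_singleton _, fun y hy z hz => by
        obtain rfl : z = some e := by simpa using hz.symm
        exact h2 y hy⟩)
      (fun y hy => by
        rw [List.head?_append_of_ne_nil _ hne] at hy
        have := (List.isChain_cons.1 hr).1 y hy
        cases y <;> simp_all) (by simp) (by simp [len, hn])
    refine ⟨Letter.eval (some e), es, h3, h4, ?_⟩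
    rw [← h5, evalWord_append, evalWord_singleton, ← evalWord_nf w, hn, evalWord_cons]
    group

/-! ### Random involutions without fixed points -/

/-- The permutations of `Fin N` of order two without fixed points. -/
def involutions (N : ℕ) : Finset (Equiv.Perm (Fin N)) :=
  Finset.univ.filter fun σ => orderOf σ = 2 ∧ ∀ i, σ i ≠ i

theorem mem_involutions {N : ℕ} {σ : Equiv.Perm (Fin N)} :
    σ ∈ involutions N ↔ orderOf σ = 2 ∧ ∀ i, σ i ≠ i := by
  simp [involutions]

theorem apply_apply_of_mem_involutions {N : ℕ} {σ : Equiv.Perm (Fin N)}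
    (h : σ ∈ involutions N) (x : Fin N) : σ (σ x) = x := by
  have : σ ^ 2 = 1 := by rw [← (mem_involutions.1 h).1, pow_orderOf_eq_one]
  rw [← Equiv.Perm.mul_apply, ← pow_two, this, Equiv.Perm.one_apply]

theorem conj_mem_involutions {N : ℕ} {σ : Equiv.Perm (Fin N)} (h : σ ∈ involutions N)
    (π : Equiv.Perm (Fin N)) : π * σ * π⁻¹ ∈ involutions N := by
  rw [mem_involutions] at *
  refine ⟨?_, fun i hi => h.2 (π⁻¹ i) ?_⟩
  · rw [← h.1]
    exact orderOf_injective (MulAut.conj π).toMonoidHom (MulAut.conj π).injective σ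
  · rw [Equiv.Perm.eq_inv_iff_eq]
    simpa using hi

/-- The involutions that interchange `x i` and `y i` for every `i`. -/
def involutionsThrough {N : ℕ} {ι : Type*} [Fintype ι] (x y : ι → Fin N) :
    Finset (Equiv.Perm (Fin N)) :=
  (involutions N).filter fun σ => ∀ i, σ (x i) = y i

theorem mem_involutionsThrough {N : ℕ} {ι : Type*} [Fintype ι] {x y : ι → Fin N}
    {σ : Equiv.Perm (Fin N)} :
    σ ∈ involutionsThrough x y ↔ σ ∈ involutions N ∧ ∀ i, σ (x i) = y i := by
  simp [involutionsThrough]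

/-- If `e` pairs are already prescribed, the partner of one more point is uniformly distributed
among the `N - 1 - 2 * e` free points. -/
theorem card_involutionsThrough_castSucc {N e : ℕ} (x y : Fin (e + 1) → Fin N)
    (h : Function.Injective (Sum.elim x y)) :
    (involutionsThrough (fun i : Fin e => x i.castSucc) (fun i : Fin e => y i.castSucc)).card =
      (N - 1 - 2 * e) * (involutionsThrough x y).card := by
  have hx : ∀ i j, x i = x j → i = j := fun i j hij =>
    Sum.inl_injective (h (a₁ := Sum.inl i) (a₂ := Sum.inl j) hij)
  have hy : ∀ i j, y i = y j → i = j := fun i j hij =>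
    Sum.inr_injective (h (a₁ := Sum.inr i) (a₂ := Sum.inr j) hij)
  have hxy : ∀ i j, x i ≠ y j := fun i j hij =>
    absurd (h (a₁ := Sum.inl i) (a₂ := Sum.inr j) hij) (by simp)
  set F := involutionsThrough (fun i : Fin e => x i.castSucc) (fun i : Fin e => y i.castSucc)
  let f : Fin (e + 1) ⊕ Fin e → Fin N := Sum.elim x (fun i => y i.castSucc)
  have hf : Function.Injective f := by
    rintro (i | i) (j | j) hij
    · exact congrArg _ (hx i j hij)
    · exact absurd hij (hxy _ _)
    · exact absurd hij.symm (hxy _ _)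
    · exact congrArg _ (Fin.castSucc_injective _ (hy _ _ hij))
  set Y : Finset (Fin N) := (Finset.univ.image f)ᶜ
  have hYcard : Y.card = N - 1 - 2 * e := by
    rw [Finset.card_compl, Finset.card_image_of_injective _ hf]
    simp
    omega
  have hmap : ∀ σ ∈ F, σ (x (Fin.last e)) ∈ Y := by
    intro σ hσ
    rw [mem_involutionsThrough] at hσ
    rw [Finset.mem_compl, Finset.mem_image]
    rintro ⟨i | i, -, hi⟩
    · induction i using Fin.lastCases with
      | last => exact (mem_involutions.1 hσ.1).2 _ hi.symm
      | cast i =>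
        have h1 := hσ.2 i
        change x i.castSucc = _ at hi
        rw [hi, apply_apply_of_mem_involutions hσ.1] at h1
        exact hxy _ _ h1
    · change y i.castSucc = _ at hi
      rw [← hσ.2 i, σ.apply_eq_iff_eq] at hi
      exact absurd (hx _ _ hi) (Fin.castSucc_lt_last i).ne
  rw [Finset.card_eq_sum_card_fiberwise hmap, ← hYcard, ← smul_eq_mul]
  refine Finset.sum_eq_card_nsmul fun z hz => ?_
  -- Conjugation by the transposition of `z` and `y (last e)` fixes all other prescribed points.
  have hz' : ∀ a, f a ≠ z := fun a ha => by
    rw [Finset.mem_compl, Finset.mem_image] at hz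
    exact hz ⟨a, Finset.mem_univ _, ha⟩
  set π := Equiv.swap z (y (Fin.last e))
  have hπx : ∀ i, π (x i) = x i := fun i =>
    Equiv.swap_apply_of_ne_of_ne (hz' (Sum.inl i)) (hxy _ _)
  have hπy : ∀ i : Fin e, π (y i.castSucc) = y i.castSucc := fun i =>
    Equiv.swap_apply_of_ne_of_ne (hz' (Sum.inr i))
      fun h' => absurd (hy _ _ h') (Fin.castSucc_lt_last i).ne
  have hπi : π⁻¹ = π := Equiv.swap_inv _ _
  have hππ : ∀ u, π (π u) = u := fun u => Equiv.swap_apply_self _ _ u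
  refine Finset.card_nbij' (fun σ => π * σ * π⁻¹) (fun σ => π * σ * π⁻¹) ?_ ?_ ?_ ?_
  · intro σ hσ
    rw [Finset.mem_coe, Finset.mem_filter, mem_involutionsThrough] at hσ
    rw [Finset.mem_coe, mem_involutionsThrough]
    refine ⟨conj_mem_involutions hσ.1.1 π, fun i => ?_⟩
    rw [hπi, Equiv.Perm.mul_apply, Equiv.Perm.mul_apply, hπx]
    induction i using Fin.lastCases with
    | last => rw [hσ.2, Equiv.swap_apply_left]
    | cast i => rw [hσ.1.2, hπy]
  · intro σ hσ
    rw [Finset.mem_coe, mem_involutionsThrough] at hσ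
    rw [Finset.mem_coe, Finset.mem_filter, mem_involutionsThrough]
    refine ⟨⟨conj_mem_involutions hσ.1 π, fun i => ?_⟩, ?_⟩
    · rw [hπi, Equiv.Perm.mul_apply, Equiv.Perm.mul_apply, hπx, hσ.2, hπy]
    · rw [hπi, Equiv.Perm.mul_apply, Equiv.Perm.mul_apply, hπx, hσ.2, Equiv.swap_apply_right]
  · intro σ _
    ext u
    simp [hπi, hππ]
  · intro σ _
    ext u
    simp [hπi, hππ]

/-- For `2 * e` distinct points, a uniformly random involution without fixed points interchanges
`x i` and `y i` for all `i : Fin e` with probability `∏ i < e, (N - 1 - 2 * i)⁻¹`. -/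
theorem card_involutionsThrough_mul_prod {N : ℕ} : ∀ {e : ℕ} (x y : Fin e → Fin N),
    Function.Injective (Sum.elim x y) →
    (involutionsThrough x y).card * ∏ i ∈ Finset.range e, (N - 1 - 2 * i) = (involutions N).card
  | 0, x, y, _ => by
    simp [involutionsThrough]
  | e + 1, x, y, h => by
    have h' : Function.Injective
        (Sum.elim (fun i : Fin e => x i.castSucc) (fun i : Fin e => y i.castSucc)) := by
      have := h.comp (Function.Injective.sumMap (Fin.castSucc_injective e) (Fin.castSucc_injective e))
      rwa [Sum.elim_comp_map] at this
    rw [← card_involutionsThrough_mul_prod _ _ h', card_involutionsThrough_castSucc x y h,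
      Finset.prod_range_succ]
    ring

/-- A set invariant under an involution without fixed points is a union of 2-cycles. -/
theorem exists_pairing {N : ℕ} {σ : Equiv.Perm (Fin N)} (hσ : σ ∈ involutions N)
    {U : Finset (Fin N)} (hU : ∀ u ∈ U, σ u ∈ U) :
    ∃ e, U.card = 2 * e ∧ ∃ x y : Fin e → Fin N, Function.Injective (Sum.elim x y) ∧
      (∀ i, σ (x i) = y i) ∧ ∀ u, u ∈ U ↔ ∃ i, u = x i ∨ u = y i := by
  have hss := apply_apply_of_mem_involutions hσ
  set A := U.filter fun u => u < σ u
  have hA : ∀ i, A.orderEmbOfFin rfl i ∈ A := fun i => A.orderEmbOfFin_mem rfl i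
  have hinj : Function.Injective
      (Sum.elim (A.orderEmbOfFin rfl) fun i => σ (A.orderEmbOfFin rfl i)) := by
    have key : ∀ i j, A.orderEmbOfFin rfl i ≠ σ (A.orderEmbOfFin rfl j) := by
      intro i j hij
      have h1 := (Finset.mem_filter.1 (hA i)).2
      have h2 := (Finset.mem_filter.1 (hA j)).2
      rw [hij, hss] at h1
      exact lt_asymm h1 h2
    rintro (i | i) (j | j) hij
    · exact congrArg _ ((A.orderEmbOfFin rfl).injective hij)
    · exact absurd hij (key _ _)
    · exact absurd hij.symm (key _ _)
    · exact congrArg _ ((A.orderEmbOfFin rfl).injective (σ.injective hij))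
  have hmem : ∀ u, u ∈ U ↔ ∃ i, u = A.orderEmbOfFin rfl i ∨ u = σ (A.orderEmbOfFin rfl i) := by
    have hr : ∀ a ∈ A, ∃ i, A.orderEmbOfFin rfl i = a := by
      intro a ha
      have : a ∈ Set.range (A.orderEmbOfFin rfl) := by rwa [Finset.range_orderEmbOfFin]
      exact this
    intro u
    constructor
    · intro hu
      rcases lt_trichotomy u (σ u) with h | h | h
      · obtain ⟨i, hi⟩ := hr u (Finset.mem_filter.2 ⟨hu, h⟩)
        exact ⟨i, Or.inl hi.symm⟩
      · exact absurd h.symm ((mem_involutions.1 hσ).2 u)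
      · obtain ⟨i, hi⟩ := hr (σ u) (Finset.mem_filter.2 ⟨hU u hu, by rwa [hss]⟩)
        exact ⟨i, Or.inr (by rw [hi, hss])⟩
    · rintro ⟨i, rfl | rfl⟩
      · exact (Finset.mem_filter.1 (hA i)).1
      · exact hU _ (Finset.mem_filter.1 (hA i)).1
  refine ⟨A.card, ?_, A.orderEmbOfFin rfl, fun i => σ (A.orderEmbOfFin rfl i), hinj,
    fun _ => rfl, hmem⟩
  have : U = Finset.univ.image
      (Sum.elim (A.orderEmbOfFin rfl) fun i => σ (A.orderEmbOfFin rfl i)) := by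
    ext u
    rw [hmem]
    simp [exists_or, eq_comm]
  rw [this, Finset.card_image_of_injective _ hinj]
  simp
  omega

/-- The probability that a random involution passes through prescribed pairs, in terms of the number
of points occurring in them. -/
theorem exists_card_involutionsThrough_mul_prod {N : ℕ} {ι : Type*} [Fintype ι] {x y : ι → Fin N}
    (h : (involutionsThrough x y).Nonempty) :
    ∃ e, (Finset.univ.image x ∪ Finset.univ.image y).card = 2 * e ∧
      (involutionsThrough x y).card * ∏ i ∈ Finset.range e, (N - 1 - 2 * i) =
        (involutions N).card := by
  obtain ⟨σ, hσ⟩ := h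
  rw [mem_involutionsThrough] at hσ
  have hU : ∀ u ∈ Finset.univ.image x ∪ Finset.univ.image y,
      σ u ∈ Finset.univ.image x ∪ Finset.univ.image y := by
    intro u hu
    simp only [Finset.mem_union, Finset.mem_image, Finset.mem_univ, true_and] at hu ⊢
    rcases hu with ⟨i, rfl⟩ | ⟨i, rfl⟩
    · exact Or.inr ⟨i, (hσ.2 i).symm⟩
    · exact Or.inl ⟨i, by rw [← hσ.2 i, apply_apply_of_mem_involutions hσ.1]⟩
  obtain ⟨e, he, a, a', hinj, ha, hmem⟩ := exists_pairing hσ.1 hU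
  refine ⟨e, he, ?_⟩
  rw [← card_involutionsThrough_mul_prod a a' hinj]
  congr 2
  ext ρ
  rw [mem_involutionsThrough, mem_involutionsThrough]
  refine and_congr_right fun hρ => ⟨fun hi i => ?_, fun hi i => ?_⟩
  · have h1 : a i ∈ Finset.univ.image x ∪ Finset.univ.image y := (hmem _).2 ⟨i, Or.inl rfl⟩
    rw [← ha i]
    simp only [Finset.mem_union, Finset.mem_image, Finset.mem_univ, true_and] at h1
    rcases h1 with ⟨j, hj⟩ | ⟨j, hj⟩
    · rw [← hj, hi, hσ.2]
    · rw [← hj, ← hi j, apply_apply_of_mem_involutions hρ, hi j, ← hσ.2 j,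
        apply_apply_of_mem_involutions hσ.1]
  · have h1 : x i ∈ Finset.univ.image x ∪ Finset.univ.image y := by simp
    rw [← hσ.2 i]
    obtain ⟨j, hj | hj⟩ := (hmem _).1 h1
    · rw [hj, hi, ha]
    · rw [hj, ← hi j, apply_apply_of_mem_involutions hρ, hi j, ← ha j,
        apply_apply_of_mem_involutions hσ.1]

/-! ### Closed paths and their triangles -/

/-- The permutations of `Fin N` of order three without fixed points. -/
def rotations (N : ℕ) : Finset (Equiv.Perm (Fin N)) :=
  Finset.univ.filter fun τ => orderOf τ = 3 ∧ ∀ i, τ i ≠ i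

theorem mem_rotations {N : ℕ} {τ : Equiv.Perm (Fin N)} :
    τ ∈ rotations N ↔ orderOf τ = 3 ∧ ∀ i, τ i ≠ i := by
  simp [rotations]

/-- The orbit of a point under a permutation of order three: a triangle. -/
def triangle {N : ℕ} (τ : Equiv.Perm (Fin N)) (x : Fin N) : Finset (Fin N) := {x, τ x, τ (τ x)}

section Rotation

variable {N : ℕ} {τ : Equiv.Perm (Fin N)} (hτ : τ ∈ rotations N)
include hτ

theorem rotation_apply_three (x : Fin N) : τ (τ (τ x)) = x := by
  have : τ ^ 3 = 1 := by rw [← (mem_rotations.1 hτ).1, pow_orderOf_eq_one]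
  have h := congrArg (fun π : Equiv.Perm (Fin N) => π x) this
  simpa [pow_succ] using h

theorem rotation_apply_ne (x : Fin N) : τ x ≠ x := (mem_rotations.1 hτ).2 x

theorem rotation_apply_two_ne (x : Fin N) : τ (τ x) ≠ x := fun h =>
  rotation_apply_ne hτ x (by
    have := rotation_apply_three hτ x
    rwa [h] at this)

theorem rotation_pow_ne (e : Bool) (x : Fin N) : (τ ^ (e.toNat + 1)) x ≠ x := by
  cases e
  · simpa using rotation_apply_ne hτ x
  · simpa [pow_succ] using rotation_apply_two_ne hτ x

theorem rotation_pow_injective {e e' : Bool} {x : Fin N}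
    (h : (τ ^ (e.toNat + 1)) x = (τ ^ (e'.toNat + 1)) x) : e = e' := by
  have key : τ x ≠ τ (τ x) := fun h => rotation_apply_ne hτ x (τ.injective h).symm
  rcases e with _ | _ <;> rcases e' with _ | _
  · rfl
  · exact absurd (by simpa [pow_succ] using h) key
  · exact absurd (by simpa [pow_succ] using h.symm) key
  · rfl

theorem triangle_apply (x : Fin N) : triangle τ (τ x) = triangle τ x := by
  ext u
  simp only [triangle, rotation_apply_three hτ, Finset.mem_insert, Finset.mem_singleton]
  tauto

theorem triangle_pow (k : ℕ) (x : Fin N) : triangle τ ((τ ^ k) x) = triangle τ x := by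
  induction k with
  | zero => simp
  | succ k ih => rw [pow_succ', Equiv.Perm.mul_apply, triangle_apply hτ, ih]

omit hτ in
theorem exists_pow_of_triangle_eq {x y : Fin N} (h : triangle τ x = triangle τ y) :
    ∃ a : Fin 3, y = (τ ^ (a : ℕ)) x := by
  have : y ∈ triangle τ x := by rw [h]; simp [triangle]
  simp only [triangle, Finset.mem_insert, Finset.mem_singleton] at this
  rcases this with h | h | h
  · exact ⟨0, by simpa using h⟩
  · exact ⟨1, by simpa using h⟩
  · exact ⟨2, by simpa [pow_succ] using h⟩

end Rotation

/-- The target of the `j`-th edge of a closed path `x`: the involution has to map `x j` to a point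
from which a rotation by `ε j` leads to `x (j + 1)`. -/
def target {N m : ℕ} (τ : Equiv.Perm (Fin N)) (ε : ZMod m → Bool) (x : ZMod m → Fin N)
    (j : ZMod m) : Fin N :=
  (τ ^ ((ε j).toNat + 1)) (x (j + 1))

/-- The product of the first `k` permutations `σ * τ ^ (ε j + 1)`. -/
def pathPerm {N m : ℕ} (σ τ : Equiv.Perm (Fin N)) (ε : ZMod m → Bool) (k : ℕ) :
    Equiv.Perm (Fin N) :=
  ((List.range k).map fun i : ℕ => σ * τ ^ ((ε i).toNat + 1)).prod

theorem pathPerm_succ {N m : ℕ} (σ τ : Equiv.Perm (Fin N)) (ε : ZMod m → Bool) (k : ℕ) :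
    pathPerm σ τ ε (k + 1) = pathPerm σ τ ε k * (σ * τ ^ ((ε k).toNat + 1)) := by
  rw [pathPerm, List.range_succ, List.map_append, List.prod_append]
  simp [pathPerm]

/-- Fixed points of a word are the same as closed paths along it. -/
theorem card_fixed_pathPerm {N m : ℕ} [NeZero m] {σ τ : Equiv.Perm (Fin N)}
    (hσ : σ ∈ involutions N) (ε : ZMod m → Bool) :
    (Finset.univ.filter fun y => pathPerm σ τ ε m y = y).card =
      (Finset.univ.filter fun x : ZMod m → Fin N => ∀ j, σ (x j) = target τ ε x j).card := by
  have hss := apply_apply_of_mem_involutions hσ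
  have key : ∀ x : ZMod m → Fin N, (∀ j, σ (x j) = target τ ε x j) → ∀ k : ℕ,
      pathPerm σ τ ε k (x k) = x 0 := by
    intro x hx k
    induction k with
    | zero => simp [pathPerm]
    | succ k ih =>
      rw [pathPerm_succ, Equiv.Perm.mul_apply, Equiv.Perm.mul_apply, Nat.cast_succ]
      change pathPerm σ τ ε k (σ (target τ ε x k)) = x 0
      rw [← hx, hss, ih]
  symm
  refine Finset.card_nbij (fun x => x 0) ?_ ?_ ?_
  · intro x hx
    rw [Finset.mem_coe, Finset.mem_filter] at hx ⊢
    have := key x hx.2 m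
    rw [ZMod.natCast_self] at this
    exact ⟨Finset.mem_univ _, this⟩
  · intro x hx x' hx' h
    rw [Finset.mem_coe, Finset.mem_filter] at hx hx'
    ext1 j
    have h1 := key x hx.2 j.val
    have h2 := key x' hx'.2 j.val
    rw [ZMod.natCast_zmod_val] at h1 h2
    refine (pathPerm σ τ ε j.val).injective ?_
    rw [h1, h2]
    exact h
  · intro y hy
    rw [Finset.mem_coe, Finset.mem_filter] at hy
    refine ⟨fun j => (pathPerm σ τ ε j.val)⁻¹ y, ?_, ?_⟩
    · rw [Finset.mem_coe, Finset.mem_filter]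
      refine ⟨Finset.mem_univ _, fun j => ?_⟩
      have hstep : (pathPerm σ τ ε (j + 1).val)⁻¹ y = (pathPerm σ τ ε (j.val + 1))⁻¹ y := by
        have hj : (j + 1).val = (j.val + 1) % m := by
          have := ZMod.val_natCast m (j.val + 1)
          rwa [Nat.cast_succ, ZMod.natCast_zmod_val] at this
        rcases Nat.lt_or_ge (j.val + 1) m with h | h
        · rw [hj, Nat.mod_eq_of_lt h]
        · have h' : j.val + 1 = m := le_antisymm (ZMod.val_lt j) h
          rw [hj, h', Nat.mod_self]
          simp only [pathPerm, List.range_zero, List.map_nil, List.prod_nil, inv_one,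
            Equiv.Perm.one_apply]
          rw [Equiv.Perm.eq_inv_iff_eq]
          exact hy.2
      rw [target, hstep, pathPerm_succ, ZMod.natCast_zmod_val, mul_inv_rev, Equiv.Perm.mul_apply]
      set u := (pathPerm σ τ ε j.val)⁻¹ y
      have hu : (σ * τ ^ ((ε j).toNat + 1))⁻¹ u = (τ ^ ((ε j).toNat + 1))⁻¹ (σ u) := by
        rw [Equiv.Perm.inv_eq_iff_eq, Equiv.Perm.mul_apply]
        simp [hss]
      rw [hu]
      exact (Equiv.apply_symm_apply (τ ^ ((ε j).toNat + 1)) _).symm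
    · simp [pathPerm]

/-- The number of triangles visited by a closed path. -/
def numTriangles {N m : ℕ} [NeZero m] (τ : Equiv.Perm (Fin N)) (x : ZMod m → Fin N) : ℕ :=
  (Finset.univ.image fun j => triangle τ (x j)).card

/-- The points used by a closed path. -/
def pathPoints {N m : ℕ} [NeZero m] (τ : Equiv.Perm (Fin N)) (ε : ZMod m → Bool)
    (x : ZMod m → Fin N) : Finset (Fin N) :=
  Finset.univ.image x ∪ Finset.univ.image (target τ ε x)

section Path

variable {N m : ℕ} [NeZero m] {τ : Equiv.Perm (Fin N)} (hτ : τ ∈ rotations N)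
  (ε : ZMod m → Bool) (x : ZMod m → Fin N)

theorem mem_pathPoints_left (j : ZMod m) : x j ∈ pathPoints τ ε x := by
  simp [pathPoints]

theorem mem_pathPoints_right (j : ZMod m) : target τ ε x j ∈ pathPoints τ ε x := by
  simp [pathPoints]

include hτ

omit [NeZero m] in
theorem triangle_target (j : ZMod m) : triangle τ (target τ ε x j) = triangle τ (x (j + 1)) :=
  triangle_pow hτ _ _

omit [NeZero m] in
theorem target_ne (j : ZMod m) : target τ ε x j ≠ x (j + 1) :=
  rotation_pow_ne hτ _ _

theorem triangle_mem_of_mem_pathPoints {u : Fin N} (hu : u ∈ pathPoints τ ε x) :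
    triangle τ u ∈ Finset.univ.image fun j => triangle τ (x j) := by
  simp only [pathPoints, Finset.mem_union, Finset.mem_image, Finset.mem_univ, true_and] at hu ⊢
  rcases hu with ⟨j, rfl⟩ | ⟨j, rfl⟩
  · exact ⟨j, rfl⟩
  · exact ⟨j + 1, (triangle_target hτ ε x j).symm⟩

/-- A path enters and leaves each triangle through different points. -/
theorem pair_subset_fiber (j : ZMod m) : {x (j + 1), target τ ε x j} ⊆
    (pathPoints τ ε x).filter fun u => triangle τ u = triangle τ (x (j + 1)) := by
  intro u hu
  rw [Finset.mem_insert, Finset.mem_singleton] at hu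
  rw [Finset.mem_filter]
  rcases hu with rfl | rfl
  · exact ⟨mem_pathPoints_left ε x _, rfl⟩
  · exact ⟨mem_pathPoints_right ε x _, triangle_target hτ ε x j⟩

theorem two_le_card_fiber (T : Finset (Fin N))
    (hT : T ∈ Finset.univ.image fun j => triangle τ (x j)) :
    2 ≤ ((pathPoints τ ε x).filter fun u => triangle τ u = T).card := by
  obtain ⟨j, -, rfl⟩ := Finset.mem_image.1 hT
  have h := Finset.card_le_card (pair_subset_fiber hτ ε x (j - 1))
  rw [Finset.card_pair (target_ne hτ ε x _).symm, sub_add_cancel] at h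
  exact h

/-- If a path uses only two points per triangle, these are the points of any of its visits. -/
theorem eq_or_eq_of_triangle_eq (hcard : (pathPoints τ ε x).card ≤ 2 * numTriangles τ x)
    {j : ZMod m} {u : Fin N} (hu : u ∈ pathPoints τ ε x)
    (h : triangle τ u = triangle τ (x (j + 1))) : u = x (j + 1) ∨ u = target τ ε x j := by
  have hfib : ((pathPoints τ ε x).filter fun u => triangle τ u = triangle τ (x (j + 1))).card ≤ 2 := by
    by_contra hc
    push Not at hc
    rw [Finset.card_eq_sum_card_fiberwise (f := triangle τ)
      (t := Finset.univ.image fun j => triangle τ (x j))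
      (fun u hu => triangle_mem_of_mem_pathPoints hτ ε x hu), mul_comm, numTriangles,
      ← smul_eq_mul, ← Finset.sum_const] at hcard
    exact absurd hcard (not_le.2 (Finset.sum_lt_sum (two_le_card_fiber hτ ε x)
      ⟨_, Finset.mem_image_of_mem _ (Finset.mem_univ (j + 1)), hc⟩))
  have h2 : u ∈ ({x (j + 1), target τ ε x j} : Finset (Fin N)) := by
    rw [Finset.eq_of_subset_of_card_le (pair_subset_fiber hτ ε x j)
      (by rwa [Finset.card_pair (target_ne hτ ε x _).symm])]
    exact Finset.mem_filter.2 ⟨hu, h⟩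
  simpa using h2

/-- If a path uses only two points per triangle, then it traverses each visited triangle always in
the same direction. -/
theorem eq_of_triangle_eq (hcard : (pathPoints τ ε x).card ≤ 2 * numTriangles τ x)
    {σ : Equiv.Perm (Fin N)} (hσ : σ ∈ involutionsThrough x (target τ ε x)) {j k : ZMod m}
    (h : triangle τ (x j) = triangle τ (x k)) : x j = x k := by
  rw [mem_involutionsThrough] at hσ
  have hss := apply_apply_of_mem_involutions hσ.1
  by_contra hne
  -- Two visits in opposite directions force the neighbouring visits to be opposite as well, until
  -- the two visits meet.
  have step : ∀ j k, x k = target τ ε x (j - 1) → x j = target τ ε x (k - 1) →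
      x (k + 1) = target τ ε x (j - 1 - 1) ∧ x (j - 1) = target τ ε x (k + 1 - 1) := by
    intro j k h1 h2
    have h3 : x (j - 1) = target τ ε x k := by
      rw [← hσ.2 k, h1, ← hσ.2, hss]
    have h4 : triangle τ (x (k + 1)) = triangle τ (x (j - 1 - 1 + 1)) := by
      rw [sub_add_cancel, h3, triangle_target hτ]
    rcases eq_or_eq_of_triangle_eq hτ ε x hcard (mem_pathPoints_left ε x _) h4 with h5 | h5
    · rw [sub_add_cancel, h3] at h5
      exact absurd h5.symm (target_ne hτ ε x k)
    · exact ⟨h5, by rwa [add_sub_cancel_right]⟩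
  have h1 : x k = target τ ε x (j - 1) := by
    rcases eq_or_eq_of_triangle_eq hτ ε x hcard (j := j - 1) (mem_pathPoints_left ε x k)
      (by rw [sub_add_cancel, h]) with h5 | h5
    · rw [sub_add_cancel] at h5
      exact absurd h5.symm hne
    · exact h5
  have h2 : x j = target τ ε x (k - 1) := by
    rcases eq_or_eq_of_triangle_eq hτ ε x hcard (j := k - 1) (mem_pathPoints_left ε x j)
      (by rw [sub_add_cancel, h]) with h5 | h5
    · rw [sub_add_cancel] at h5
      exact absurd h5 hne
    · exact h5
  have iter : ∀ i : ℕ, x (k + i) = target τ ε x (j - i - 1) ∧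
      x (j - i) = target τ ε x (k + i - 1) := by
    intro i
    induction i with
    | zero => simpa using ⟨h1, h2⟩
    | succ i ih =>
      have := step _ _ ih.1 ih.2
      push_cast
      rwa [← add_assoc, ← sub_sub]
  obtain ⟨n, hn⟩ : ∃ n : ℕ, j = k + n := ⟨(j - k).val, by rw [ZMod.natCast_zmod_val]; ring⟩
  rcases Nat.even_or_odd' n with ⟨i, rfl | rfl⟩
  · have h6 := (iter i).1
    have h7 : j - i = k + i := by rw [hn]; push_cast; ring
    rw [h7] at h6
    have := target_ne hτ ε x (k + i - 1)
    rw [sub_add_cancel] at this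
    exact this h6.symm
  · have h6 := (iter i).1
    have h7 : j - i - 1 = k + i := by rw [hn]; push_cast; ring
    rw [h7, ← hσ.2] at h6
    exact (mem_involutions.1 hσ.1).2 _ h6.symm

end Path

/-- The closed paths that run around a simple cycle of `d` triangles again and again: the path has
period `d`, and its first `d` triangles are distinct. -/
structure IsCycle {N m : ℕ} (τ : Equiv.Perm (Fin N)) (d : ℕ) (x : ZMod m → Fin N) : Prop where
  periodic : ∀ j, x (j + d) = x j
  injOn : Set.InjOn (fun i : ℕ => triangle τ (x i)) (Set.Iio d)

theorem IsCycle.apply_mod {N m : ℕ} {τ : Equiv.Perm (Fin N)} {d : ℕ} {x : ZMod m → Fin N}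
    (h : IsCycle τ d x) (i : ℕ) : x (i % d : ℕ) = x i := by
  have key : ∀ k r : ℕ, x ((r + d * k : ℕ) : ZMod m) = x r := by
    intro k r
    induction k with
    | zero => simp
    | succ k ih =>
      rw [← ih, ← h.periodic ((r + d * k : ℕ) : ZMod m)]
      congr 1
      push_cast
      ring
  conv_rhs => rw [← Nat.mod_add_div i d]
  rw [key]

theorem IsCycle.triangle_eq_iff {N m : ℕ} {τ : Equiv.Perm (Fin N)} {d : ℕ} {x : ZMod m → Fin N}
    (h : IsCycle τ d x) (hd : 0 < d) (i i' : ℕ) :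
    triangle τ (x i) = triangle τ (x i') ↔ i ≡ i' [MOD d] := by
  rw [← h.apply_mod i, ← h.apply_mod i']
  refine ⟨fun h' => h.injOn (Nat.mod_lt _ hd) (Nat.mod_lt _ hd) h', fun h' => ?_⟩
  rw [h']

theorem IsCycle.unique {N m : ℕ} {τ : Equiv.Perm (Fin N)} {d d' : ℕ} {x : ZMod m → Fin N}
    (h : IsCycle τ d x) (h' : IsCycle τ d' x) (hd : 0 < d) (hd' : 0 < d') : d = d' := by
  have key : ∀ i i', i ≡ i' [MOD d] ↔ i ≡ i' [MOD d'] := fun i i' => by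
    rw [← h.triangle_eq_iff hd, ← h'.triangle_eq_iff hd']
  refine Nat.dvd_antisymm ?_ ?_
  · exact (Nat.modEq_zero_iff_dvd).1 ((key d' 0).2 (Nat.modEq_zero_iff_dvd.2 dvd_rfl))
  · exact (Nat.modEq_zero_iff_dvd).1 ((key d 0).1 (Nat.modEq_zero_iff_dvd.2 dvd_rfl))

/-- The lengths of the simple cycles around which a closed path of type `ε` can run. -/
def periods {m : ℕ} [NeZero m] (ε : ZMod m → Bool) : Finset ℕ :=
  m.divisors.filter fun d => ∀ j, ε (j + d) = ε j

section Cycle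

variable {N m : ℕ} [NeZero m] {τ : Equiv.Perm (Fin N)} (hτ : τ ∈ rotations N)
  (ε : ZMod m → Bool) (x : ZMod m → Fin N)
include hτ

/-- A path that uses only two points per triangle runs around a cycle: it closes up at the first
repetition of a triangle, because it always traverses this triangle in the same direction. -/
theorem exists_isCycle (hcard : (pathPoints τ ε x).card ≤ 2 * numTriangles τ x)
    {σ : Equiv.Perm (Fin N)} (hσ : σ ∈ involutionsThrough x (target τ ε x)) :
    ∃ d ∈ periods ε, IsCycle τ d x := by
  have hσ' := hσ
  rw [mem_involutionsThrough] at hσ'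
  have next : ∀ j k, x j = x k → x (j + 1) = x (k + 1) ∧ ε j = ε k := by
    intro j k h
    have h1 : target τ ε x j = target τ ε x k := by rw [← hσ'.2, ← hσ'.2, h]
    have h2 : x (j + 1) = x (k + 1) := eq_of_triangle_eq hτ ε x hcard hσ (by
      rw [← triangle_target hτ ε, h1, triangle_target hτ])
    refine ⟨h2, rotation_pow_injective hτ (x := x (j + 1)) ?_⟩
    rw [target, target, ← h2] at h1
    exact h1
  have shift : ∀ j k, x j = x k → ∀ i : ℕ, x (j + i) = x (k + i) := by
    intro j k h i
    induction i with
    | zero => simpa using h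
    | succ i ih =>
      push_cast
      rw [← add_assoc, ← add_assoc]
      exact (next _ _ ih).1
  have hm : 0 < m := Nat.pos_of_ne_zero (NeZero.ne m)
  have hex : ∃ d : ℕ, 0 < d ∧ x d = x 0 := ⟨m, hm, by rw [ZMod.natCast_self]⟩
  classical
  set d := Nat.find hex
  obtain ⟨hd, hxd⟩ : 0 < d ∧ x d = x 0 := Nat.find_spec hex
  have hdm : d ≤ m := Nat.find_min' hex ⟨hm, by rw [ZMod.natCast_self]⟩
  have hper : ∀ j, x (j + d) = x j := by
    intro j
    have := shift _ _ hxd j.val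
    rwa [ZMod.natCast_zmod_val, zero_add, add_comm] at this
  have hcyc : IsCycle τ d x := by
    refine ⟨hper, ?_⟩
    have key : ∀ i i' : ℕ, i < i' → i' < d → triangle τ (x i) ≠ triangle τ (x i') := by
      intro i i' hii hi' heq
      have h1 := shift _ _ (eq_of_triangle_eq hτ ε x hcard hσ heq) (m - i)
      have h2 : (i : ZMod m) + (m - i : ℕ) = 0 := by
        rw [← Nat.cast_add, Nat.add_sub_cancel' (by omega), ZMod.natCast_self]
      have h3 : (i' : ZMod m) + (m - i : ℕ) = (i' - i : ℕ) := by
        rw [← Nat.cast_add, show i' + (m - i) = (i' - i) + m by omega, Nat.cast_add,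
          ZMod.natCast_self, add_zero]
      rw [h2, h3] at h1
      exact Nat.find_min hex (m := i' - i) (by omega) ⟨by omega, h1.symm⟩
    intro i hi i' hi' heq
    rcases lt_trichotomy i i' with h | h | h
    · exact absurd heq (key _ _ h hi')
    · exact h
    · exact absurd heq.symm (key _ _ h hi)
  refine ⟨d, ?_, hcyc⟩
  rw [periods, Finset.mem_filter, Nat.mem_divisors]
  refine ⟨⟨?_, NeZero.ne m⟩, fun j => (next _ _ (hper j)).2⟩
  refine Nat.modEq_zero_iff_dvd.1 ((hcyc.triangle_eq_iff hd m 0).1 ?_)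
  rw [ZMod.natCast_self, Nat.cast_zero]

/-- A path around a cycle of length `d` prescribes exactly `d` pairs of the involution. -/
theorem IsCycle.card_mul_prod {d : ℕ} {x : ZMod m → Fin N} (h : IsCycle τ d x)
    (hd : d ∈ periods ε) :
    (involutionsThrough x (target τ ε x)).card * ∏ i ∈ Finset.range d, (N - 1 - 2 * i) =
      (involutions N).card := by
  rw [periods, Finset.mem_filter, Nat.mem_divisors] at hd
  have hd0 : 0 < d := Nat.pos_of_dvd_of_pos hd.1.1 (Nat.pos_of_ne_zero hd.1.2)
  have htri : ∀ i : ℕ, triangle τ (target τ ε x i) = triangle τ (x (i + 1 : ℕ)) := fun i => by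
    rw [triangle_target hτ, Nat.cast_succ]
  have hinj : Function.Injective (Sum.elim (fun i : Fin d => x ((i : ℕ) : ZMod m))
      (fun i : Fin d => target τ ε x ((i : ℕ) : ZMod m))) := by
    have hlt : ∀ i i' : Fin d, (i : ℕ) ≡ i' [MOD d] → i = i' := fun i i' hii =>
      Fin.ext (Nat.ModEq.eq_of_lt_of_lt hii i.2 i'.2)
    have key : ∀ i i' : ℕ, x (i : ZMod m) ≠ target τ ε x (i' : ZMod m) := by
      intro i i' hii
      have h1 := congrArg (triangle τ) hii
      rw [htri, h.triangle_eq_iff hd0] at h1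
      have h2 : x i = x (i' + 1 : ℕ) := by
        rw [← h.apply_mod i, ← h.apply_mod (i' + 1), h1]
      rw [h2, Nat.cast_succ] at hii
      exact target_ne hτ ε x _ hii.symm
    rintro (i | i) (i' | i') hii
    · exact congrArg _ (hlt _ _ ((h.triangle_eq_iff hd0 _ _).1 (congrArg (triangle τ) hii)))
    · exact absurd hii (key _ _)
    · exact absurd hii.symm (key _ _)
    · have h1 := congrArg (triangle τ) hii
      simp only [Sum.elim_inr] at h1
      rw [htri, htri, h.triangle_eq_iff hd0] at h1
      exact congrArg _ (hlt _ _ (Nat.ModEq.add_right_cancel' 1 h1))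
  rw [← card_involutionsThrough_mul_prod _ _ hinj]
  congr 2
  ext σ
  rw [mem_involutionsThrough, mem_involutionsThrough]
  refine and_congr_right fun _ => ⟨fun h' i => h' _, fun h' j => ?_⟩
  have hεmod : ∀ k r : ℕ, ε ((r + d * k : ℕ) : ZMod m) = ε r := by
    intro k r
    induction k with
    | zero => simp
    | succ k ih =>
      rw [← ih, ← hd.2 ((r + d * k : ℕ) : ZMod m)]
      congr 1
      push_cast
      ring
  obtain ⟨i, rfl⟩ : ∃ i : ℕ, (i : ZMod m) = j := ⟨j.val, ZMod.natCast_zmod_val j⟩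
  have h1 := h' ⟨i % d, Nat.mod_lt _ hd0⟩
  have h2 : target τ ε x ((i % d : ℕ) : ZMod m) = target τ ε x i := by
    have h3 : ε ((i % d : ℕ) : ZMod m) = ε i := by
      conv_rhs => rw [← Nat.mod_add_div i d]
      rw [hεmod]
    have h4 : x (((i % d : ℕ) : ZMod m) + 1) = x ((i : ZMod m) + 1) := by
      rw [← Nat.cast_succ, ← Nat.cast_succ, ← h.apply_mod (i % d).succ, ← h.apply_mod i.succ]
      congr 2
      exact (Nat.mod_modEq i d).add_right 1
    rw [target, target, h3, h4]
  rwa [h2, h.apply_mod i] at h1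

end Cycle

/-! ### Counting closed paths -/

section Counting

variable {N m : ℕ} [NeZero m] {τ : Equiv.Perm (Fin N)}

open scoped Classical in
/-- The paths that run around a simple cycle of length `d`. -/
def cycles {N : ℕ} (m : ℕ) [NeZero m] (τ : Equiv.Perm (Fin N)) (d : ℕ) :
    Finset (ZMod m → Fin N) :=
  Finset.univ.filter fun x => IsCycle τ d x

theorem mem_cycles {d : ℕ} {x : ZMod m → Fin N} : x ∈ cycles m τ d ↔ IsCycle τ d x := by
  simp [cycles]

theorem card_cycles_le (d : ℕ) (hd : 0 < d) : (cycles m τ d).card ≤ N ^ d := by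
  have : (cycles m τ d).card ≤ (Finset.univ : Finset (Fin d → Fin N)).card := by
    refine Finset.card_le_card_of_injOn (fun x i => x ((i : ℕ) : ZMod m)) (by simp) ?_
    intro x hx x' hx' h
    rw [Finset.mem_coe, mem_cycles] at hx hx'
    ext1 j
    rw [← ZMod.natCast_zmod_val j, ← hx.apply_mod, ← hx'.apply_mod]
    exact congrFun h ⟨j.val % d, Nat.mod_lt _ hd⟩
  simpa using this

theorem card_filter_apply_eq_le {d : ℕ} {i i' : Fin d} (h : i ≠ i') (f : Fin N → Fin N) :
    (Finset.univ.filter fun y : Fin d → Fin N => y i' = f (y i)).card ≤ N ^ (d - 1) := by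
  have : (Finset.univ.filter fun y : Fin d → Fin N => y i' = f (y i)).card ≤
      (Finset.univ : Finset ({k : Fin d // k ≠ i'} → Fin N)).card := by
    refine Finset.card_le_card_of_injOn (fun y k => y k.1) (by simp) ?_
    intro y hy y' hy' hyy
    rw [Finset.mem_coe, Finset.mem_filter] at hy hy'
    have key : ∀ k, k ≠ i' → y k = y' k := fun k hk => congrFun hyy ⟨k, hk⟩
    ext1 k
    by_cases hk : k = i'
    · rw [hk, hy.2, hy'.2, key i h]
    · exact key k hk
  refine this.trans_eq ?_
  rw [Finset.card_univ, Fintype.card_fun, Fintype.card_fin, Fintype.card_subtype_compl,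
    Fintype.card_fin, Fintype.card_subtype_eq]

/-- Almost every choice of `d` starting points of the triangles gives a cycle, since two of the
points rarely share a triangle. -/
theorem pow_le_card_cycles_add {d : ℕ} (hd : d ∣ m) :
    N ^ d ≤ (cycles m τ d).card + 3 * d ^ 2 * N ^ (d - 1) := by
  classical
  have hd0 : 0 < d := Nat.pos_of_dvd_of_pos hd (Nat.pos_of_ne_zero (NeZero.ne m))
  set G := Finset.univ.filter fun y : Fin d → Fin N => Function.Injective fun i => triangle τ (y i)
  have h1 : G.card ≤ (cycles m τ d).card := by
    have hval : ∀ i : Fin d, ((i : ℕ) : ZMod m).val % d = i := by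
      intro i
      rw [ZMod.val_natCast, Nat.mod_mod_of_dvd _ hd, Nat.mod_eq_of_lt i.2]
    refine Finset.card_le_card_of_injOn
      (fun y (j : ZMod m) => y ⟨j.val % d, Nat.mod_lt _ hd0⟩) ?_ ?_
    · intro y hy
      rw [Finset.mem_coe, Finset.mem_filter] at hy
      rw [Finset.mem_coe, mem_cycles]
      refine ⟨fun j => ?_, fun i hi i' hi' h => ?_⟩
      · refine congrArg y (Fin.ext ?_)
        change (j + d).val % d = j.val % d
        rw [ZMod.val_add, Nat.mod_mod_of_dvd _ hd, ZMod.val_natCast, Nat.add_mod,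
          Nat.mod_mod_of_dvd _ hd, Nat.mod_self, add_zero, Nat.mod_mod]
      · have h2 := hy.2 h
        rw [Fin.mk.injEq] at h2
        rwa [hval ⟨i, hi⟩, hval ⟨i', hi'⟩] at h2
    · intro y _ y' _ h
      ext1 i
      have h2 := congrFun h ((i : ℕ) : ZMod m)
      simp only [hval] at h2
      exact h2
  have h2 : Gᶜ.card ≤ 3 * d ^ 2 * N ^ (d - 1) := by
    set B := (Finset.univ : Finset ((Fin d × Fin d) × Fin 3)).filter fun q => q.1.1 ≠ q.1.2
    have hsub : Gᶜ ⊆ B.biUnion fun q =>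
        Finset.univ.filter fun y : Fin d → Fin N => y q.1.2 = (τ ^ (q.2 : ℕ)) (y q.1.1) := by
      intro y hy
      have hy' : ¬ Function.Injective fun i => triangle τ (y i) := fun h =>
        Finset.mem_compl.1 hy (Finset.mem_filter.2 ⟨Finset.mem_univ _, h⟩)
      simp only [Function.Injective, not_forall] at hy'
      obtain ⟨i, i', heq, hne⟩ := hy'
      obtain ⟨a, ha⟩ := exists_pow_of_triangle_eq heq
      rw [Finset.mem_biUnion]
      exact ⟨((i, i'), a), by simpa [B] using hne, by simpa using ha⟩
    refine (Finset.card_le_card hsub).trans ?_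
    refine (Finset.card_biUnion_le_card_mul _ _ (N ^ (d - 1)) fun q hq =>
      card_filter_apply_eq_le (Finset.mem_filter.1 hq).2 _).trans ?_
    refine Nat.mul_le_mul_right _ ((Finset.card_filter_le _ _).trans_eq ?_)
    simp
    ring
  have h3 : G.card + Gᶜ.card = N ^ d := by
    rw [Finset.card_add_card_compl]
    simp
  omega

/-- A path through `t` triangles has only `t` degrees of freedom. -/
theorem card_numTriangles_eq_le (t : ℕ) :
    (Finset.univ.filter fun x : ZMod m → Fin N => numTriangles τ x = t).card ≤
      (t ^ m * 3 ^ m) * N ^ t := by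
  classical
  let F : ((ZMod m → Fin t) × (ZMod m → Fin 3)) × (Fin t → Fin N) → ZMod m → Fin N :=
    fun q j => (τ ^ (q.1.2 j : ℕ)) (q.2 (q.1.1 j))
  have hsub : (Finset.univ.filter fun x : ZMod m → Fin N => numTriangles τ x = t) ⊆
      Finset.univ.image F := by
    intro x hx
    have ht : (Finset.univ.image fun j => triangle τ (x j)).card = t := (Finset.mem_filter.1 hx).2
    let en := Finset.equivFinOfCardEq ht
    have hrep : ∀ s : Fin t, ∃ j, triangle τ (x j) = (en.symm s).1 := fun s => by
      obtain ⟨j, -, hj⟩ := Finset.mem_image.1 (en.symm s).2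
      exact ⟨j, hj⟩
    choose r hr using hrep
    have hmem : ∀ j, triangle τ (x j) ∈ Finset.univ.image fun j => triangle τ (x j) :=
      fun j => Finset.mem_image_of_mem _ (Finset.mem_univ j)
    have hpow : ∀ j, ∃ a : Fin 3, x j = (τ ^ (a : ℕ)) (x (r (en ⟨_, hmem j⟩))) := fun j =>
      exists_pow_of_triangle_eq (by rw [hr, Equiv.symm_apply_apply])
    choose a ha using hpow
    rw [Finset.mem_image]
    exact ⟨((fun j => en ⟨_, hmem j⟩, a), fun s => x (r s)), Finset.mem_univ _,
      funext fun j => (ha j).symm⟩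
  refine (Finset.card_le_card hsub).trans (Finset.card_image_le.trans_eq ?_)
  simp [ZMod.card]

end Counting

/-! ### The mean number of fixed points -/

section Mean

variable {N m : ℕ} [NeZero m] {τ : Equiv.Perm (Fin N)}

omit [NeZero m] in
theorem cast_falling {k : ℕ} (hN : 4 * m ≤ N) (hk : k < m) :
    ((N - 1 - 2 * k : ℕ) : ℝ) = N - (1 + 2 * k) := by
  rw [Nat.sub_sub, Nat.cast_sub (by omega)]
  push_cast
  ring

omit [NeZero m] in
theorem falling_prod_le {d : ℕ} (hN : 4 * m ≤ N) (hd : d ≤ m) :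
    ((∏ i ∈ Finset.range d, (N - 1 - 2 * i) : ℕ) : ℝ) ≤ (N : ℝ) ^ d := by
  push_cast
  refine (Finset.prod_le_prod (fun i _ => by positivity) (g := fun _ => (N : ℝ)) ?_).trans_eq
    (by simp)
  intro i hi
  rw [cast_falling hN (lt_of_lt_of_le (Finset.mem_range.1 hi) hd)]
  have : (0 : ℝ) ≤ i := by positivity
  linarith

omit [NeZero m] in
theorem half_pow_le_falling_prod {d : ℕ} (hN : 4 * m ≤ N) (hd : d ≤ m) :
    ((N : ℝ) / 2) ^ d ≤ ((∏ i ∈ Finset.range d, (N - 1 - 2 * i) : ℕ) : ℝ) := by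
  push_cast
  rw [show ((N : ℝ) / 2) ^ d = ∏ i ∈ Finset.range d, (N : ℝ) / 2 by
    rw [Finset.prod_const, Finset.card_range]]
  refine Finset.prod_le_prod (fun i _ => by positivity) ?_
  intro i hi
  have hi' := lt_of_lt_of_le (Finset.mem_range.1 hi) hd
  rw [cast_falling hN hi']
  have h1 : (i : ℝ) + 1 ≤ m := by exact_mod_cast hi'
  have h2 : 4 * (m : ℝ) ≤ N := by exact_mod_cast hN
  linarith

theorem one_add_pow_le {u : ℝ} (h0 : 0 ≤ u) (h1 : u ≤ 1) (d : ℕ) : (1 + u) ^ d ≤ 1 + 3 ^ d * u := by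
  induction d with
  | zero => simpa using h0
  | succ d ih =>
    have h3 : (1 : ℝ) ≤ 3 ^ d := one_le_pow₀ (by norm_num)
    rw [pow_succ, pow_succ]
    calc (1 + u) ^ d * (1 + u) ≤ (1 + 3 ^ d * u) * (1 + u) := by gcongr
      _ = 1 + (3 ^ d + 1 + 3 ^ d * u) * u := by ring
      _ ≤ 1 + 3 ^ d * 3 * u := by
        gcongr
        nlinarith

theorem pow_le_falling_prod_mul {d : ℕ} (hN : 4 * m ≤ N) (hd : d ≤ m) :
    (N : ℝ) ^ d ≤ ((∏ i ∈ Finset.range d, (N - 1 - 2 * i) : ℕ) : ℝ) * (1 + 3 ^ d * (4 * m / N)) := by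
  have hm : (1 : ℝ) ≤ m := by exact_mod_cast Nat.pos_of_ne_zero (NeZero.ne m)
  have hN' : 4 * (m : ℝ) ≤ N := by exact_mod_cast hN
  have hN0 : (0 : ℝ) < N := by linarith
  have hu : 4 * (m : ℝ) / N ≤ 1 := by rwa [div_le_one hN0]
  calc (N : ℝ) ^ d = ∏ i ∈ Finset.range d, (N : ℝ) := by simp
    _ ≤ ∏ i ∈ Finset.range d, (((N - 1 - 2 * i : ℕ) : ℝ) * (1 + 4 * m / N)) := by
      refine Finset.prod_le_prod (fun _ _ => hN0.le) fun i hi => ?_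
      have hi' := lt_of_lt_of_le (Finset.mem_range.1 hi) hd
      rw [cast_falling hN hi']
      have h1 : (i : ℝ) + 1 ≤ m := by exact_mod_cast hi'
      have h2 : (0 : ℝ) ≤ i := by positivity
      rw [mul_add, mul_one, mul_div_assoc', ← sub_le_iff_le_add', le_div_iff₀ hN0]
      nlinarith
    _ = ((∏ i ∈ Finset.range d, (N - 1 - 2 * i) : ℕ) : ℝ) * (1 + 4 * m / N) ^ d := by
      rw [Finset.prod_mul_distrib]
      simp
    _ ≤ _ := by
      gcongr
      exact one_add_pow_le (by positivity) hu d

/-- The paths around a simple cycle of length `d` contribute `1 + O(1 / N)` to the mean. -/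
theorem abs_card_cycles_sub_le {d : ℕ} (hN : 4 * m ≤ N) (hd : d ∣ m) :
    |((cycles m τ d).card : ℝ) / ((∏ i ∈ Finset.range d, (N - 1 - 2 * i) : ℕ) : ℝ) - 1| ≤
      (3 * d ^ 2 + 3 ^ d * (4 * m)) / N := by
  have hm0 := Nat.pos_of_ne_zero (NeZero.ne m)
  have hdm : d ≤ m := Nat.le_of_dvd hm0 hd
  have hd0 : 0 < d := Nat.pos_of_dvd_of_pos hd hm0
  have hN0 : (0 : ℝ) < N := by exact_mod_cast (by omega : 0 < N)
  have hQ := half_pow_le_falling_prod hN hdm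
  have hQ1 := falling_prod_le hN hdm
  have hQ2 := pow_le_falling_prod_mul hN hdm
  set Q := ((∏ i ∈ Finset.range d, (N - 1 - 2 * i) : ℕ) : ℝ)
  have hQ0 : 0 < Q := lt_of_lt_of_le (by positivity) hQ
  have hC1 : ((cycles m τ d).card : ℝ) ≤ (N : ℝ) ^ d := by exact_mod_cast card_cycles_le d hd0
  have hC2 : (N : ℝ) ^ d ≤ (cycles m τ d).card + 3 * d ^ 2 * (N : ℝ) ^ (d - 1) := by
    exact_mod_cast pow_le_card_cycles_add hd
  have hpow : (N : ℝ) ^ (d - 1) = N ^ d / N := by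
    rw [eq_div_iff hN0.ne', ← pow_succ, Nat.sub_add_cancel hd0]
  rw [hpow] at hC2
  have h1 : (0 : ℝ) ≤ 3 * d ^ 2 / N := by positivity
  have h2 : (0 : ℝ) ≤ 3 ^ d * (4 * m) / N := by positivity
  rw [abs_le, add_div]
  constructor
  · have h3 : 1 - 3 * (d : ℝ) ^ 2 / N ≤ (cycles m τ d).card / (N : ℝ) ^ d := by
      rw [le_div_iff₀ (by positivity), sub_mul, one_mul]
      rw [mul_div_assoc'] at hC2
      rw [div_mul_eq_mul_div]
      linarith
    have h4 : ((cycles m τ d).card : ℝ) / (N : ℝ) ^ d ≤ (cycles m τ d).card / Q := by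
      gcongr
    linarith
  · have h3 : ((cycles m τ d).card : ℝ) / Q ≤ 1 + 3 ^ d * (4 * m / N) := by
      rw [div_le_iff₀ hQ0, mul_comm]
      exact hC1.trans hQ2
    rw [mul_div_assoc'] at h3
    linarith

/-- A closed path that is not a cycle uses at least three points in some triangle, which makes it
unlikely. -/
theorem card_involutionsThrough_le (hτ : τ ∈ rotations N) (hN : 4 * m ≤ N) (ε : ZMod m → Bool)
    {x : ZMod m → Fin N} (hx : ∀ d ∈ periods ε, ¬ IsCycle τ d x) :
    ((involutionsThrough x (target τ ε x)).card : ℝ) ≤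
      (involutions N).card * (2 / N) ^ (numTriangles τ x + 1) := by
  have hm0 := Nat.pos_of_ne_zero (NeZero.ne m)
  have hN4 : (4 : ℝ) ≤ N := by exact_mod_cast (by omega : 4 ≤ N)
  rcases Finset.eq_empty_or_nonempty (involutionsThrough x (target τ ε x)) with h0 | hne
  · rw [h0]
    simp only [Finset.card_empty, Nat.cast_zero]
    positivity
  obtain ⟨e, he, hcard⟩ := exists_card_involutionsThrough_mul_prod hne
  change (pathPoints τ ε x).card = 2 * e at he
  have het : numTriangles τ x + 1 ≤ e := by
    by_contra hc
    obtain ⟨σ, hσ⟩ := hne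
    obtain ⟨d, hd, hcyc⟩ := exists_isCycle hτ ε x (by omega) hσ
    exact hx d hd hcyc
  have hem : e ≤ m := by
    have h1 : (pathPoints τ ε x).card ≤ m + m := by
      refine (Finset.card_union_le _ _).trans (add_le_add ?_ ?_) <;>
        exact Finset.card_image_le.trans_eq (by simp [ZMod.card])
    omega
  rw [← hcard]
  push_cast
  rw [mul_assoc]
  refine le_mul_of_one_le_right (by positivity) ?_
  have h2 := half_pow_le_falling_prod hN hem
  push_cast at h2
  calc (1 : ℝ) = ((N : ℝ) / 2) ^ (numTriangles τ x + 1) * (2 / N) ^ (numTriangles τ x + 1) := by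
        rw [← mul_pow, div_mul_div_comm, mul_comm, div_self (by positivity), one_pow]
    _ ≤ ((N : ℝ) / 2) ^ e * (2 / N) ^ (numTriangles τ x + 1) := by
        gcongr
        linarith
    _ ≤ _ := by gcongr

/-- For a fixed rotation `τ`, the mean number of fixed points of the word with exponents `ε` is the
number of periods of `ε`, up to `O(1 / N)`. -/
theorem exists_abs_sum_card_fixed_sub_le {m : ℕ} [NeZero m] (ε : ZMod m → Bool) :
    ∃ K : ℝ, ∀ N : ℕ, 4 * m ≤ N → ∀ τ ∈ rotations N,
      |∑ σ ∈ involutions N, ((Finset.univ.filter fun y => pathPerm σ τ ε m y = y).card : ℝ) -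
        (periods ε).card * (involutions N).card| ≤ K / N * (involutions N).card := by
  classical
  refine ⟨∑ d ∈ periods ε, (3 * (d : ℝ) ^ 2 + 3 ^ d * (4 * m)) +
    ∑ t ∈ Finset.range (m + 1), ((t : ℝ) ^ m * 3 ^ m) * 2 ^ (t + 1), fun N hN τ hτ => ?_⟩
  have hm0 := Nat.pos_of_ne_zero (NeZero.ne m)
  have hN0 : (0 : ℝ) < N := by exact_mod_cast (by omega : 0 < N)
  set I := ((involutions N).card : ℝ)
  have hI : 0 ≤ I := by positivity
  let P : (ZMod m → Fin N) → ℝ := fun x => ((involutionsThrough x (target τ ε x)).card : ℝ)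
  have hsum : ∑ σ ∈ involutions N,
      ((Finset.univ.filter fun y => pathPerm σ τ ε m y = y).card : ℝ) = ∑ x, P x := by
    have h1 : ∀ σ ∈ involutions N,
        ((Finset.univ.filter fun y => pathPerm σ τ ε m y = y).card : ℝ) =
          ∑ x : ZMod m → Fin N, if ∀ j, σ (x j) = target τ ε x j then (1 : ℝ) else 0 := by
      intro σ hσ
      rw [card_fixed_pathPerm hσ, Finset.sum_boole]
    rw [Finset.sum_congr rfl h1, Finset.sum_comm]
    refine Finset.sum_congr rfl fun x _ => ?_
    rw [Finset.sum_boole]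
    rfl
  set Z := (periods ε).biUnion (cycles m τ)
  have hdpos : ∀ d ∈ periods ε, 0 < d := fun d hd =>
    Nat.pos_of_mem_divisors (Finset.mem_filter.1 hd).1
  have hdvd : ∀ d ∈ periods ε, d ∣ m := fun d hd =>
    Nat.dvd_of_mem_divisors (Finset.mem_filter.1 hd).1
  have hdisj : Set.PairwiseDisjoint (periods ε : Set ℕ) (cycles m τ) := by
    intro d hd d' hd' hne
    rw [Function.onFun, Finset.disjoint_left]
    intro x hx hx'
    exact hne ((mem_cycles.1 hx).unique (mem_cycles.1 hx') (hdpos d hd) (hdpos d' hd'))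
  have hZ : |∑ x ∈ Z, P x - (periods ε).card * I| ≤
      (∑ d ∈ periods ε, (3 * (d : ℝ) ^ 2 + 3 ^ d * (4 * m))) / N * I := by
    rw [Finset.sum_biUnion hdisj, Finset.card_eq_sum_ones, Nat.cast_sum, Finset.sum_mul,
      ← Finset.sum_sub_distrib, Finset.sum_div, Finset.sum_mul]
    refine (Finset.abs_sum_le_sum_abs _ _).trans (Finset.sum_le_sum fun d hd => ?_)
    have hQ0 : (0 : ℝ) < ((∏ i ∈ Finset.range d, (N - 1 - 2 * i) : ℕ) : ℝ) :=
      lt_of_lt_of_le (by positivity) (half_pow_le_falling_prod hN (Nat.le_of_dvd hm0 (hdvd d hd)))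
    have h1 : ∑ x ∈ cycles m τ d, P x = ((cycles m τ d).card : ℝ) /
        ((∏ i ∈ Finset.range d, (N - 1 - 2 * i) : ℕ) : ℝ) * I := by
      rw [div_mul_eq_mul_div, mul_div_assoc, ← nsmul_eq_mul]
      refine Finset.sum_eq_card_nsmul fun x hx => ?_
      rw [eq_div_iff hQ0.ne']
      rw [← Nat.cast_mul]
      exact congrArg Nat.cast ((mem_cycles.1 hx).card_mul_prod hτ ε hd)
    rw [h1, Nat.cast_one, ← sub_mul, abs_mul, abs_of_nonneg hI]
    gcongr
    exact abs_card_cycles_sub_le hN (hdvd d hd)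
  have hZc : ∑ x ∈ Zᶜ, P x ≤
      (∑ t ∈ Finset.range (m + 1), ((t : ℝ) ^ m * 3 ^ m) * 2 ^ (t + 1)) / N * I := by
    calc ∑ x ∈ Zᶜ, P x ≤ ∑ x ∈ Zᶜ, I * (2 / N) ^ (numTriangles τ x + 1) := by
          refine Finset.sum_le_sum fun x hx => card_involutionsThrough_le hτ hN ε fun d hd hc => ?_
          exact Finset.mem_compl.1 hx (Finset.mem_biUnion.2 ⟨d, hd, mem_cycles.2 hc⟩)
      _ ≤ ∑ x : ZMod m → Fin N, I * (2 / (N : ℝ)) ^ (numTriangles τ x + 1) :=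
          Finset.sum_le_sum_of_subset_of_nonneg (Finset.subset_univ _)
            fun _ _ _ => by positivity
      _ = ∑ t ∈ Finset.range (m + 1), ∑ x : ZMod m → Fin N with numTriangles τ x = t,
            I * (2 / (N : ℝ)) ^ (numTriangles τ x + 1) := by
          rw [Finset.sum_fiberwise_of_maps_to]
          intro x _
          rw [Finset.mem_range, Nat.lt_succ_iff]
          exact Finset.card_image_le.trans_eq (by simp [ZMod.card])
      _ ≤ ∑ t ∈ Finset.range (m + 1), ((t : ℝ) ^ m * 3 ^ m) * 2 ^ (t + 1) / N * I := by
          refine Finset.sum_le_sum fun t _ => ?_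
          have h1 : ∑ x : ZMod m → Fin N with numTriangles τ x = t,
              I * (2 / (N : ℝ)) ^ (numTriangles τ x + 1) =
              ((Finset.univ.filter fun x : ZMod m → Fin N => numTriangles τ x = t).card : ℝ) *
                (I * (2 / (N : ℝ)) ^ (t + 1)) := by
            rw [← nsmul_eq_mul]
            refine Finset.sum_eq_card_nsmul fun x hx => ?_
            rw [(Finset.mem_filter.1 hx).2]
          have h2 : ((Finset.univ.filter fun x : ZMod m → Fin N => numTriangles τ x = t).card : ℝ) ≤
              ((t : ℝ) ^ m * 3 ^ m) * (N : ℝ) ^ t := by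
            exact_mod_cast card_numTriangles_eq_le t
          rw [h1]
          calc _ ≤ ((t : ℝ) ^ m * 3 ^ m) * (N : ℝ) ^ t * (I * (2 / (N : ℝ)) ^ (t + 1)) := by
                gcongr
            _ = _ := by
                rw [div_pow, pow_succ (N : ℝ) t]
                field_simp
      _ = _ := by rw [← Finset.sum_mul, ← Finset.sum_div]
  have hZc0 : 0 ≤ ∑ x ∈ Zᶜ, P x := Finset.sum_nonneg fun _ _ => by positivity
  rw [hsum, ← Finset.sum_add_sum_compl Z, add_div, add_mul]
  rw [abs_le] at hZ ⊢
  constructor <;> linarith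

end Mean

/-! ### Traces and fixed points -/

/-- The number of fixed points of a permutation. -/
def numFixed {N : ℕ} (π : Equiv.Perm (Fin N)) : ℕ := (Finset.univ.filter fun y => π y = y).card

theorem numFixed_conj {N : ℕ} (π ρ : Equiv.Perm (Fin N)) :
    numFixed (ρ * π * ρ⁻¹) = numFixed π := by
  refine Finset.card_nbij' (fun y => ρ⁻¹ y) (fun y => ρ y) ?_ ?_ ?_ ?_
  · intro y hy
    rw [Finset.mem_coe, Finset.mem_filter] at *
    refine ⟨Finset.mem_univ _, ?_⟩
    rw [Equiv.Perm.eq_inv_iff_eq]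
    exact hy.2
  · intro y hy
    rw [Finset.mem_coe, Finset.mem_filter] at *
    refine ⟨Finset.mem_univ _, ?_⟩
    change ρ (π (ρ⁻¹ (ρ y))) = ρ y
    rw [show ρ⁻¹ (ρ y) = y from ρ.symm_apply_apply y, hy.2]
  · intro y _
    exact ρ.apply_symm_apply y
  · intro y _
    exact ρ.symm_apply_apply y

theorem trace_pi_eq_sum {N : ℕ} (f : (Fin N → ℂ) →ₗ[ℂ] (Fin N → ℂ)) :
    LinearMap.trace ℂ _ f = ∑ i, f (Pi.single i 1) i := by
  rw [LinearMap.trace_eq_matrix_trace ℂ (Pi.basisFun ℂ (Fin N)), Matrix.trace]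
  refine Finset.sum_congr rfl fun i _ => ?_
  rw [Matrix.diag_apply, LinearMap.toMatrix_apply]
  simp

theorem trace_permRep {N : ℕ} (π : Equiv.Perm (Fin N)) :
    LinearMap.trace ℂ _ (permRep N π) = numFixed π := by
  rw [trace_pi_eq_sum, numFixed, ← Finset.sum_boole]
  refine Finset.sum_congr rfl fun i _ => ?_
  change (Pi.single i 1 : Fin N → ℂ) (π⁻¹ i) = _
  rw [Pi.single_apply]
  refine if_congr ?_ rfl rfl
  rw [Equiv.Perm.inv_eq_iff_eq, eq_comm]

/-- The averaging operator on `ℂ^N`. -/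
def average (N : ℕ) : (Fin N → ℂ) →ₗ[ℂ] (Fin N → ℂ) :=
  LinearMap.pi fun _ => (1 / N : ℂ) • ∑ i, LinearMap.proj i

theorem average_apply {N : ℕ} (v : Fin N → ℂ) (i : Fin N) :
    average N v i = (1 / N : ℂ) * ∑ j, v j := by
  simp [average]

theorem trace_average {N : ℕ} (hN : N ≠ 0) : LinearMap.trace ℂ _ (average N) = 1 := by
  rw [trace_pi_eq_sum]
  simp [average_apply, hN]

/-- The projection of `ℂ^N` onto the vectors of coordinate sum zero. -/
def projSumZero {N : ℕ} (hN : N ≠ 0) : (Fin N → ℂ) →ₗ[ℂ] sumZero N :=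
  (LinearMap.id - average N).codRestrict (sumZero N) fun v => by
    change ∑ i, (v i - average N v i) = 0
    have hN' : (N : ℂ) ≠ 0 := by exact_mod_cast hN
    simp only [average_apply]
    rw [Finset.sum_sub_distrib, Finset.sum_const, Finset.card_univ, Fintype.card_fin,
      nsmul_eq_mul, ← mul_assoc, mul_one_div_cancel hN', one_mul, sub_self]

/-- The trace of the standard representation, computed in `ℂ^N` by means of the projection onto
`sumZero N`. -/
theorem trace_stdRep {N : ℕ} (hN : N ≠ 0) (π : Equiv.Perm (Fin N)) :
    LinearMap.trace ℂ (sumZero N) (stdRep N π) = numFixed π - 1 := by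
  have h1 : stdRep N π = projSumZero hN ∘ₗ (permRep N π ∘ₗ (sumZero N).subtype) := by
    ext v i
    have hv : ∑ i, permRep N π v.1 i = 0 := permRep_mem_sumZero π v.1 v.2
    change permRep N π v.1 i = permRep N π v.1 i - average N (permRep N π v.1) i
    rw [average_apply, hv, mul_zero, sub_zero]
  have h2 : (permRep N π ∘ₗ (sumZero N).subtype) ∘ₗ projSumZero hN = permRep N π - average N := by
    refine LinearMap.ext fun v => funext fun i => ?_
    change v (π⁻¹ i) - average N v (π⁻¹ i) = v (π⁻¹ i) - average N v i
    rw [average_apply, average_apply]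
  rw [h1, LinearMap.trace_comp_comm', h2, map_sub, trace_permRep, trace_average hN]

/-! ### The expansion of the mean trace -/

theorem mem_pairs {n : ℕ} {p : Equiv.Perm (Fin (6 * n)) × Equiv.Perm (Fin (6 * n))} :
    p ∈ pairs n ↔ p.1 ∈ involutions (6 * n) ∧ p.2 ∈ rotations (6 * n) := by
  simp [pairs, mem_involutions, mem_rotations]

/-- Disjoint copies of a fixed-point-free permutation of prime order. -/
theorem exists_perm_orderOf_eq {N k l : ℕ} [hk : Fact k.Prime] (hN : k * l = N) (hl : 0 < l)
    (r : Equiv.Perm (Fin k)) (hr : ∀ i, r i ≠ i) (hrk : r ^ k = 1) :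
    ∃ π : Equiv.Perm (Fin N), orderOf π = k ∧ ∀ i, π i ≠ i := by
  subst hN
  let f : Equiv.Perm (Fin k) →* Equiv.Perm (Fin k × Fin l) :=
    { toFun := fun ρ => Equiv.prodCongr ρ (Equiv.refl _)
      map_one' := rfl
      map_mul' := fun _ _ => rfl }
  let φ : Equiv.Perm (Fin k) →* Equiv.Perm (Fin (k * l)) :=
    (finProdFinEquiv.permCongrHom.toMonoidHom).comp f
  have happ : ∀ i, φ r i ≠ i := by
    intro i h
    have h1 : finProdFinEquiv (r (finProdFinEquiv.symm i).1, (finProdFinEquiv.symm i).2) = i := h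
    rw [← Equiv.eq_symm_apply] at h1
    exact hr _ (congrArg Prod.fst h1)
  refine ⟨φ r, orderOf_eq_prime ?_ ?_, happ⟩
  · rw [← map_pow, hrk, map_one]
  · intro h
    have hpos : 0 < k * l := Nat.mul_pos hk.out.pos hl
    exact happ ⟨0, hpos⟩ (by rw [h]; rfl)

theorem pairs_nonempty {n : ℕ} (hn : 0 < n) : (pairs n).Nonempty := by
  have : Fact (Nat.Prime 2) := ⟨Nat.prime_two⟩
  have : Fact (Nat.Prime 3) := ⟨Nat.prime_three⟩
  obtain ⟨σ, hσ⟩ := exists_perm_orderOf_eq (N := 6 * n) (k := 2) (l := 3 * n) (by ring) (by omega)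
    (finRotate 2) (by decide) (by decide)
  obtain ⟨τ, hτ⟩ := exists_perm_orderOf_eq (N := 6 * n) (k := 3) (l := 2 * n) (by ring) (by omega)
    (finRotate 3) (by decide) (by decide)
  exact ⟨(σ, τ), mem_pairs.2 ⟨mem_involutions.2 hσ, mem_rotations.2 hτ⟩⟩

/-- The mean number of fixed points of `Φ(σ, τ)(γ)`. -/
def meanFixed (n : ℕ) (γ : PSL2Z) : ℝ :=
  (∑ p : pairs n, (numFixed (pairHom p γ) : ℝ)) / (pairs n).card

theorem meanTrace_eq {n : ℕ} (hn : 0 < n) (γ : PSL2Z) :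
    meanTrace n γ = ((meanFixed n γ - 1 : ℝ) : ℂ) / (6 * n) := by
  have hc : ((pairs n).card : ℂ) ≠ 0 := by exact_mod_cast (pairs_nonempty hn).card_ne_zero
  have hn' : (n : ℂ) ≠ 0 := by exact_mod_cast hn.ne'
  have h1 : ∀ p : pairs n, normTrace p γ = (1 / (6 * n : ℂ)) * (numFixed (pairHom p γ) - 1) :=
    fun p => by rw [normTrace, trace_stdRep (by omega)]
  rw [meanTrace, Finset.sum_congr rfl fun p _ => h1 p, ← Finset.mul_sum, Finset.sum_sub_distrib,
    meanFixed]
  push_cast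
  simp only [Finset.sum_const, Finset.card_univ, Fintype.card_coe, nsmul_eq_mul, mul_one]
  field_simp

theorem u₀_eq (γ : PSL2Z) [Decidable (γ = 1)] : u₀ γ = if γ = 1 then 1 else 0 := by
  classical
  rw [u₀, canonTrace, lp.inner_single_left]
  change inner ℂ (1 : ℂ) ((lp.single 2 (1 : PSL2Z) (1 : ℂ) : Ell2) (γ⁻¹ * 1)) = _
  rw [lp.single_apply, mul_one]
  by_cases h : γ = 1
  · simp [h]
  · have : γ⁻¹ ≠ 1 := fun h' => h (inv_eq_one.1 h')
    simp [h, this]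

/-- A first-order expansion of the mean trace determines `u₁`. -/
theorem u₁_eq_and_isBigO {γ : PSL2Z} {a : ℂ} {K : ℝ}
    (h : ∀ᶠ n : ℕ in atTop, ‖meanTrace n γ - (u₀ γ + a / (6 * n : ℂ))‖ ≤ K / (6 * n : ℝ) ^ 2) :
    u₁ γ = a ∧ (fun n : ℕ => meanTrace n γ - (u₀ γ + u₁ γ / (6 * n : ℂ))) =O[atTop]
      fun n : ℕ => 1 / (6 * n : ℝ) ^ 2 := by
  have h1 : a = u₁ γ := by
    refine eq_u₁_of_expansion γ (fun i => if i = 0 then u₀ γ else a) (by simp) 2 le_rfl K ?_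
    filter_upwards [h] with n hn
    simpa [Finset.sum_range_succ] using hn
  refine ⟨h1.symm, IsBigO.of_bound K ?_⟩
  filter_upwards [h] with n hn
  rw [← h1]
  refine hn.trans_eq ?_
  rw [Real.norm_of_nonneg (by positivity)]
  ring

theorem expansion_of_meanFixed {γ : PSL2Z} (hγ : γ ≠ 1) {D K : ℝ}
    (h : ∀ᶠ n : ℕ in atTop, |meanFixed n γ - D| ≤ K / (6 * n)) :
    u₁ γ = ((D - 1 : ℝ) : ℂ) ∧
      (fun n : ℕ => meanTrace n γ - (u₀ γ + u₁ γ / (6 * n : ℂ))) =O[atTop]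
        fun n : ℕ => 1 / (6 * n : ℝ) ^ 2 := by
  classical
  refine u₁_eq_and_isBigO (K := K) ?_
  filter_upwards [h, eventually_gt_atTop 0] with n hn hpos
  have hp : (0 : ℝ) < 6 * n := by positivity
  rw [u₀_eq, if_neg hγ, zero_add, meanTrace_eq hpos, ← sub_div, ← Complex.ofReal_sub, norm_div,
    Complex.norm_real, Real.norm_eq_abs]
  have h6 : ‖(6 * n : ℂ)‖ = 6 * n := by simp
  rw [h6, div_le_iff₀ hp, sub_sub_sub_cancel_right]
  refine hn.trans_eq ?_
  field_simp

theorem expansion_one : u₁ 1 = -1 ∧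
    (fun n : ℕ => meanTrace n 1 - (u₀ 1 + u₁ 1 / (6 * n : ℂ))) =O[atTop]
      fun n : ℕ => 1 / (6 * n : ℝ) ^ 2 := by
  classical
  refine u₁_eq_and_isBigO (K := 0) ?_
  filter_upwards [eventually_gt_atTop 0] with n hpos
  have hn' : (n : ℂ) ≠ 0 := by exact_mod_cast hpos.ne'
  have hc : ((pairs n).card : ℝ) ≠ 0 := by exact_mod_cast (pairs_nonempty hpos).card_ne_zero
  have h1 : meanFixed n 1 = 6 * n := by
    have h2 : ∀ p : pairs n, (numFixed (pairHom p 1) : ℝ) = 6 * n := fun p => by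
      simp [numFixed]
    rw [meanFixed, Finset.sum_congr rfl fun p _ => h2 p, Finset.sum_const, Finset.card_univ,
      Fintype.card_coe, nsmul_eq_mul]
    field_simp
  rw [u₀_eq, if_pos rfl, meanTrace_eq hpos, h1]
  have : ((6 * n - 1 : ℝ) : ℂ) / (6 * n) - (1 + -1 / (6 * n)) = 0 := by
    push_cast
    field_simp
    ring
  rw [this]
  simp

theorem numFixed_pairHom_conj {n : ℕ} (p : pairs n) (v w : PSL2Z) :
    numFixed (pairHom p (v * w * v⁻¹)) = numFixed (pairHom p w) := by
  rw [map_mul, map_mul, map_inv, numFixed_conj]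

/-- Conjugates of `b`, `c` and `c²` act without fixed points. -/
theorem expansion_letter (v : PSL2Z) (x : Letter) : u₁ (v * x.eval * v⁻¹) = -1 ∧
    (fun n : ℕ => meanTrace n (v * x.eval * v⁻¹) -
      (u₀ (v * x.eval * v⁻¹) + u₁ (v * x.eval * v⁻¹) / (6 * n : ℂ))) =O[atTop]
        fun n : ℕ => 1 / (6 * n : ℝ) ^ 2 := by
  have hne : v * x.eval * v⁻¹ ≠ 1 := by
    rw [Ne, conj_eq_one_iff]
    intro h
    have := len_eval x
    simp [h] at this
  have h0 : ∀ n, meanFixed n (v * x.eval * v⁻¹) = 0 := by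
    intro n
    have h2 : ∀ p : pairs n, (numFixed (pairHom p (v * x.eval * v⁻¹)) : ℝ) = 0 := fun p => by
      have hp := mem_pairs.1 p.2
      rw [numFixed_pairHom_conj, Nat.cast_eq_zero, numFixed, Finset.card_eq_zero,
        Finset.filter_eq_empty_iff]
      intro y _
      rcases x with _ | e
      · change ¬ pairHom p b y = y
        rw [pairHom_b]
        exact (mem_involutions.1 hp.1).2 y
      · change ¬ pairHom p (c ^ (e.toNat + 1)) y = y
        rw [map_pow, pairHom_c]
        exact rotation_pow_ne hp.2 e y
    rw [meanFixed, Finset.sum_congr rfl fun p _ => h2 p]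
    simp
  have := expansion_of_meanFixed hne (D := 0) (K := 0) (by
    filter_upwards with n
    simp [h0])
  simpa using this

/-- The exponents of a word, as a function on `ℤ / m`. -/
def exponents (es : List Bool) (j : ZMod es.length) : Bool := es.getD j.val false

theorem map_exponents (es : List Bool) :
    (List.range es.length).map (fun i : ℕ => exponents es i) = es := by
  refine List.ext_getElem (by simp) fun i h1 h2 => ?_
  rw [List.getElem_map, List.getElem_range, exponents, ZMod.val_natCast, Nat.mod_eq_of_lt h2,
    List.getD_eq_getElem _ _ h2]

theorem pairHom_evalBC {n : ℕ} (p : pairs n) (es : List Bool) :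
    pairHom p (evalBC es) = pathPerm p.1.1 p.1.2 (exponents es) es.length := by
  conv_lhs => rw [← map_exponents es]
  rw [evalBC, pathPerm, map_list_prod, List.map_map, List.map_map]
  congr 1
  refine List.map_congr_left fun i _ => ?_
  simp [pairHom_b, pairHom_c]

/-- The first-order coefficient of a hyperbolic element counts its proper roots. -/
theorem expansion_evalBC {es : List Bool} [NeZero es.length] (v : PSL2Z)
    (hne : v * evalBC es * v⁻¹ ≠ 1) :
    u₁ (v * evalBC es * v⁻¹) = (((periods (exponents es)).card - 1 : ℝ) : ℂ) ∧
    (fun n : ℕ => meanTrace n (v * evalBC es * v⁻¹) -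
      (u₀ (v * evalBC es * v⁻¹) + u₁ (v * evalBC es * v⁻¹) / (6 * n : ℂ))) =O[atTop]
        fun n : ℕ => 1 / (6 * n : ℝ) ^ 2 := by
  obtain ⟨K, hK⟩ := exists_abs_sum_card_fixed_sub_le (exponents es)
  refine expansion_of_meanFixed hne (K := K) ?_
  filter_upwards [eventually_gt_atTop es.length] with n hn
  have hpos : 0 < n := by omega
  have hc : (0 : ℝ) < (pairs n).card := by exact_mod_cast (pairs_nonempty hpos).card_pos
  have hprod : pairs n = involutions (6 * n) ×ˢ rotations (6 * n) := by
    ext p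
    rw [mem_pairs, Finset.mem_product]
  have hsum : ∑ p : pairs n, (numFixed (pairHom p (v * evalBC es * v⁻¹)) : ℝ) =
      ∑ τ ∈ rotations (6 * n), ∑ σ ∈ involutions (6 * n),
        (numFixed (pathPerm σ τ (exponents es) es.length) : ℝ) := by
    have h1 : ∀ p : pairs n, (numFixed (pairHom p (v * evalBC es * v⁻¹)) : ℝ) =
        numFixed (pathPerm p.1.1 p.1.2 (exponents es) es.length) := fun p => by
      rw [numFixed_pairHom_conj, pairHom_evalBC]
    rw [Finset.sum_congr rfl fun p _ => h1 p, Finset.sum_coe_sort (pairs n) fun p =>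
      (numFixed (pathPerm p.1 p.2 (exponents es) es.length) : ℝ), hprod, Finset.sum_product_right]
  have hcard : ((pairs n).card : ℝ) = ∑ τ ∈ rotations (6 * n), ((involutions (6 * n)).card : ℝ) := by
    rw [hprod, Finset.card_product, Finset.sum_const, nsmul_eq_mul]
    push_cast
    ring
  rw [meanFixed, div_sub' hc.ne', abs_div, abs_of_pos hc, div_le_iff₀ hc, hsum, hcard,
    Finset.sum_mul, Finset.mul_sum, ← Finset.sum_sub_distrib]
  refine (Finset.abs_sum_le_sum_abs _ _).trans (Finset.sum_le_sum fun τ hτ => ?_)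
  have := hK (6 * n) (by omega) τ hτ
  push_cast at this
  rw [mul_comm ((involutions (6 * n)).card : ℝ)]
  exact this

/-- Every element other than the identity is conjugate to a letter or to a product of elements
`b * c` and `b * c²`. -/
theorem exists_conj_letter_or_evalBC {γ : PSL2Z} (hγ : γ ≠ 1) :
    (∃ v x, γ = v * Letter.eval x * v⁻¹ ∧ NoCancel v x.eval ∧ NoCancel x.eval v⁻¹) ∨
      ∃ v es, es ≠ [] ∧ 2 * es.length ≤ len γ ∧ γ = v * evalBC es * v⁻¹ ∧
        ∀ k, (γ ^ k = 1 → k = 0) := by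
  obtain ⟨v, w, h, h1, h2, h3, h4⟩ := exists_conj γ
  rcases lt_or_ge (len w) 2 with hw | hw
  · left
    rcases hn : nf w with _ | ⟨x, l⟩
    · have : w = 1 := by rw [← evalWord_nf w, hn, evalWord_nil]
      rw [this] at h
      simp at h
      exact absurd h hγ
    · have hl : l = [] := by
        unfold len at hw
        rw [hn] at hw
        simpa using hw
      have : w = x.eval := by rw [← evalWord_nf w, hn, hl, evalWord_singleton]
      subst this
      exact ⟨v, x, h, h1, h2⟩
  · right
    obtain ⟨v', es, h5, h6, h7⟩ := (h4 hw).exists_eq_evalBC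
    refine ⟨v * v', es, h5, by omega, ?_, fun k hk => ?_⟩
    · rw [h, h7]
      group
    · rw [h, conj_pow, conj_eq_one_iff] at hk
      have := (h4 hw).len_pow k
      rw [hk, len_one] at this
      rcases Nat.mul_eq_zero.1 this.symm with h8 | h8
      · exact h8
      · omega

theorem meanTrace_isBigO (γ : PSL2Z) :
    (fun n : ℕ => meanTrace n γ - (u₀ γ + u₁ γ / (6 * n : ℂ))) =O[atTop]
      fun n : ℕ => 1 / (6 * n : ℝ) ^ 2 := by
  by_cases hγ : γ = 1
  · rw [hγ]
    exact expansion_one.2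
  rcases exists_conj_letter_or_evalBC hγ with ⟨v, x, rfl, -, -⟩ | ⟨v, es, hes, -, rfl, -⟩
  · exact (expansion_letter v x).2
  · have : NeZero es.length := ⟨by simpa using hes⟩
    exact (expansion_evalBC v hγ).2

/-- The element `γ` is conjugate to an element of length at most one, by a conjugation without
cancellation on the left. -/
def IsElliptic (γ : PSL2Z) : Prop :=
  ∃ v w, γ = v * w * v⁻¹ ∧ NoCancel v (w * v⁻¹) ∧ len w ≤ 1

/-- A conjugation of a letter without cancellation does not even merge letters, because every
letter of a free factor is `x` or `x⁻¹`. -/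
theorem noCancel_letter_mul_inv {v : PSL2Z} {x : Letter} (h1 : NoCancel v x.eval)
    (h2 : NoCancel x.eval v⁻¹) : NoCancel v (x.eval * v⁻¹) := by
  rcases h2.nf_mul with h | ⟨p', e, q', h3, h4, h5⟩
  · intro y hy hy'
    refine h1 y hy ?_
    rw [h] at hy'
    simpa using hy'
  · rw [nf_eval] at h3
    have hx : x = some e := by
      have := congrArg List.getLast? h3
      simpa using this
    exact absurd (by simp [hx]) (h1 (some e) (by simp [h4]))

/-- The element `γ` is the `k`-th power of a conjugate, without cancellation, of a cyclically reduced
element. -/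
def IsHyperbolicPower (k : ℕ) (γ : PSL2Z) : Prop :=
  ∃ v w, γ = v * w ^ k * v⁻¹ ∧ NoCancel v w ∧ NoCancel w v⁻¹ ∧ CyclicallyReduced w

theorem pow_six_eq_one_of_len_le_one {w : PSL2Z} (h : len w ≤ 1) : w ^ 6 = 1 := by
  have hb : b ^ 6 = 1 := by rw [pow_mul b 2 3, b_sq, one_pow]
  have hc : c ^ 6 = 1 := by rw [pow_mul c 3 2, c_cube, one_pow]
  rcases hn : nf w with _ | ⟨x, l⟩
  · have : w = 1 := by rw [← evalWord_nf w, hn, evalWord_nil]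
    rw [this, one_pow]
  · have hl : l = [] := by
      unfold len at h
      rw [hn] at h
      simpa using h
    have : w = x.eval := by rw [← evalWord_nf w, hn, hl, evalWord_singleton]
    rw [this]
    rcases x with _ | e
    · exact hb
    · rw [Letter.eval, ← pow_mul, mul_comm, pow_mul, hc, one_pow]

/-- A word with a period is a power of its initial segment of that length. -/
theorem evalBC_eq_pow {es : List Bool} [NeZero es.length] {d : ℕ}
    (hd : d ∈ periods (exponents es)) : ∃ g, evalBC es = g ^ (es.length / d) := by
  rw [periods, Finset.mem_filter, Nat.mem_divisors] at hd
  let B : ℕ → PSL2Z := fun k => evalBC ((List.range k).map fun i : ℕ => exponents es i)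
  have hB : ∀ k, B (d + k) = B d * B k := by
    intro k
    simp only [B, evalBC, List.range_add, List.map_append, List.prod_append, List.map_map]
    congr 2
    refine List.map_congr_left fun i _ => ?_
    have := hd.2 i
    simp only [Function.comp_apply, Nat.cast_add, add_comm (d : ZMod es.length), this]
  have hpow : ∀ k, B (d * k) = B d ^ k := by
    intro k
    induction k with
    | zero => simp [B, evalBC]
    | succ k ih => rw [Nat.mul_succ, add_comm, hB, ih, pow_succ']
  refine ⟨B d, ?_⟩
  rw [← hpow, Nat.mul_div_cancel' hd.1.1]
  simp only [B]
  rw [map_exponents]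

/-- The support of `u₁` consists of elements of finite order and of proper powers. A period
`d < m` of a word of `m` factors exhibits it as an `m / d`-th power. -/
theorem isElliptic_or_isHyperbolicPower {γ : PSL2Z} (h : u₁ γ ≠ 0) :
    IsElliptic γ ∨ ∃ k, 2 ≤ k ∧ k ≤ len γ ∧ IsHyperbolicPower k γ := by
  by_cases hγ : γ = 1
  · exact Or.inl ⟨1, 1, by simp [hγ], fun x hx => by simp at hx, by simp⟩
  rcases exists_conj_letter_or_evalBC hγ with ⟨v, x, hx, h1, h2⟩ | ⟨v, es, hes, hlen, hv, hpow⟩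
  · exact Or.inl ⟨v, x.eval, hx, noCancel_letter_mul_inv h1 h2, by simp⟩
  right
  have : NeZero es.length := ⟨by simpa using hes⟩
  have hm0 := Nat.pos_of_ne_zero (NeZero.ne es.length)
  obtain ⟨d, hd, hdm⟩ : ∃ d ∈ periods (exponents es), d ≠ es.length := by
    by_contra hc
    push Not at hc
    have : periods (exponents es) = {es.length} := by
      refine Finset.eq_singleton_iff_unique_mem.2 ⟨?_, hc⟩
      rw [periods, Finset.mem_filter, Nat.mem_divisors]
      exact ⟨⟨dvd_rfl, NeZero.ne _⟩, fun j => by simp⟩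
    refine h ?_
    rw [hv, (expansion_evalBC v (hv ▸ hγ)).1, this]
    simp
  obtain ⟨g, hg⟩ := evalBC_eq_pow hd
  rw [periods, Finset.mem_filter, Nat.mem_divisors] at hd
  obtain ⟨k, hk⟩ := hd.1.1
  have hd0 : 0 < d := Nat.pos_of_dvd_of_pos hd.1.1 hm0
  have hkd : es.length / d = k := by rw [hk, Nat.mul_div_cancel_left _ hd0]
  rw [hkd] at hg
  have hk2 : 2 ≤ k := by
    rcases k with _ | _ | k
    · omega
    · omega
    · omega
  obtain ⟨v', w, h1, h2, h3, -, h4⟩ := exists_conj (v * g * v⁻¹)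
  have hγk : γ = v' * w ^ k * v'⁻¹ := by rw [← conj_pow, ← h1, conj_pow, ← hg, hv]
  refine ⟨k, hk2, ?_, v', w, hγk, h2, h3, h4 ?_⟩
  · have : k ≤ d * k := Nat.le_mul_of_pos_left k hd0
    omega
  -- If `len w ≤ 1`, then `w` and hence `γ` would have finite order.
  · by_contra hc
    have h6 := pow_six_eq_one_of_len_le_one (w := w) (by omega)
    have := hpow 6 (by rw [hγk, conj_pow, ← pow_mul, mul_comm, pow_mul, h6]; simp)
    omega

theorem norm_u₁_le (γ : PSL2Z) : ‖u₁ γ‖ ≤ len γ + 1 := by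
  have h0 : (0 : ℝ) ≤ len γ := by positivity
  by_cases hγ : γ = 1
  · rw [hγ, expansion_one.1]
    simp
  rcases exists_conj_letter_or_evalBC hγ with ⟨v, x, hx, -, -⟩ | ⟨v, es, hes, hlen, hv, -⟩
  · have : u₁ γ = -1 := by rw [hx]; exact (expansion_letter v x).1
    rw [this]
    simp
  · have : NeZero es.length := ⟨by simpa using hes⟩
    have h1 : u₁ γ = (((periods (exponents es)).card - 1 : ℝ) : ℂ) := by
      rw [hv]
      exact (expansion_evalBC v (hv ▸ hγ)).1
    have h2 : (periods (exponents es)).card ≤ es.length :=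
      (Finset.card_filter_le _ _).trans (Nat.card_divisors_le_self _)
    have h3 : ((periods (exponents es)).card : ℝ) ≤ len γ := by exact_mod_cast h2.trans (by omega)
    have h4 : (0 : ℝ) ≤ (periods (exponents es)).card := by positivity
    rw [h1, Complex.norm_real, Real.norm_eq_abs, abs_le]
    constructor <;> linarith

/-! ### Green's functions on `PSL(2, ℤ)` -/

theorem regAlg_apply (α : MonoidAlgebra ℂ PSL2Z) (f : Ell2) (x : PSL2Z) :
    regAlg α f x = ∑ γ ∈ α.coeff.support, α.coeff γ * f (γ⁻¹ * x) := by
  have h1 : regAlg α = ∑ γ ∈ α.coeff.support, α.coeff γ • regRep γ := by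
    rw [regAlg, MonoidAlgebra.lift_apply, Finsupp.sum]
  rw [h1, sum_apply, lp.coeFn_sum, Finset.sum_apply]
  rfl

open scoped Classical in
/-- The unit vector at `x`. -/
def delta (x : PSL2Z) : Ell2 := lp.single 2 x (1 : ℂ)

open scoped Classical in
theorem delta_apply (x y : PSL2Z) : delta x y = if y = x then 1 else 0 := by
  rw [delta, lp.single_apply, Pi.single_apply]

theorem inner_delta_left (x : PSL2Z) (f : Ell2) : inner ℂ (delta x) f = f x := by
  classical
  rw [delta, lp.inner_single_left]
  simp

theorem norm_delta (x : PSL2Z) : ‖delta x‖ = 1 := by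
  classical
  rw [delta, lp.norm_single (by norm_num)]
  simp

theorem regAlg_delta_one_apply (α : MonoidAlgebra ℂ PSL2Z) (x : PSL2Z) :
    regAlg α (delta 1) x = α.coeff x := by
  classical
  rw [regAlg_apply]
  simp only [delta_apply, inv_mul_eq_one]
  simp only [mul_ite, mul_one, mul_zero]
  rw [Finset.sum_ite_eq' α.coeff.support x]
  by_cases h : x ∈ α.coeff.support
  · rw [if_pos h]
  · rw [if_neg h, Finsupp.notMem_support_iff.1 h]

theorem memℓp_rightTranslate (y : PSL2Z) (f : Ell2) :
    Memℓp (fun x : PSL2Z => f (x * y⁻¹)) 2 := by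
  refine memℓp_gen ?_
  have h := (lp.memℓp f).summable (by norm_num)
  exact (Equiv.mulRight y⁻¹).summable_iff.2 h

/-- Right translation `x ↦ f (x y⁻¹)`. -/
def rightTranslate (y : PSL2Z) (f : Ell2) : Ell2 :=
  ⟨fun x => f (x * y⁻¹), memℓp_rightTranslate y f⟩

theorem rightTranslate_apply (y : PSL2Z) (f : Ell2) (x : PSL2Z) :
    rightTranslate y f x = f (x * y⁻¹) := rfl

theorem memℓp_indicator (X : Set PSL2Z) (f : Ell2) : Memℓp (X.indicator f) 2 := by
  refine memℓp_gen (Summable.of_nonneg_of_le (fun _ => by positivity) (fun x => ?_)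
    ((lp.memℓp f).summable (by norm_num)))
  by_cases h : x ∈ X
  · rw [Set.indicator_of_mem h]
  · rw [Set.indicator_of_notMem h]
    simp

/-- The restriction of a vector to a set. -/
def restrict (X : Set PSL2Z) (f : Ell2) : Ell2 := ⟨X.indicator f, memℓp_indicator X f⟩

theorem restrict_apply (X : Set PSL2Z) (f : Ell2) (x : PSL2Z) :
    restrict X f x = X.indicator f x := rfl

/-- The operator `1 - z λ(α)`. -/
def pencil (α : MonoidAlgebra ℂ PSL2Z) (z : ℂ) : Ell2 →L[ℂ] Ell2 := 1 - z • regAlg α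

theorem pencil_apply (α : MonoidAlgebra ℂ PSL2Z) (z : ℂ) (f : Ell2) (x : PSL2Z) :
    pencil α z f x = f x - z * ∑ γ ∈ α.coeff.support, α.coeff γ * f (γ⁻¹ * x) := by
  rw [← regAlg_apply]
  rfl

theorem norm_pencil_apply_le {α : MonoidAlgebra ℂ PSL2Z} {z : ℂ} (h : ‖z‖ * ‖regAlg α‖ < 1)
    (f : Ell2) : ‖pencil α z f‖ ≤ 2 * ‖f‖ := by
  have h1 : ‖regAlg α f‖ ≤ ‖regAlg α‖ * ‖f‖ := (regAlg α).le_opNorm f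
  calc ‖pencil α z f‖ = ‖f - z • regAlg α f‖ := rfl
    _ ≤ ‖f‖ + ‖z • regAlg α f‖ := norm_sub_le _ _
    _ ≤ ‖f‖ + ‖z‖ * (‖regAlg α‖ * ‖f‖) := by rw [norm_smul]; gcongr
    _ ≤ 2 * ‖f‖ := by nlinarith [norm_nonneg f]

/-- The operator `1 - z λ(α)` is accretive. -/
theorem le_re_inner_pencil (α : MonoidAlgebra ℂ PSL2Z) (z : ℂ) (f : Ell2) :
    (1 - ‖z‖ * ‖regAlg α‖) * ‖f‖ ^ 2 ≤ (inner ℂ f (pencil α z f)).re := by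
  have h1 : ‖regAlg α f‖ ≤ ‖regAlg α‖ * ‖f‖ := (regAlg α).le_opNorm f
  have h2 : inner ℂ f (pencil α z f) = inner ℂ f f - inner ℂ f (z • regAlg α f) := by
    rw [← inner_sub_right]
    rfl
  have h3 : (inner ℂ f f : ℂ).re = ‖f‖ ^ 2 := by
    rw [inner_self_eq_norm_sq_to_K]
    norm_cast
  have h4 : (inner ℂ f (z • regAlg α f) : ℂ).re ≤ ‖f‖ * (‖z‖ * (‖regAlg α‖ * ‖f‖)) := by
    refine (Complex.re_le_norm _).trans ((norm_inner_le_norm _ _).trans ?_)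
    rw [norm_smul]
    gcongr
  rw [h2, Complex.sub_re, h3]
  nlinarith

theorem pencil_rightTranslate {α : MonoidAlgebra ℂ PSL2Z} {z : ℂ} {g : Ell2}
    (hg : pencil α z g = delta 1) (y : PSL2Z) : pencil α z (rightTranslate y g) = delta y := by
  classical
  ext x
  have h := congrArg (fun f : Ell2 => f (x * y⁻¹)) hg
  simp only [pencil_apply, delta_apply] at h
  rw [pencil_apply, delta_apply]
  simp only [rightTranslate_apply, ← mul_assoc] at h ⊢
  rw [h]
  simp only [mul_inv_eq_one]

/-- Green's function: the solution `g` of `(1 - z λ(α)) g = δ_e`. -/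
def green (α : MonoidAlgebra ℂ PSL2Z) (z : ℂ) : Ell2 := (∑' p : ℕ, (z • regAlg α) ^ p) (delta 1)

theorem pencil_green {α : MonoidAlgebra ℂ PSL2Z} {z : ℂ} (h : ‖z‖ * ‖regAlg α‖ < 1) :
    pencil α z (green α z) = delta 1 := by
  have h1 : ‖z • regAlg α‖ < 1 := by rwa [norm_smul]
  have := mul_neg_geom_series (z • regAlg α) h1
  exact congrArg (fun T : Ell2 →L[ℂ] Ell2 => T (delta 1)) this

theorem norm_green_le {α : MonoidAlgebra ℂ PSL2Z} {z : ℂ} (h : ‖z‖ * ‖regAlg α‖ < 1) :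
    ‖green α z‖ ≤ 1 / (1 - ‖z‖ * ‖regAlg α‖) := by
  have h1 := le_re_inner_pencil α z (green α z)
  rw [pencil_green h] at h1
  have h2 : (inner ℂ (green α z) (delta 1) : ℂ).re ≤ ‖green α z‖ := by
    refine (Complex.re_le_norm _).trans ((norm_inner_le_norm _ _).trans ?_)
    rw [norm_delta, mul_one]
  have hc : 0 < 1 - ‖z‖ * ‖regAlg α‖ := by linarith
  rcases (norm_nonneg (green α z)).eq_or_lt with h0 | h0
  · rw [← h0]
    positivity
  · rw [le_div_iff₀ hc]
    nlinarith

theorem hasSum_green {α : MonoidAlgebra ℂ PSL2Z} {z : ℂ} (h : ‖z‖ * ‖regAlg α‖ < 1) (x : PSL2Z) :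
    HasSum (fun p : ℕ => z ^ p * (α ^ p).coeff x) (green α z x) := by
  have h1 : ‖z • regAlg α‖ < 1 := by rwa [norm_smul]
  have h2 := (summable_geometric_of_norm_lt_one h1).hasSum
  have h3 := ((ContinuousLinearMap.apply ℂ Ell2 (delta 1)).hasSum h2)
  have h4 := (innerSL ℂ (delta x)).hasSum h3
  simp only [ContinuousLinearMap.apply_apply, innerSL_apply_apply, inner_delta_left] at h4
  have h5 : (fun p : ℕ => z ^ p * (α ^ p).coeff x) =
      fun p : ℕ => ((z • regAlg α) ^ p) (delta 1) x := by
    ext p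
    rw [smul_pow, ← map_pow, ← regAlg_delta_one_apply]
    rfl
  rw [h5]
  exact h4

theorem norm_coeff_pow_le (α : MonoidAlgebra ℂ PSL2Z) (p : ℕ) (x : PSL2Z) :
    ‖(α ^ p).coeff x‖ ≤ ‖regAlg α‖ ^ p := by
  rw [← regAlg_delta_one_apply, ← inner_delta_left]
  refine (norm_inner_le_norm _ _).trans ?_
  rw [norm_delta, one_mul]
  refine ((regAlg (α ^ p)).le_opNorm _).trans ?_
  rw [norm_delta, mul_one, map_pow]
  rcases p with _ | p
  · rw [pow_zero, pow_zero]
    exact ContinuousLinearMap.norm_id_le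
  · exact norm_pow_le' _ p.succ_pos

/-- Green's function between the points of a finite set is accretive. -/
theorem green_matrix_accretive {α : MonoidAlgebra ℂ PSL2Z} {z : ℂ} (h : ‖z‖ * ‖regAlg α‖ < 1)
    (B : Finset PSL2Z) (φ : PSL2Z → ℂ) :
    (1 - ‖z‖ * ‖regAlg α‖) / 4 * ∑ s ∈ B, ‖φ s‖ ^ 2 ≤
      (∑ s ∈ B, (starRingEnd ℂ) (φ s) * ∑ s' ∈ B, φ s' * green α z (s * s'⁻¹)).re := by
  classical
  set ψ : Ell2 := ∑ s' ∈ B, φ s' • rightTranslate s' (green α z)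
  set Φ : Ell2 := ∑ s' ∈ B, φ s' • delta s'
  have hψ : pencil α z ψ = Φ := by
    simp only [ψ, Φ, map_sum, map_smul, pencil_rightTranslate (pencil_green h)]
  have hψa : ∀ s, ψ s = ∑ s' ∈ B, φ s' * green α z (s * s'⁻¹) := by
    intro s
    simp only [ψ, lp.coeFn_sum, Finset.sum_apply]
    rfl
  have hin : ∀ f : Ell2, inner ℂ Φ f = ∑ s ∈ B, (starRingEnd ℂ) (φ s) * f s := by
    intro f
    simp only [Φ, sum_inner, inner_smul_left, inner_delta_left]
  have hΦ : ‖Φ‖ ^ 2 = ∑ s ∈ B, ‖φ s‖ ^ 2 := by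
    have h1 : (inner ℂ Φ Φ : ℂ).re = ‖Φ‖ ^ 2 := by
      rw [inner_self_eq_norm_sq_to_K]
      norm_cast
    rw [← h1, hin, Complex.re_sum]
    refine Finset.sum_congr rfl fun s hs => ?_
    have h2 : Φ s = φ s := by
      simp only [Φ, lp.coeFn_sum, Finset.sum_apply, lp.coeFn_smul, Pi.smul_apply, delta_apply,
        smul_eq_mul, mul_ite, mul_one, mul_zero]
      rw [Finset.sum_ite_eq B s, if_pos hs]
    rw [h2, ← Complex.normSq_eq_conj_mul_self, Complex.ofReal_re, Complex.normSq_eq_norm_sq]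
  have h1 := le_re_inner_pencil α z ψ
  have h2 : (inner ℂ ψ (pencil α z ψ) : ℂ).re = (inner ℂ Φ ψ : ℂ).re := by
    rw [hψ, ← inner_conj_symm, Complex.conj_re]
  have h3 : ‖Φ‖ ≤ 2 * ‖ψ‖ := by
    rw [← hψ]
    exact norm_pencil_apply_le h ψ
  rw [h2, hin] at h1
  simp only [hψa] at h1
  refine le_trans ?_ h1
  rw [← hΦ]
  have h4 : ‖Φ‖ ^ 2 ≤ 4 * ‖ψ‖ ^ 2 := by nlinarith [norm_nonneg Φ, norm_nonneg ψ]
  have hc : 0 < 1 - ‖z‖ * ‖regAlg α‖ := by linarith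
  nlinarith

/-- The linear system whose matrix is Green's function on a finite set can be solved, with a
uniform bound. -/
theorem exists_green_matrix_solution {α : MonoidAlgebra ℂ PSL2Z} {z : ℂ}
    (h : ‖z‖ * ‖regAlg α‖ < 1) (B : Finset PSL2Z) (v : PSL2Z → ℂ) :
    ∃ φ : PSL2Z → ℂ, (∀ s ∈ B, ∑ s' ∈ B, φ s' * green α z (s * s'⁻¹) = v s) ∧
      ∀ s ∈ B, ‖φ s‖ ≤ 4 / (1 - ‖z‖ * ‖regAlg α‖) * ∑ s' ∈ B, ‖v s'‖ := by
  classical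
  have hc : 0 < 1 - ‖z‖ * ‖regAlg α‖ := by linarith
  set k := 1 - ‖z‖ * ‖regAlg α‖
  let M : Matrix B B ℂ := fun s s' => green α z (s.1 * s'.1⁻¹)
  let ext : (B → ℂ) → PSL2Z → ℂ := fun φ s => if hs : s ∈ B then φ ⟨s, hs⟩ else 0
  have hext : ∀ (φ : B → ℂ) (s : B), ext φ s.1 = φ s := fun φ s => by simp [ext, s.2]
  have hM : ∀ (φ : B → ℂ) (s : B),
      ∑ s' ∈ B, ext φ s' * green α z (s.1 * s'⁻¹) = M.mulVec φ s := by
    intro φ s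
    rw [← Finset.sum_coe_sort B]
    refine Finset.sum_congr rfl fun s' _ => ?_
    rw [hext, mul_comm]
  have hinj : Function.Injective M.mulVecLin := by
    rw [← LinearMap.ker_eq_bot, LinearMap.ker_eq_bot']
    intro φ hφ
    have h1 := green_matrix_accretive h B (ext φ)
    have h2 : ∑ s ∈ B, (starRingEnd ℂ) (ext φ s) *
        ∑ s' ∈ B, ext φ s' * green α z (s * s'⁻¹) = 0 := by
      refine Finset.sum_eq_zero fun s hs => ?_
      rw [hM φ ⟨s, hs⟩]
      have := congrFun hφ ⟨s, hs⟩
      rw [Matrix.mulVecLin_apply] at this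
      rw [this]
      simp
    rw [h2, Complex.zero_re] at h1
    have h3 : ∑ s ∈ B, ‖ext φ s‖ ^ 2 ≤ 0 := by
      by_contra hc'
      push Not at hc'
      have : 0 < k / 4 * ∑ s ∈ B, ‖ext φ s‖ ^ 2 := by positivity
      linarith
    ext s
    have h4 : ‖ext φ s.1‖ ^ 2 ≤ ∑ s ∈ B, ‖ext φ s‖ ^ 2 :=
      Finset.single_le_sum (f := fun s => ‖ext φ s‖ ^ 2) (fun _ _ => by positivity) s.2
    rw [hext] at h4
    have h5 : ‖φ s‖ = 0 := by nlinarith [norm_nonneg (φ s)]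
    simpa using h5
  obtain ⟨φ, hφ⟩ := (LinearMap.injective_iff_surjective.1 hinj) fun s : B => v s.1
  have hsol : ∀ s ∈ B, ∑ s' ∈ B, ext φ s' * green α z (s * s'⁻¹) = v s := by
    intro s hs
    rw [hM φ ⟨s, hs⟩]
    exact congrFun hφ ⟨s, hs⟩
  refine ⟨ext φ, hsol, ?_⟩
  set Q := ∑ s ∈ B, ‖ext φ s‖ ^ 2
  set V := ∑ s' ∈ B, ‖v s'‖
  have hQ0 : 0 ≤ Q := Finset.sum_nonneg fun _ _ => by positivity
  have hle : ∀ s ∈ B, ‖ext φ s‖ ≤ √Q := fun s hs =>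
    Real.le_sqrt_of_sq_le (Finset.single_le_sum (f := fun s => ‖ext φ s‖ ^ 2)
      (fun _ _ => by positivity) hs)
  have h1 : k / 4 * Q ≤ √Q * V := by
    refine (green_matrix_accretive h B (ext φ)).trans ((Complex.re_le_norm _).trans
      ((norm_sum_le _ _).trans ?_))
    rw [Finset.mul_sum]
    refine Finset.sum_le_sum fun s hs => ?_
    rw [hsol s hs, norm_mul, RCLike.norm_conj]
    gcongr
    exact hle s hs
  have h2 : √Q ≤ 4 / k * V := by
    rcases (Real.sqrt_nonneg Q).eq_or_lt with h0 | h0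
    · rw [← h0]
      exact mul_nonneg (by positivity) (Finset.sum_nonneg fun _ _ => norm_nonneg _)
    · have h3 : k / 4 * √Q ≤ V := by
        refine le_of_mul_le_mul_left ?_ h0
        calc √Q * (k / 4 * √Q) = k / 4 * (√Q * √Q) := by ring
          _ ≤ √Q * V := by rwa [Real.mul_self_sqrt hQ0]
      calc √Q = 4 / k * (k / 4 * √Q) := by field_simp
        _ ≤ 4 / k * V := by gcongr
  exact fun s hs => (hle s hs).trans h2

/-- If the finite set `B` contains every point of `X` from which a step of `α` leaves `X`, then
Green's function from outside `X` to `X` factors through `B`. -/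
theorem norm_green_le_sum {α : MonoidAlgebra ℂ PSL2Z} {z : ℂ} (h : ‖z‖ * ‖regAlg α‖ < 1)
    {B : Finset PSL2Z} {X : Set PSL2Z}
    (hB : ∀ γ ∈ α.coeff.support, ∀ x ∈ X, γ⁻¹ * x ∉ X → x ∈ B) {x y : PSL2Z}
    (hx : x ∈ X ∨ x ∈ B) (hy : y ∉ X ∨ y ∈ B) :
    ‖green α z (x * y⁻¹)‖ ≤ 4 / (1 - ‖z‖ * ‖regAlg α‖) *
      ∑ s ∈ B, ∑ s' ∈ B, ‖green α z (x * s⁻¹)‖ * ‖green α z (s' * y⁻¹)‖ := by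
  classical
  have hc : 0 < 1 - ‖z‖ * ‖regAlg α‖ := by linarith
  -- Subtract from `green (· * y⁻¹)` the combination of the `green (· * s⁻¹)` that agrees with it
  -- on `B`. The difference `f` vanishes on `B` and is harmonic on the rest of `X`.
  obtain ⟨φ, hφ, hbound⟩ := exists_green_matrix_solution h B fun s => green α z (s * y⁻¹)
  set f : Ell2 := rightTranslate y (green α z) - ∑ s ∈ B, φ s • rightTranslate s (green α z)
  have hfa : ∀ u, f u = green α z (u * y⁻¹) - ∑ s ∈ B, φ s * green α z (u * s⁻¹) := by
    intro u
    simp only [f, lp.coeFn_sub, Pi.sub_apply, lp.coeFn_sum, Finset.sum_apply]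
    rfl
  have hfB : ∀ u ∈ B, f u = 0 := fun u hu => by rw [hfa, hφ u hu, sub_self]
  have hAf : pencil α z f = delta y - ∑ s ∈ B, φ s • delta s := by
    simp only [f, map_sub, map_sum, map_smul, pencil_rightTranslate (pencil_green h)]
  -- The restriction of `f` to `X'` is orthogonal to its image under the pencil, so accretivity
  -- makes it vanish.
  set X' : Set PSL2Z := {u | u ∈ X ∧ u ∉ B}
  have hAfX : ∀ u ∈ X', pencil α z f u = 0 := by
    intro u hu
    have h1 : u ≠ y := by
      rintro rfl
      rcases hy with hy | hy
      · exact hy hu.1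
      · exact hu.2 hy
    rw [hAf]
    simp only [lp.coeFn_sub, Pi.sub_apply, lp.coeFn_sum, Finset.sum_apply, lp.coeFn_smul,
      Pi.smul_apply, delta_apply, if_neg h1, zero_sub, neg_eq_zero]
    refine Finset.sum_eq_zero fun s hs => ?_
    rw [if_neg fun h' : u = s => hu.2 (by rwa [h']), smul_zero]
  have hloc : ∀ u ∈ X', pencil α z (restrict X' f) u = 0 := by
    intro u hu
    rw [← hAfX u hu, pencil_apply, pencil_apply, restrict_apply, Set.indicator_of_mem hu]
    congr 2
    refine Finset.sum_congr rfl fun γ hγ => ?_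
    congr 1
    rw [restrict_apply]
    by_cases h1 : γ⁻¹ * u ∈ X'
    · rw [Set.indicator_of_mem h1]
    · rw [Set.indicator_of_notMem h1]
      by_cases h2 : γ⁻¹ * u ∈ B
      · rw [hfB _ h2]
      · exact absurd (hB γ hγ u hu.1 fun h3 => h1 ⟨h3, h2⟩) hu.2
  have hzero : restrict X' f = 0 := by
    have h1 := le_re_inner_pencil α z (restrict X' f)
    have h2 : inner ℂ (restrict X' f) (pencil α z (restrict X' f)) = 0 := by
      rw [lp.inner_eq_tsum]
      refine (tsum_congr fun u => ?_).trans tsum_zero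
      by_cases hu : u ∈ X'
      · rw [hloc u hu, inner_zero_right]
      · rw [restrict_apply, Set.indicator_of_notMem hu, inner_zero_left]
    rw [h2, Complex.zero_re] at h1
    have h3 : ‖restrict X' f‖ ^ 2 ≤ 0 := by
      by_contra hc'
      push Not at hc'
      have : 0 < (1 - ‖z‖ * ‖regAlg α‖) * ‖restrict X' f‖ ^ 2 := by positivity
      linarith
    have h4 : ‖restrict X' f‖ = 0 := by nlinarith [norm_nonneg (restrict X' f)]
    exact norm_eq_zero.1 h4
  have hfx : f x = 0 := by
    by_cases hxB : x ∈ B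
    · exact hfB x hxB
    · have hx' : x ∈ X' := ⟨hx.resolve_right hxB, hxB⟩
      have := congrArg (fun f : Ell2 => f x) hzero
      simp only [restrict_apply, Set.indicator_of_mem hx'] at this
      simpa using this
  rw [hfa, sub_eq_zero] at hfx
  rw [hfx]
  refine (norm_sum_le _ _).trans ?_
  rw [Finset.mul_sum]
  refine Finset.sum_le_sum fun s hs => ?_
  rw [norm_mul, ← Finset.mul_sum]
  calc ‖φ s‖ * ‖green α z (x * s⁻¹)‖
      ≤ (4 / (1 - ‖z‖ * ‖regAlg α‖) * ∑ s' ∈ B, ‖green α z (s' * y⁻¹)‖) *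
          ‖green α z (x * s⁻¹)‖ := by
        gcongr
        exact hbound s hs
    _ = _ := by ring

/-! ### Sums of Green's function over conjugates of powers -/

/-- The word lengths of the elements occurring in `α` are at most `R`. -/
def HasRange (α : MonoidAlgebra ℂ PSL2Z) (R : ℕ) : Prop := ∀ γ ∈ α.coeff.support, len γ ≤ R

theorem HasRange.mono {α : MonoidAlgebra ℂ PSL2Z} {R R' : ℕ} (h : HasRange α R) (hR : R ≤ R') :
    HasRange α R' := fun γ hγ => (h γ hγ).trans hR

theorem HasRange.pow {α : MonoidAlgebra ℂ PSL2Z} {R : ℕ} (h : HasRange α R) (p : ℕ) :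
    HasRange (α ^ p) (R * p) := by
  classical
  induction p with
  | zero =>
    intro γ hγ
    rw [pow_zero, MonoidAlgebra.one_def, MonoidAlgebra.coeff_single] at hγ
    have := Finsupp.support_single_subset hγ
    rw [Finset.mem_singleton] at this
    simp [this]
  | succ p ih =>
    intro γ hγ
    rw [pow_succ] at hγ
    obtain ⟨x, hx, y, hy, rfl⟩ := Finset.mem_mul.1 (MonoidAlgebra.support_coeff_mul_subset _ _ hγ)
    calc len (x * y) ≤ len x + len y := len_mul_le x y
      _ ≤ R * p + R := add_le_add (ih x hx) (h y hy)
      _ = R * (p + 1) := by ring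

section Green

variable {α : MonoidAlgebra ℂ PSL2Z} {z : ℂ} (h : ‖z‖ * ‖regAlg α‖ < 1)
include h

/-- Green's function almost factors along a product without cancellation: the Cayley graph is
separated by a ball around the end of the first factor. -/
theorem norm_green_mul_le {R : ℕ} (hR : HasRange α R) {u v : PSL2Z}
    (huv : NoCancel u v ∨ len u ≤ R ∨ len v ≤ R) :
    ‖green α z (u * v)‖ ≤ 4 / (1 - ‖z‖ * ‖regAlg α‖) *
      ∑ i ∈ ball R ×ˢ ball R, ‖green α z (u * i.1⁻¹)‖ * ‖green α z (i.2 * v)‖ := by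
  -- The set `X` consists of the elements with the same last letter as `u`. If one of the factors
  -- is short, a trivial set will do.
  obtain ⟨X, hB, hx, hy⟩ : ∃ X : Set PSL2Z,
      (∀ γ ∈ α.coeff.support, ∀ x ∈ X, γ⁻¹ * x ∉ X → x ∈ ball R) ∧
      (u ∈ X ∨ u ∈ ball R) ∧ (v⁻¹ ∉ X ∨ v⁻¹ ∈ ball R) := by
    rcases huv with huv | hu | hv
    · refine ⟨{x | (nf x⁻¹).head? = (nf u⁻¹).head?}, fun γ hγ x hx hγx => ?_, Or.inl rfl, ?_⟩
      · have hne : (nf x⁻¹).head? ≠ (nf (x⁻¹ * γ)).head? := by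
          intro h'
          refine hγx ?_
          simp only [Set.mem_ofPred_eq] at hx ⊢
          rw [mul_inv_rev, inv_inv, ← h', hx]
        have h1 := (noCancel_of_ne hne).len_left_le
        rw [mul_inv_cancel_left] at h1
        exact mem_ball.2 (h1.trans (hR γ hγ))
      · by_cases h0 : (nf v).head? = (nf u⁻¹).head?
        · right
          have h1 : nf v = [] := by
            rcases hn : nf v with _ | ⟨x, l⟩
            · rfl
            · rw [hn] at h0
              exact absurd (by simp [hn]) (huv x (by simpa using h0.symm))
          rw [mem_ball, len_inv, len, h1]
          exact Nat.zero_le _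
        · left
          simpa using h0
    · exact ⟨∅, by simp, Or.inr (mem_ball.2 hu), Or.inl (by simp)⟩
    · exact ⟨Set.univ, by simp, Or.inl trivial, Or.inr (by simpa using hv)⟩
  have := norm_green_le_sum h hB hx hy
  rwa [inv_inv, ← Finset.sum_product'] at this

omit h in
/-- The Cauchy–Schwarz inequality along two injective families. -/
theorem sum_norm_mul_norm_le {ι : Type*} (g : Ell2) (V : Finset ι) (f₁ f₂ : ι → PSL2Z)
    (h₁ : Set.InjOn f₁ V) (h₂ : Set.InjOn f₂ V) :
    ∑ v ∈ V, ‖g (f₁ v)‖ * ‖g (f₂ v)‖ ≤ ‖g‖ ^ 2 := by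
  classical
  have key : ∀ f : ι → PSL2Z, Set.InjOn f V → ∑ v ∈ V, ‖g (f v)‖ ^ 2 ≤ ‖g‖ ^ 2 := by
    intro f hf
    have h1 := lp.sum_rpow_le_norm_rpow (p := 2) (by norm_num) g (V.image f)
    rw [Finset.sum_image hf] at h1
    simpa using h1
  have h3 : ∀ v ∈ V, ‖g (f₁ v)‖ * ‖g (f₂ v)‖ ≤ (‖g (f₁ v)‖ ^ 2 + ‖g (f₂ v)‖ ^ 2) / 2 :=
    fun v _ => by nlinarith [sq_nonneg (‖g (f₁ v)‖ - ‖g (f₂ v)‖)]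
  refine (Finset.sum_le_sum h3).trans ?_
  rw [← Finset.sum_div, Finset.sum_add_distrib]
  linarith [key f₁ h₁, key f₂ h₂]

omit h in
theorem sum_le_sum_product_image {ι : Type*} (F : Finset ι) (v w : ι → PSL2Z)
    (hinj : Set.InjOn (fun i => (v i, w i)) F) (f : PSL2Z → PSL2Z → ℝ) (hf : ∀ x y, 0 ≤ f x y)
    (W : Finset PSL2Z) (hW : ∀ i ∈ F, w i ∈ W) [DecidableEq PSL2Z] :
    ∑ i ∈ F, f (v i) (w i) ≤ ∑ x ∈ F.image v, ∑ y ∈ W, f x y := by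
  rw [← Finset.sum_product', ← Finset.sum_image (f := fun q : PSL2Z × PSL2Z => f q.1 q.2) hinj]
  refine Finset.sum_le_sum_of_subset_of_nonneg ?_ fun _ _ _ => hf _ _
  intro q hq
  obtain ⟨i, hi, rfl⟩ := Finset.mem_image.1 hq
  exact Finset.mem_product.2 ⟨Finset.mem_image_of_mem v hi, hW i hi⟩

/-- Elliptic elements `v w v⁻¹` contribute a bounded amount: after the splitting before `w`, the
conjugator `v` occurs in both factors, and `w` takes finitely many values. -/
theorem sum_norm_green_elliptic_le {R : ℕ} (hR : HasRange α R) (F : Finset PSL2Z)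
    (hF : ∀ γ ∈ F, IsElliptic γ) :
    ∑ γ ∈ F, ‖green α z γ‖ ≤ 4 / (1 - ‖z‖ * ‖regAlg α‖) *
      ((ball R ×ˢ ball R).card * ((ball 1).card * ‖green α z‖ ^ 2)) := by
  classical
  have hc : 0 < 1 - ‖z‖ * ‖regAlg α‖ := by linarith
  set g := green α z
  have hF' : ∀ γ : PSL2Z, ∃ v w, γ ∈ F →
      γ = v * w * v⁻¹ ∧ NoCancel v (w * v⁻¹) ∧ len w ≤ 1 := fun γ => by
    by_cases hγ : γ ∈ F
    · obtain ⟨v, w, h'⟩ := hF γ hγ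
      exact ⟨v, w, fun _ => h'⟩
    · exact ⟨1, 1, fun h' => absurd h' hγ⟩
  choose v w hvw using hF'
  have hinj : Set.InjOn (fun γ => (v γ, w γ)) F := by
    intro γ hγ γ' hγ' heq
    have h1 : v γ = v γ' := congrArg Prod.fst heq
    have h2 : w γ = w γ' := congrArg Prod.snd heq
    rw [(hvw γ hγ).1, (hvw γ' hγ').1, h1, h2]
  calc ∑ γ ∈ F, ‖g γ‖ ≤ ∑ γ ∈ F, 4 / (1 - ‖z‖ * ‖regAlg α‖) *
        ∑ i ∈ ball R ×ˢ ball R, ‖g (v γ * i.1⁻¹)‖ * ‖g (i.2 * (w γ * (v γ)⁻¹))‖ := by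
        refine Finset.sum_le_sum fun γ hγ => ?_
        have h1 := norm_green_mul_le h hR (Or.inl (hvw γ hγ).2.1)
        rwa [← mul_assoc, ← (hvw γ hγ).1] at h1
    _ = 4 / (1 - ‖z‖ * ‖regAlg α‖) * ∑ i ∈ ball R ×ˢ ball R,
          ∑ γ ∈ F, ‖g (v γ * i.1⁻¹)‖ * ‖g (i.2 * (w γ * (v γ)⁻¹))‖ := by
        rw [← Finset.mul_sum, Finset.sum_comm]
    _ ≤ _ := by
        gcongr
        rw [← nsmul_eq_mul]
        refine Finset.sum_le_card_nsmul _ _ _ fun i _ => ?_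
        refine (sum_le_sum_product_image F v w hinj
          (fun x y => ‖g (x * i.1⁻¹)‖ * ‖g (i.2 * (y * x⁻¹))‖) (fun _ _ => by positivity) (ball 1)
          (fun γ hγ => mem_ball.2 (hvw γ hγ).2.2)).trans ?_
        rw [Finset.sum_comm, ← nsmul_eq_mul]
        refine Finset.sum_le_card_nsmul _ _ _ fun y _ => ?_
        exact sum_norm_mul_norm_le g _ _ _ (fun a _ b _ hab => mul_right_cancel hab)
          (fun a _ b _ hab => inv_injective (mul_left_cancel (mul_left_cancel hab)))

omit h in
theorem head?_mul_inv_of_len_lt {p q : PSL2Z} (hpq : len q < len p) :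
    (nf (p * q⁻¹)).head? = (nf p).head? := head?_mul_of_len_lt (by rwa [len_inv])

/-- The index set for the three successive splittings of a conjugate of a power. -/
def splitBox (R : ℕ) :
    Finset ((PSL2Z × PSL2Z) × ((PSL2Z × PSL2Z) × (PSL2Z × PSL2Z))) :=
  (ball R ×ˢ ball R) ×ˢ
    ((ball (2 * R) ×ˢ ball (2 * R)) ×ˢ (ball (2 * R) ×ˢ ball (2 * R)))

/-- Green's function at a conjugate of a power, split at the ends of the conjugator and of the
first copy of the base. -/
theorem norm_green_conj_pow_le {R : ℕ} (hR : HasRange α R) {v w : PSL2Z} {k : ℕ} (hk : k ≠ 0)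
    (h1 : NoCancel v w) (h2 : NoCancel w v⁻¹) (hw : CyclicallyReduced w) :
    ‖green α z (v * w ^ (k + 1) * v⁻¹)‖ ≤ (4 / (1 - ‖z‖ * ‖regAlg α‖)) ^ 3 *
      ∑ i ∈ splitBox R,
        (‖green α z (v * i.2.1.1⁻¹)‖ * ‖green α z (i.2.2.2 * v⁻¹)‖) *
        (‖green α z (i.2.1.2 * (w * i.1.1⁻¹))‖ * ‖green α z (i.1.2 * w ^ k * i.2.2.1⁻¹)‖) := by
  have hc : 0 < 1 - ‖z‖ * ‖regAlg α‖ := by linarith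
  set g := green α z
  set C := 4 / (1 - ‖z‖ * ‖regAlg α‖)
  have hC : 0 ≤ C := by positivity
  have hR2 : HasRange α (2 * R) := hR.mono (by omega)
  have hlenk : 2 ≤ len (w ^ k) := by
    rw [hw.len_pow]
    calc 2 ≤ len w := hw.1
      _ ≤ k * len w := Nat.le_mul_of_pos_left _ (Nat.pos_of_ne_zero hk)
  have hheadinv : (nf (w ^ k)⁻¹).head? = (nf w⁻¹).head? := by
    rw [← inv_pow]
    exact hw.inv.head?_pow hk
  have h2k : NoCancel (w ^ k) v⁻¹ := by
    intro x hx
    rw [hheadinv] at hx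
    exact h2 x hx
  -- The first split, between `v * w` and `w ^ k * v⁻¹`.
  have hs1 : NoCancel (v * w) (w ^ k * v⁻¹) := by
    intro x hx hx'
    rw [mul_inv_rev, h1.symm.head?_mul (by simpa using hw.1)] at hx
    rw [h2k.head?_mul hlenk, hw.head?_pow hk] at hx'
    exact hw.head?_ne_head?_inv x hx' hx
  -- The second split, between `v` and `w * s⁻¹`.
  have hs2 : ∀ s ∈ ball R, NoCancel v (w * s⁻¹) ∨ len v ≤ 2 * R ∨ len (w * s⁻¹) ≤ 2 * R := by
    intro s hs
    rw [mem_ball] at hs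
    rcases lt_or_ge (len s) (len w) with hlt | hge
    · left
      intro x hx
      rw [head?_mul_inv_of_len_lt hlt]
      exact h1 x hx
    · right; right
      have := len_mul_le w s⁻¹
      rw [len_inv] at this
      omega
  -- The third split, between `s' * w ^ k` and `v⁻¹`.
  have hs3 : ∀ s' ∈ ball R,
      NoCancel (s' * w ^ k) v⁻¹ ∨ len (s' * w ^ k) ≤ 2 * R ∨ len v⁻¹ ≤ 2 * R := by
    intro s' hs'
    rw [mem_ball] at hs'
    rcases lt_or_ge (len s') (len (w ^ k)) with hlt | hge
    · left
      intro x hx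
      rw [mul_inv_rev, head?_mul_inv_of_len_lt (by rwa [len_inv]), hheadinv] at hx
      exact h2 x hx
    · right; left
      have := len_mul_le s' (w ^ k)
      omega
  have hfac : v * w ^ (k + 1) * v⁻¹ = v * w * (w ^ k * v⁻¹) := by
    rw [pow_succ']
    group
  calc ‖g (v * w ^ (k + 1) * v⁻¹)‖
      ≤ C * ∑ i ∈ ball R ×ˢ ball R, ‖g (v * w * i.1⁻¹)‖ * ‖g (i.2 * (w ^ k * v⁻¹))‖ := by
        rw [hfac]
        exact norm_green_mul_le h hR (Or.inl hs1)
    _ ≤ C * ∑ i ∈ ball R ×ˢ ball R,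
          (C * ∑ j ∈ ball (2 * R) ×ˢ ball (2 * R),
            ‖g (v * j.1⁻¹)‖ * ‖g (j.2 * (w * i.1⁻¹))‖) *
          (C * ∑ l ∈ ball (2 * R) ×ˢ ball (2 * R),
            ‖g (i.2 * w ^ k * l.1⁻¹)‖ * ‖g (l.2 * v⁻¹)‖) := by
        gcongr with i hi
        · rw [mul_assoc]
          exact norm_green_mul_le h hR2 (hs2 i.1 (Finset.mem_product.1 hi).1)
        · rw [← mul_assoc]
          exact norm_green_mul_le h hR2 (hs3 i.2 (Finset.mem_product.1 hi).2)
    _ = _ := by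
        rw [splitBox, Finset.sum_product (ball R ×ˢ ball R), Finset.mul_sum, Finset.mul_sum]
        refine Finset.sum_congr rfl fun i _ => ?_
        rw [Finset.sum_product (ball (2 * R) ×ˢ ball (2 * R)), mul_mul_mul_comm C _ C,
          Finset.sum_mul_sum, ← mul_assoc, show C * (C * C) = C ^ 3 by ring]
        congr 1
        refine Finset.sum_congr rfl fun j _ => ?_
        refine Finset.sum_congr rfl fun l _ => ?_
        ring

/-- The hyperbolic elements that are `k`-th powers contribute an amount that is bounded uniformly
in `k`: after the splitting, `v` and `w` both occur in two factors, since `w ^ (k - 1)` determines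
`w`. -/
theorem sum_norm_green_hyperbolic_le {R : ℕ} (hR : HasRange α R) {k : ℕ} (hk : 2 ≤ k)
    (F : Finset PSL2Z) (hF : ∀ γ ∈ F, IsHyperbolicPower k γ) :
    ∑ γ ∈ F, ‖green α z γ‖ ≤ (4 / (1 - ‖z‖ * ‖regAlg α‖)) ^ 3 *
      ((splitBox R).card * ‖green α z‖ ^ 4) := by
  classical
  obtain ⟨k, rfl⟩ : ∃ l, k = l + 1 := ⟨k - 1, by omega⟩
  have hk0 : k ≠ 0 := by omega
  have hc : 0 < 1 - ‖z‖ * ‖regAlg α‖ := by linarith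
  have hF' : ∀ γ : PSL2Z, ∃ v w, γ ∈ F → γ = v * w ^ (k + 1) * v⁻¹ ∧
      NoCancel v w ∧ NoCancel w v⁻¹ ∧ CyclicallyReduced w := fun γ => by
    by_cases hγ : γ ∈ F
    · obtain ⟨v, w, h'⟩ := hF γ hγ
      exact ⟨v, w, fun _ => h'⟩
    · exact ⟨1, 1, fun h' => absurd h' hγ⟩
  choose v w hvw using hF'
  have hinj : Set.InjOn (fun γ => (v γ, w γ)) F := by
    intro γ hγ γ' hγ' heq
    have h1 : v γ = v γ' := congrArg Prod.fst heq
    have h2 : w γ = w γ' := congrArg Prod.snd heq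
    rw [(hvw γ hγ).1, (hvw γ' hγ').1, h1, h2]
  set g := green α z
  set C := 4 / (1 - ‖z‖ * ‖regAlg α‖)
  have hC : 0 ≤ C := by positivity
  have hsum : ∀ i ∈ splitBox R, ∑ γ ∈ F,
      (‖g (v γ * i.2.1.1⁻¹)‖ * ‖g (i.2.2.2 * (v γ)⁻¹)‖) *
        (‖g (i.2.1.2 * (w γ * i.1.1⁻¹))‖ * ‖g (i.1.2 * w γ ^ k * i.2.2.1⁻¹)‖) ≤ ‖g‖ ^ 4 := by
    rintro ⟨⟨s, s'⟩, ⟨⟨t, t'⟩, ⟨r, r'⟩⟩⟩ -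
    refine (sum_le_sum_product_image F v w hinj
      (fun x y => (‖g (x * t⁻¹)‖ * ‖g (r' * x⁻¹)‖) *
        (‖g (t' * (y * s⁻¹))‖ * ‖g (s' * y ^ k * r⁻¹)‖)) (fun _ _ => by positivity) (F.image w)
      (fun γ hγ => Finset.mem_image_of_mem w hγ)).trans ?_
    rw [← Finset.sum_mul_sum]
    have h1 : ∑ x ∈ F.image v, ‖g (x * t⁻¹)‖ * ‖g (r' * x⁻¹)‖ ≤ ‖g‖ ^ 2 :=
      sum_norm_mul_norm_le g _ _ _ (fun a _ b _ hab => mul_right_cancel hab)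
        (fun a _ b _ hab => inv_injective (mul_left_cancel hab))
    have h2 : ∑ y ∈ F.image w, ‖g (t' * (y * s⁻¹))‖ * ‖g (s' * y ^ k * r⁻¹)‖ ≤ ‖g‖ ^ 2 := by
      refine sum_norm_mul_norm_le g _ _ _
        (fun a _ b _ hab => mul_right_cancel (mul_left_cancel hab)) (fun a ha b hb hab => ?_)
      obtain ⟨γ, hγ, rfl⟩ := Finset.mem_image.1 (Finset.mem_coe.1 ha)
      obtain ⟨γ', hγ', rfl⟩ := Finset.mem_image.1 (Finset.mem_coe.1 hb)
      exact (hvw γ hγ).2.2.2.eq_of_pow_eq (hvw γ' hγ').2.2.2 hk0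
        (mul_left_cancel (mul_right_cancel hab))
    calc _ ≤ ‖g‖ ^ 2 * ‖g‖ ^ 2 := by
          gcongr
      _ = ‖g‖ ^ 4 := by ring
  calc ∑ γ ∈ F, ‖g γ‖ ≤ ∑ γ ∈ F, C ^ 3 * ∑ i ∈ splitBox R,
        (‖g (v γ * i.2.1.1⁻¹)‖ * ‖g (i.2.2.2 * (v γ)⁻¹)‖) *
        (‖g (i.2.1.2 * (w γ * i.1.1⁻¹))‖ * ‖g (i.1.2 * w γ ^ k * i.2.2.1⁻¹)‖) := by
        refine Finset.sum_le_sum fun γ hγ => ?_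
        obtain ⟨h1, h2, h3, h4⟩ := hvw γ hγ
        have h5 := norm_green_conj_pow_le h hR hk0 h2 h3 h4
        rwa [← h1] at h5
    _ ≤ _ := by
        rw [← Finset.mul_sum, Finset.sum_comm, ← nsmul_eq_mul]
        gcongr
        exact Finset.sum_le_card_nsmul _ _ _ hsum

end Green

/-! ### The spectral radius bound -/

/-- Cauchy's estimate for the coefficients of a power series that converges absolutely on a closed
disc. -/
theorem norm_coeff_mul_pow_le {a : ℕ → ℂ} {r C : ℝ} (hr : 0 ≤ r)
    (ha : Summable fun p => ‖a p‖ * r ^ p)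
    (hC : ∀ z : ℂ, ‖z‖ = r → ‖∑' p, a p * z ^ p‖ ≤ C) (p : ℕ) : ‖a p‖ * r ^ p ≤ C := by
  -- The coefficient is the `p`-th Fourier coefficient of the function on the circle of radius `r`.
  have : Fact ((0 : ℝ) < 1) := ⟨one_pos⟩
  let F : ℕ → AddCircle (1 : ℝ) → ℂ := fun q t =>
    fourier (-(p : ℤ)) t * (a q * (r * fourier 1 t) ^ q)
  have hn1 : ∀ (n : ℤ) (t : AddCircle (1 : ℝ)), ‖fourier n t‖ = 1 := fun n t => by
    rw [fourier_apply]
    exact Circle.norm_coe _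
  have hpow : ∀ (q : ℕ) (t : AddCircle (1 : ℝ)), (fourier 1 t : ℂ) ^ q = fourier (q : ℤ) t := by
    intro q t
    induction q with
    | zero => simp
    | succ q ih => rw [pow_succ, ih, Nat.cast_succ, fourier_add]
  have hnorm : ∀ q t, ‖F q t‖ = ‖a q‖ * r ^ q := by
    intro q t
    simp only [F]
    rw [norm_mul, hn1, one_mul, norm_mul, norm_pow, norm_mul, hn1, mul_one, Complex.norm_real,
      Real.norm_of_nonneg hr]
  have hFeq : ∀ q, ∫ t, F q t ∂AddCircle.haarAddCircle = if q = p then a q * r ^ q else 0 := by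
    intro q
    have h1 : ∀ t, F q t = (a q * r ^ q) * (fourier (-(p : ℤ)) t • fourier (q : ℤ) t) := by
      intro t
      simp only [F, mul_pow, hpow, smul_eq_mul]
      ring
    simp only [h1]
    rw [MeasureTheory.integral_const_mul]
    have h2 := congrFun (fourierCoeff_fourier (T := (1 : ℝ)) (q : ℤ)) (p : ℤ)
    rw [fourierCoeff] at h2
    rw [h2, Pi.single_apply]
    by_cases hqp : q = p
    · simp [hqp]
    · have : (p : ℤ) ≠ q := fun h' => hqp (by exact_mod_cast h'.symm)
      simp [hqp, this]
  have hint : ∀ q, MeasureTheory.Integrable (F q) AddCircle.haarAddCircle := by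
    intro q
    have hcont : Continuous (F q) := by
      simp only [F]
      fun_prop
    exact hcont.integrable_of_hasCompactSupport (HasCompactSupport.of_compactSpace _)
  have hsum := MeasureTheory.hasSum_integral_of_summable_integral_norm hint (by
    simp only [hnorm]
    simpa using ha)
  simp only [hFeq] at hsum
  have hF : ∀ t, ‖∑' q, F q t‖ ≤ C := by
    intro t
    simp only [F, tsum_mul_left]
    rw [norm_mul, hn1, one_mul]
    refine hC _ ?_
    rw [norm_mul, hn1, mul_one, Complex.norm_real, Real.norm_of_nonneg hr]
  have h3 : a p * (r : ℂ) ^ p = ∫ t, ∑' q, F q t ∂AddCircle.haarAddCircle := by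
    refine HasSum.unique ?_ hsum
    simpa using hasSum_single (f := fun q => if q = p then a q * (r : ℂ) ^ q else 0) p
      fun q hq => if_neg hq
  have h5 := MeasureTheory.norm_integral_le_of_norm_le_const
    (μ := AddCircle.haarAddCircle (T := 1)) (Eventually.of_forall hF)
  rw [← h3] at h5
  simpa [Real.norm_of_nonneg hr, abs_of_nonneg hr] using h5

/-- Bounds for the elliptic elements and for the `k`-th powers combine to a bound in which the word
length enters polynomially: it limits both `u₁` and the exponents `k`. -/
theorem sum_norm_u₁_mul_green_le {α : MonoidAlgebra ℂ PSL2Z} {z : ℂ} {E H : ℝ}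
    (hE : ∀ F : Finset PSL2Z, (∀ γ ∈ F, IsElliptic γ) → ∑ γ ∈ F, ‖green α z γ‖ ≤ E)
    (hH : ∀ k, 2 ≤ k → ∀ F : Finset PSL2Z, (∀ γ ∈ F, IsHyperbolicPower k γ) →
      ∑ γ ∈ F, ‖green α z γ‖ ≤ H)
    (L : ℕ) (F : Finset PSL2Z) (hF : ∀ γ ∈ F, len γ ≤ L) :
    ∑ γ ∈ F, ‖u₁ γ‖ * ‖green α z γ‖ ≤ (E + H) * (L + 1) ^ 2 := by
  classical
  have hE0 : 0 ≤ E := by simpa using hE ∅ (by simp)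
  have hH0 : 0 ≤ H := by simpa using hH 2 le_rfl ∅ (by simp)
  have hterm : ∀ γ ∈ F, ‖u₁ γ‖ * ‖green α z γ‖ ≤ (L + 1) *
      ((if IsElliptic γ then ‖green α z γ‖ else 0) +
        ∑ k ∈ Finset.Icc 2 L, if IsHyperbolicPower k γ then ‖green α z γ‖ else 0) := by
    intro γ hγ
    have hnn : ∀ P : Prop, ∀ _ : Decidable P, 0 ≤ if P then ‖green α z γ‖ else 0 := by
      intro P _
      split_ifs
      · exact norm_nonneg _
      · exact le_rfl
    have hsnn : 0 ≤ ∑ k ∈ Finset.Icc 2 L, if IsHyperbolicPower k γ then ‖green α z γ‖ else 0 :=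
      Finset.sum_nonneg fun k _ => hnn _ _
    by_cases h0 : u₁ γ = 0
    · rw [h0, norm_zero, zero_mul]
      have := hnn (IsElliptic γ) inferInstance
      positivity
    · have hu : ‖u₁ γ‖ ≤ L + 1 := (norm_u₁_le γ).trans (by gcongr; exact hF γ hγ)
      refine mul_le_mul hu ?_ (norm_nonneg _) (by positivity)
      rcases isElliptic_or_isHyperbolicPower h0 with he | ⟨k, hk2, hkl, hk⟩
      · rw [if_pos he]
        linarith
      · have h1 := Finset.single_le_sum
          (f := fun k => if IsHyperbolicPower k γ then ‖green α z γ‖ else 0)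
          (fun k _ => hnn _ _) (Finset.mem_Icc.2 ⟨hk2, hkl.trans (hF γ hγ)⟩)
        simp only [if_pos hk] at h1
        have := hnn (IsElliptic γ) inferInstance
        linarith
  refine (Finset.sum_le_sum hterm).trans ?_
  rw [← Finset.mul_sum, Finset.sum_add_distrib, Finset.sum_comm]
  have h1 : (∑ γ ∈ F, if IsElliptic γ then ‖green α z γ‖ else 0) ≤ E := by
    rw [← Finset.sum_filter]
    exact hE _ fun γ hγ => (Finset.mem_filter.1 hγ).2
  have h2 : (∑ k ∈ Finset.Icc 2 L, ∑ γ ∈ F, if IsHyperbolicPower k γ then ‖green α z γ‖ else 0) ≤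
      (L + 1) * H := by
    refine (Finset.sum_le_card_nsmul _ _ H fun k hk => ?_).trans ?_
    · rw [← Finset.sum_filter]
      exact hH k (Finset.mem_Icc.1 hk).1 _ fun γ hγ => (Finset.mem_filter.1 hγ).2
    · rw [nsmul_eq_mul]
      gcongr
      rw [Nat.card_Icc]
      exact_mod_cast (by omega : L + 1 - 2 ≤ L + 1)
  calc (L + 1 : ℝ) * _ ≤ (L + 1) * (E + (L + 1) * H) := by gcongr
    _ ≤ (E + H) * (L + 1) ^ 2 := by nlinarith [mul_nonneg (Nat.cast_nonneg (α := ℝ) L) hE0]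

/-- Up to a polynomial factor, `u₁(α ^ p)` is at most `r⁻ᵖ` for every circle of radius `r` inside
the disc of convergence of Green's function. -/
theorem exists_norm_u₁Alg_pow_le (α : MonoidAlgebra ℂ PSL2Z) {r : ℝ} (hr : 0 ≤ r)
    (h : r * ‖regAlg α‖ < 1) :
    ∃ (K : ℝ) (R : ℕ), ∀ p : ℕ, ‖u₁Alg (α ^ p)‖ * r ^ p ≤ K * (R * p + 1) ^ 2 := by
  classical
  obtain ⟨R, hR⟩ : ∃ R, HasRange α R :=
    ⟨α.coeff.support.sup len, fun γ hγ => Finset.le_sup (f := len) hγ⟩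
  have hc : 0 < 1 - r * ‖regAlg α‖ := by linarith
  set k := 1 - r * ‖regAlg α‖
  set E := 4 / k * ((ball R ×ˢ ball R).card * ((ball 1).card * (1 / k) ^ 2))
  set H := (4 / k) ^ 3 * ((splitBox R).card * (1 / k) ^ 4)
  refine ⟨E + H, R, fun p => ?_⟩
  set F := (α ^ p).coeff.support
  -- The exponent `p` is fixed, and `u₁` is cut off to the support of `α ^ p`, so that the power
  -- series in `q` is a finite combination of values of Green's function.
  set a : ℕ → ℂ := fun q => ∑ γ ∈ F, (α ^ q).coeff γ * u₁ γ
  have hap : a p = u₁Alg (α ^ p) := rfl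
  have ha : Summable fun q => ‖a q‖ * r ^ q := by
    refine Summable.of_nonneg_of_le (fun q => by positivity) (fun q => ?_)
      ((summable_geometric_of_lt_one (mul_nonneg hr (norm_nonneg _)) h).mul_left
        (∑ γ ∈ F, ‖u₁ γ‖))
    rw [mul_pow, mul_comm (r ^ q), ← mul_assoc]
    gcongr
    rw [Finset.sum_mul]
    refine (norm_sum_le _ _).trans (Finset.sum_le_sum fun γ _ => ?_)
    rw [norm_mul, mul_comm]
    gcongr
    exact norm_coeff_pow_le α q γ
  rw [← hap]
  refine norm_coeff_mul_pow_le hr ha (fun z hz => ?_) p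
  have hz1 : ‖z‖ * ‖regAlg α‖ < 1 := by rwa [hz]
  have hg : ‖green α z‖ ≤ 1 / k := by
    have := norm_green_le hz1
    rwa [hz] at this
  have hsum : HasSum (fun q => a q * z ^ q) (∑ γ ∈ F, u₁ γ * green α z γ) := by
    have h1 := hasSum_sum (s := F) fun γ _ => (hasSum_green hz1 γ).mul_left (u₁ γ)
    refine h1.congr_fun fun q => ?_
    rw [Finset.sum_mul]
    exact Finset.sum_congr rfl fun γ _ => by ring
  rw [hsum.tsum_eq]
  refine (norm_sum_le _ _).trans ?_
  simp only [norm_mul]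
  have hlen := hR.pow p
  refine (sum_norm_u₁_mul_green_le (E := E) (H := H) (fun F' hF' => ?_)
    (fun l hl F' hF' => ?_) (R * p) F hlen).trans (by push_cast; exact le_rfl)
  · refine (sum_norm_green_elliptic_le hz1 hR F' hF').trans ?_
    rw [hz]
    change 4 / k * ((ball R ×ˢ ball R).card * ((ball 1).card * ‖green α z‖ ^ 2)) ≤
      4 / k * ((ball R ×ˢ ball R).card * ((ball 1).card * (1 / k) ^ 2))
    gcongr
  · refine (sum_norm_green_hyperbolic_le hz1 hR hl F' hF').trans ?_
    rw [hz]
    change (4 / k) ^ 3 * ((splitBox R).card * ‖green α z‖ ^ 4) ≤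
      (4 / k) ^ 3 * ((splitBox R).card * (1 / k) ^ 4)
    gcongr

theorem eventually_norm_u₁Alg_pow_le (α : MonoidAlgebra ℂ PSL2Z) {y : ℝ} (hy : ‖regAlg α‖ < y) :
    ∀ᶠ p : ℕ in atTop, ‖u₁Alg (α ^ p)‖ ≤ y ^ p := by
  obtain ⟨x, hx, hxy⟩ := exists_between hy
  have hx0 : 0 < x := (norm_nonneg _).trans_lt hx
  have hy0 : 0 < y := hx0.trans hxy
  obtain ⟨K, R, hK⟩ := exists_norm_u₁Alg_pow_le α (r := x⁻¹) (by positivity) (by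
    rwa [inv_mul_lt_iff₀ hx0, mul_one])
  have hlim : Tendsto (fun p : ℕ => K * (R * p + 1) ^ 2 * (x / y) ^ p) atTop (𝓝 0) := by
    have hlt : |x / y| < 1 := by
      rwa [abs_of_pos (by positivity), div_lt_one hy0]
    have h2 := (tendsto_pow_const_mul_const_pow_of_abs_lt_one 2 hlt).const_mul (K * R ^ 2)
    have h1 := (tendsto_pow_const_mul_const_pow_of_abs_lt_one 1 hlt).const_mul (2 * K * R)
    have h0 := (tendsto_pow_const_mul_const_pow_of_abs_lt_one 0 hlt).const_mul K
    have h3 := (h2.add h1).add h0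
    simp only [mul_zero, add_zero] at h3
    refine h3.congr fun p => ?_
    ring
  filter_upwards [hlim.eventually (gt_mem_nhds one_pos)] with p hp
  have h1 := hK p
  rw [inv_pow, ← div_eq_mul_inv, div_le_iff₀ (by positivity)] at h1
  have h2 : K * (R * p + 1) ^ 2 * x ^ p ≤ 1 * y ^ p := by
    rw [div_pow, ← mul_div_assoc] at hp
    exact ((div_lt_iff₀ (by positivity)).1 hp).le
  linarith

theorem limsup_u₁Alg_pow_le (α : MonoidAlgebra ℂ PSL2Z) :
    limsup (fun p : ℕ => ‖u₁Alg (α ^ p)‖ₑ ^ (1 / (p : ℝ))) atTop ≤ ‖regAlg α‖ₑ := by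
  refine ENNReal.le_of_forall_pos_le_add fun ε hε _ => ?_
  have hy : ‖regAlg α‖ < ‖regAlg α‖ + ε := by
    have : (0 : ℝ) < ε := hε
    linarith
  have hE : ‖regAlg α‖ₑ + ε = ENNReal.ofReal (‖regAlg α‖ + ε) := by
    rw [ENNReal.ofReal_add (norm_nonneg _) ε.coe_nonneg, ofReal_norm, ENNReal.ofReal_coe_nnreal]
  rw [hE]
  refine limsup_le_of_le (by isBoundedDefault) ?_
  filter_upwards [eventually_norm_u₁Alg_pow_le α hy, eventually_gt_atTop 0] with p hp hp0
  rw [one_div, ENNReal.rpow_inv_le_iff (by exact_mod_cast hp0), ENNReal.rpow_natCast,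
    ← ENNReal.ofReal_pow (by positivity), ← ofReal_norm]
  exact ENNReal.ofReal_le_ofReal hp

end BrooksMakover

end

theorem proposition3p4 :
    (∀ γ : BrooksMakover.PSL2Z,
      (fun n : ℕ => BrooksMakover.meanTrace n γ -
          (BrooksMakover.u₀ γ + BrooksMakover.u₁ γ / (6 * n : ℂ)))
        =O[atTop] fun n : ℕ => 1 / (6 * n : ℝ) ^ 2) ∧
    ∀ α : MonoidAlgebra ℂ BrooksMakover.PSL2Z, BrooksMakover.IsSelfAdj α →
      limsup (fun p : ℕ => ‖BrooksMakover.u₁Alg (α ^ p)‖ₑ ^ (1 / (p : ℝ))) atTop ≤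
        ‖BrooksMakover.regAlg α‖ₑ :=
  ⟨BrooksMakover.meanTrace_isBigO, fun α _ => BrooksMakover.limsup_u₁Alg_pow_le α⟩
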